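/- **Setting.** Let $B_1(0)\subset\mathbb R^2$ be the open unit disk and $L>0$. Let $M_L$ be the set of closed, simple $C^2$-curves $\gamma:[0,L]\to B_1(0)$ with $|\gamma'|=1$, where closed means that the $L$-periodic extension of $\gamma$ is $C^2$. We identify $\gamma$ with its trace, and put $\mathcal B(\gamma)=\int_0^L|\gamma''(s)|^2\,ds$. Let $W(r)=\frac14(1-r^2)^2$ and $c_0=\int_{-1}^1\sqrt{2W(s)}\,ds$. For $\varepsilon,\alpha,\beta>0$ and $u$ of class $C^2$ set $$\mu_\varepsilon=\frac1{c_0}\Big(\frac\varepsilon2|\nabla u|^2+\frac1\varepsilon W(u)\Big)\,dx \ \text{ on } B_1(0),\qquad L_\varepsilon(u)=\mu_\varepsilon(B_1(0)),$$ $$\mathcal B_\varepsilon(u)=\frac1{c_0}\int_{B_1(0)}\frac1\varepsilon\Big(-\varepsilon\Delta u+\frac1\varepsilon W'(u)\Big)^2dx,\qquad T_\varepsilon(u)=\frac1{c_0}\int_{B_1(0)}\Big(-\varepsilon\Delta u+\frac1\varepsilon W'(u)\Big)|\nabla u|\,dx,$$ $$\mathcal F_\varepsilon(u)=\mathcal B_\varepsilon(u)+\varepsilon^{-\alpha}(L_\varepsilon(u)-L)^2+\varepsilon^{-\beta}(T_\varepsilon(u)-2\pi)^2.$$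 Let $q(r)=\tanh(r/\sqrt2)$. A *cut-off* is an even function $\eta\in C^\infty(\mathbb R)$ with $0\le\eta\le1$, $\eta=1$ on $[-1,1]$, $\eta(r)=0$ for $|r|\ge2$, and $\eta'(r)\le0$ for $r\ge0$. For $\gamma\in M_L$ let $d$ be the signed distance from $\gamma$, positive in the region inside $\gamma$ (the union of the bounded connected components of $\mathbb R^2\setminus\gamma$) and nonpositive elsewhere. For $\delta,\varepsilon>0$ and a cut-off $\eta$ set $$q_\varepsilon(r)=\eta\Big(\frac{2r}\delta\Big)q\Big(\frac r\varepsilon\Big)+\operatorname{sgn}(r)\Big(1-\eta\Big(\frac{2r}\delta\Big)\Big),\qquad u_\varepsilon(x)=q_\varepsilon(d(x))\quad(x\in\mathbb R^2).$$ **Lemma.** Let $\gamma\in M_L$. There is $\delta_0>0$ such that for every cut-off $\eta$ and every $\delta\in(0,\delta_0)$ the following holds. 1. For all $\varepsilon>0$ the function $u_\varepsilon$ is of class $C^2$ with values in $[-1,1]$, and $u_\varepsilon(x)=-1$, $\nabla u_\varepsilon(x)\cdot x=0$ for all $|x|=1$. 2. The diffuse interface measures $\mu_\varepsilon$ of $u_\varepsilon$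 converge to $\mathcal H^1\lfloor\gamma$ as $\varepsilon\to0^+$: $\int\xi\,d\mu_\varepsilon\to\int_\gamma\xi\,d\mathcal H^1$ for every $\xi\in C^0(B_1(0))$. 3. There are constants $c_1,c_2>0$ such that, as $\varepsilon\to0^+$, $$L_\varepsilon(u_\varepsilon)=L+O(e^{-c_1/\varepsilon}),\qquad T_\varepsilon(u_\varepsilon)=2\pi+O(e^{-c_2/\varepsilon}),\qquad \mathcal B_\varepsilon(u_\varepsilon)=\mathcal B(\gamma)+O(\varepsilon^2).$$ 4. For all $\alpha,\beta>0$, $\mathcal F_\varepsilon(u_\varepsilon)\to\mathcal B(\gamma)$ as $\varepsilon\to0^+$. -/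

import Mathlib

open MeasureTheory Set Filter Topology Asymptotics
open scoped ContDiff Laplacian Gradient

noncomputable section

namespace PhaseField

/-- The Euclidean plane `ℝ²`. -/
abbrev Plane := EuclideanSpace ℝ (Fin 2)

/-- The open unit disk `B₁(0)`. -/
def disk : Set Plane := Metric.ball 0 1

/-! ### Sharp interface -/

/-- The class `M_L` of simple closed `C²` curves of length `L` in the open unit disk, parametrized by
arclength.  A curve on `[0, L]` that closes up in the `C²` sense is represented by its `L`-periodic
extension to `ℝ`. -/
structure IsAdmissible (L : ℝ) (γ : ℝ → Plane) : Prop where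
  contDiff : ContDiff ℝ 2 γ
  closed : Function.Periodic γ L
  simple : InjOn γ (Ico 0 L)
  unit_speed : ∀ s, ‖deriv γ s‖ = 1
  mem_disk : ∀ s, γ s ∈ disk

/-- The support (trace) of a curve on `[0, L]`. -/
def trace (L : ℝ) (γ : ℝ → Plane) : Set Plane := γ '' Icc 0 L

/-- Euler's elastica energy `∫₀ᴸ |γ''|²`. -/
def elastica (L : ℝ) (γ : ℝ → Plane) : ℝ := ∫ s in (0 : ℝ)..L, ‖deriv (deriv γ) s‖ ^ 2

/-- The region inside of `Γ`: the union of the bounded connected components of the complement. -/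
def inside (Γ : Set Plane) : Set Plane :=
  {x | x ∈ Γᶜ ∧ Bornology.IsBounded (connectedComponentIn Γᶜ x)}

open Classical in
/-- The signed distance from `Γ`, positive inside. -/
def signedDist (Γ : Set Plane) (x : Plane) : ℝ :=
  if x ∈ inside Γ then Metric.infDist x Γ else -Metric.infDist x Γ

/-! ### Diffuse functionals -/

/-- The double-well potential `W(r) = (1 - r²)² / 4`. -/
def W (r : ℝ) : ℝ := 1 / 4 * (1 - r ^ 2) ^ 2

/-- The constant `c₀ = ∫_{-1}^{1} √(2W)`. -/
def c₀ : ℝ := ∫ s in (-1 : ℝ)..1, √(2 * W s)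

/-- The energy density `ε/2 |∇u|² + W(u)/ε`. -/
def energyDensity (ε : ℝ) (u : Plane → ℝ) (x : Plane) : ℝ :=
  ε / 2 * ‖∇ u x‖ ^ 2 + 1 / ε * W (u x)

/-- The diffuse mean curvature `-ε Δu + W'(u)/ε`. -/
def diffuseCurvature (ε : ℝ) (u : Plane → ℝ) (x : Plane) : ℝ :=
  -ε * (Δ u) x + 1 / ε * deriv W (u x)

/-- The diffuse length `L_ε(u)`. -/
def diffuseLength (ε : ℝ) (u : Plane → ℝ) : ℝ :=
  1 / c₀ * ∫ x in disk, energyDensity ε u x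

/-- The diffuse elastica energy `B_ε(u)`. -/
def diffuseElastica (ε : ℝ) (u : Plane → ℝ) : ℝ :=
  1 / c₀ * ∫ x in disk, 1 / ε * diffuseCurvature ε u x ^ 2

/-- The diffuse winding number `T_ε(u)`. -/
def diffuseWinding (ε : ℝ) (u : Plane → ℝ) : ℝ :=
  1 / c₀ * ∫ x in disk, diffuseCurvature ε u x * ‖∇ u x‖

/-- The total energy `F_ε(u)` with target length `L` and penalty exponents `α`, `β`. -/
def totalEnergy (L α β ε : ℝ) (u : Plane → ℝ) : ℝ :=
  diffuseElastica ε u + ε ^ (-α) * (diffuseLength ε u - L) ^ 2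
    + ε ^ (-β) * (diffuseWinding ε u - 2 * Real.pi) ^ 2

/-- The diffuse interface measure `μ_ε = c₀⁻¹ (ε/2 |∇u|² + W(u)/ε) dx` on the unit disk. -/
def interfaceMeasure (ε : ℝ) (u : Plane → ℝ) : Measure Plane :=
  (volume.restrict disk).withDensity fun x => ENNReal.ofReal (1 / c₀ * energyDensity ε u x)

/-! ### The recovery sequence -/

/-- The optimal profile. -/
def q (r : ℝ) : ℝ := Real.tanh (r / √2)

/-- A smooth symmetric cut-off function, nonincreasing on the positive half line. -/
structure IsCutoff (η : ℝ → ℝ) : Prop where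
  smooth : ContDiff ℝ ∞ η
  even : ∀ r, η (-r) = η r
  nonneg : ∀ r, 0 ≤ η r
  le_one : ∀ r, η r ≤ 1
  eq_one : ∀ r ∈ Icc (-1 : ℝ) 1, η r = 1
  eq_zero : ∀ r, 2 ≤ |r| → η r = 0
  deriv_nonpos : ∀ r, 0 ≤ r → deriv η r ≤ 0

/-- The profile `q(r/ε)`, interpolated to `sgn r` in the region `δ/2 ≤ |r| ≤ δ`. -/
def qCut (η : ℝ → ℝ) (δ ε r : ℝ) : ℝ :=
  η (2 * r / δ) * q (r / ε) + Real.sign r * (1 - η (2 * r / δ))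

/-- The phase field `u_ε = q_ε(d)`, where `d` is the signed distance from `Γ`. -/
def recovery (Γ : Set Plane) (η : ℝ → ℝ) (δ ε : ℝ) (x : Plane) : ℝ :=
  qCut η δ ε (signedDist Γ x)

end PhaseField

end

/-! In normal coordinates `tube γ s r = γ s + r • normal γ s` the plane near the curve is
parametrized injectively with Jacobian `1 - rκ(s)`, and the signed distance is `r`
(`signedDist_tube`). There `u_ε = q_ε(r)`, `|∇u_ε| = q_ε'(r)` and `Δu_ε = q_ε'' - q_ε' κ/(1 - rκ)`
(`comp_normalCoordinate`), while at distance more than `δ` the function is locally `1` or `-1`. Each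
functional therefore becomes an integral over `r ∈ [-δ, δ]` of a profile density times an average
over `s` (`integral_disk_eq`).

The profile solves `q' = √(2W(q))`, hence `q'' = W'(q)`. For `|r| < δ/2` the energy density and `ε
q_ε'²` both equal an even function `peak`, whose mass on `[-δ, δ]` is `c₀` up to an exponentially
small error and whose second moment is `O(ε²)`. The defect `a = -ε q_ε'' + W'(q_ε)/ε` vanishes there
and is exponentially small in the layer `δ/2 ≤ |r| ≤ δ` (`exists_qCut_tail_bound`).

By Hopf's Umlaufsatz (`integral_curvature`) the Jacobian averages to `L - 2πr`. In the length the
linear term is odd and disappears. In the winding number the integrand is `a q_ε'(1 - rκ) + ε q_ε'²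
κ`, whose main part integrates to `2π ∫ ε q_ε'²`. Only exponentially small errors remain. In the
elastica energy the main part is `ε q_ε'² κ²/(1 - rκ)` with `κ²/(1 - rκ) = κ² + κ³ r + O(r²)`; the
odd term drops and the second moment gives `O(ε²)`. Exponential errors beat the penalty factors
`ε^(-α)`, `ε^(-β)`.

Two global facts enter. The Umlaufsatz is proved by lifting the angle of chords over a triangle of
parameters, starting at a lowest point of the curve. That the positive normals point inside follows
from a separation argument (`separation`), based on a continuous logarithm on the plane. -/

namespace PhaseField

/-! ### The optimal profile -/

/-- The first-order equation `q' = √(2W(q))`; it is the source of the equipartition of energy and of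
`q'' = W'(q)`. -/
theorem hasDerivAt_q (r : ℝ) : HasDerivAt q ((1 - q r ^ 2) / √2) r := by
  have hc : Real.cosh (r / √2) ≠ 0 := (Real.cosh_pos _).ne'
  have h1 : HasDerivAt (fun r : ℝ => r / √2) (1 / √2) r := (hasDerivAt_id r).div_const _
  have h2 := (h1.sinh).div (h1.cosh) hc
  have h3 : q = fun r => Real.sinh (r / √2) / Real.cosh (r / √2) := by
    funext r; simp [q, Real.tanh_eq_sinh_div_cosh]
  have h4 : q r = Real.sinh (r / √2) / Real.cosh (r / √2) := by rw [h3]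
  rw [h4]
  rw [h3]
  refine h2.congr_deriv ?_
  field_simp

theorem contDiff_q {n : WithTop ℕ∞} : ContDiff ℝ n q := by
  have h3 : q = fun r => Real.sinh (r / √2) / Real.cosh (r / √2) := by
    funext r; simp [q, Real.tanh_eq_sinh_div_cosh]
  rw [h3]
  exact (Real.contDiff_sinh.comp (contDiff_id.div_const _)).div
    (Real.contDiff_cosh.comp (contDiff_id.div_const _)) fun r => (Real.cosh_pos _).ne'

theorem q_neg (r : ℝ) : q (-r) = -q r := by simp [q, neg_div]

theorem q_lt_one (r : ℝ) : q r < 1 := Real.tanh_lt_one _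

theorem neg_one_lt_q (r : ℝ) : -1 < q r := Real.neg_one_lt_tanh _

/-- With `y = r/√2`, `1 - tanh y = 2e^(-y)/(e^y + e^(-y)) ≤ 2e^(-2y)`, and `2y = √2 r`. -/
theorem one_sub_q_le (r : ℝ) : 1 - q r ≤ 2 * Real.exp (-(√2 * r)) := by
  have hs : √2 * √2 = 2 := Real.mul_self_sqrt (by norm_num)
  have hs0 : 0 < √2 := by positivity
  have h : √2 * r = r / √2 + r / √2 := by
    field_simp; rw [sq, hs]; ring
  rw [h, q, Real.tanh_eq]
  set y := r / √2
  have e1 : Real.exp (-(y + y)) = Real.exp (-y) * Real.exp (-y) := by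
    rw [← Real.exp_add]; ring_nf
  have e2 : Real.exp y * Real.exp (-y) = 1 := by rw [← Real.exp_add]; simp
  have p1 := Real.exp_pos y
  have p2 := Real.exp_pos (-y)
  rw [e1]
  rw [sub_le_iff_le_add, ← sub_le_iff_le_add', le_div_iff₀ (by positivity)]
  nlinarith [mul_pos p2 (mul_pos p2 p2)]

/-- The derivative of the optimal profile. -/
noncomputable def profileSlope (r : ℝ) : ℝ := (1 - q r ^ 2) / √2

theorem continuous_profileSlope : Continuous profileSlope := by
  unfold profileSlope
  have : Continuous q := (contDiff_q (n := 0)).continuous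
  fun_prop

/-- The right-hand side is `W'(q)`, so the untruncated profile has no Allen-Cahn defect. -/
theorem hasDerivAt_profileSlope (r : ℝ) :
    HasDerivAt profileSlope (-(q r * (1 - q r ^ 2))) r := by
  have h := (((hasDerivAt_q r).pow 2).const_sub 1).div_const (√2)
  refine h.congr_deriv ?_
  have hs : √2 * √2 = 2 := Real.mul_self_sqrt (by norm_num)
  have hs0 : √2 ≠ 0 := by positivity
  field_simp
  simp only [sq, hs]
  push_cast
  ring

theorem profileSlope_nonneg (r : ℝ) : 0 ≤ profileSlope r := by
  unfold profileSlope
  have := q_lt_one r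
  have := neg_one_lt_q r
  apply div_nonneg _ (Real.sqrt_nonneg _)
  nlinarith

theorem profileSlope_neg (r : ℝ) : profileSlope (-r) = profileSlope r := by
  simp [profileSlope, q_neg]

theorem one_le_sqrt_two : 1 ≤ √2 := by
  rw [Real.one_le_sqrt]; norm_num

theorem profileSlope_le (r : ℝ) : profileSlope r ≤ 2 * (1 - q r) := by
  unfold profileSlope
  have := q_lt_one r
  have := neg_one_lt_q r
  rw [div_le_iff₀ (by positivity)]
  nlinarith [one_le_sqrt_two, mul_nonneg (sub_nonneg.2 (q_lt_one r).le)
    (sub_nonneg.2 one_le_sqrt_two), mul_nonneg (sub_nonneg.2 (q_lt_one r).le)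
    (sub_nonneg.2 (q_lt_one r).le)]

theorem profileSlope_le_one (r : ℝ) : profileSlope r ≤ 1 := by
  unfold profileSlope
  rw [div_le_iff₀ (by positivity)]
  nlinarith [one_le_sqrt_two, sq_nonneg (q r)]

/-- Equipartition: gradient and potential parts of the energy agree pointwise. -/
theorem profileSlope_sq (r : ℝ) : profileSlope r ^ 2 = 2 * W (q r) := by
  unfold profileSlope W
  rw [div_pow, Real.sq_sqrt (by norm_num)]
  ring

theorem profileSlope_le_exp (r : ℝ) : profileSlope r ≤ 4 * Real.exp (-|r|) := by
  wlog h : 0 ≤ r generalizing r with H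
  · have := H (-r) (by linarith)
    rwa [profileSlope_neg, abs_neg] at this
  rw [abs_of_nonneg h]
  have h1 := profileSlope_le r
  have h2 := one_sub_q_le r
  have h3 : Real.exp (-(√2 * r)) ≤ Real.exp (-r) := by
    apply Real.exp_le_exp.2
    nlinarith [one_le_sqrt_two]
  linarith

/-- The majorant is chosen because its primitive is an arctangent, which bounds the second moment on
every interval at once. It comes from `e^|t| ≥ 1 + |t| + t²/2`, squared. -/
theorem sq_mul_profileSlope_sq_le (t : ℝ) :
    t ^ 2 * profileSlope t ^ 2 ≤ 64 * (1 + t ^ 2)⁻¹ := by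
  have h0 := profileSlope_nonneg t
  have h1 := profileSlope_le_exp t
  have h2 : profileSlope t ^ 2 ≤ 16 * Real.exp (-|t|) ^ 2 := by
    calc profileSlope t ^ 2 ≤ (4 * Real.exp (-|t|)) ^ 2 := by gcongr
      _ = _ := by ring
  have h3 : 1 + |t| + |t| ^ 2 / 2 ≤ Real.exp |t| := Real.quadratic_le_exp_of_nonneg (abs_nonneg t)
  have h4 : Real.exp (-|t|) = (Real.exp |t|)⁻¹ := Real.exp_neg _
  have h5 : (t ^ 2 + t ^ 4) / 4 ≤ Real.exp |t| ^ 2 := by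
    calc (t ^ 2 + t ^ 4) / 4 ≤ (1 + |t| + |t| ^ 2 / 2) ^ 2 := by
          have := sq_abs t
          have h6 : t ^ 4 = |t| ^ 4 := by rw [show t ^ 4 = (t ^ 2) ^ 2 by ring, ← this]; ring
          rw [h6, ← this]
          have h7 := abs_nonneg t
          nlinarith [pow_nonneg h7 3]
      _ ≤ _ := by gcongr
  calc t ^ 2 * profileSlope t ^ 2 ≤ t ^ 2 * (16 * Real.exp (-|t|) ^ 2) := by gcongr
    _ = 16 * t ^ 2 / Real.exp |t| ^ 2 := by rw [h4]; field_simp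
    _ ≤ 64 * (1 + t ^ 2)⁻¹ := by
      rw [div_le_iff₀ (by positivity), ← div_eq_mul_inv, div_mul_eq_mul_div,
        le_div_iff₀ (by positivity)]
      nlinarith

/-! ### The double well, the constant `c₀` and the rescaled peak -/

theorem deriv_W (r : ℝ) : deriv W r = r ^ 3 - r := by
  have h : HasDerivAt W (r ^ 3 - r) r := by
    have := ((((hasDerivAt_id r).pow 2).const_sub 1).pow 2).const_mul (1 / 4 : ℝ)
    refine this.congr_deriv ?_
    simp
    ring
  exact h.deriv

theorem continuous_W : Continuous W := by unfold W; fun_prop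

theorem continuous_deriv_W : Continuous (deriv W) := by
  rw [show deriv W = fun r => r ^ 3 - r from funext deriv_W]
  fun_prop

/-- The primitive of `√(2W)` on `[-1, 1]`. -/
noncomputable def wellPrimitive (x : ℝ) : ℝ := (x - x ^ 3 / 3) / √2

theorem hasDerivAt_wellPrimitive (x : ℝ) : HasDerivAt wellPrimitive ((1 - x ^ 2) / √2) x := by
  have := ((hasDerivAt_id x).sub (((hasDerivAt_id x).pow 3).div_const 3)).div_const (√2)
  refine this.congr_deriv ?_
  simp

theorem c₀_eq : c₀ = 2 * wellPrimitive 1 := by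
  have h : ∀ s ∈ uIcc (-1 : ℝ) 1, √(2 * W s) = (1 - s ^ 2) / √2 := by
    intro s hs
    rw [uIcc_of_le (by norm_num)] at hs
    have h1 : 0 ≤ 1 - s ^ 2 := by nlinarith [hs.1, hs.2]
    rw [Real.sqrt_eq_iff_mul_self_eq (by unfold W; positivity) (by positivity)]
    rw [div_mul_div_comm, Real.mul_self_sqrt (by norm_num)]
    unfold W
    ring
  unfold c₀
  rw [intervalIntegral.integral_congr h,
    intervalIntegral.integral_eq_sub_of_hasDerivAt (fun x _ => hasDerivAt_wellPrimitive x)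
      (Continuous.intervalIntegrable (by fun_prop) _ _)]
  unfold wellPrimitive
  ring

theorem c₀_pos : 0 < c₀ := by
  rw [c₀_eq]; unfold wellPrimitive; norm_num

/-- The rescaled energy density of the optimal profile. -/
noncomputable def peak (ε r : ℝ) : ℝ := ε⁻¹ * profileSlope (r / ε) ^ 2

theorem continuous_peak (ε : ℝ) : Continuous (peak ε) := by
  unfold peak
  have := continuous_profileSlope
  fun_prop

theorem peak_neg (ε r : ℝ) : peak ε (-r) = peak ε r := by
  simp [peak, neg_div, profileSlope_neg]

theorem peak_nonneg {ε : ℝ} (hε : 0 < ε) (r : ℝ) : 0 ≤ peak ε r := by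
  unfold peak; positivity

/-- Since `q' = √(2W(q))`, the peak is the derivative of `wellPrimitive (q (r / ε))`. -/
theorem integral_peak {ε : ℝ} (δ : ℝ) :
    ∫ r in (-δ)..δ, peak ε r = 2 * wellPrimitive (q (δ / ε)) := by
  have h : ∀ r, HasDerivAt (fun r => wellPrimitive (q (r / ε))) (peak ε r) r := by
    intro r
    have h1 : HasDerivAt (fun r : ℝ => r / ε) (1 / ε) r := (hasDerivAt_id r).div_const _
    have := (hasDerivAt_wellPrimitive _).comp r ((hasDerivAt_q _).comp r h1)
    refine this.congr_deriv ?_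
    unfold peak profileSlope
    simp only [Function.comp]
    ring
  rw [intervalIntegral.integral_eq_sub_of_hasDerivAt (fun x _ => h x)
    ((continuous_peak ε).intervalIntegrable _ _), neg_div, q_neg]
  unfold wellPrimitive
  ring

theorem abs_integral_peak_sub_le {ε δ : ℝ} (hε : 0 < ε) (hδ : 0 < δ) :
    |(∫ r in (-δ)..δ, peak ε r) - c₀| ≤ 8 * Real.exp (-δ / ε) := by
  rw [integral_peak, c₀_eq]
  set x := q (δ / ε) with hx
  have h1 : x < 1 := q_lt_one _
  have h2 : -1 < x := neg_one_lt_q _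
  have h3 : 1 - x ≤ 2 * Real.exp (-δ / ε) := by
    refine (one_sub_q_le _).trans ?_
    gcongr
    rw [neg_div]
    have : 0 < δ / ε := by positivity
    nlinarith [one_le_sqrt_two]
  -- The primitive is stationary at the well `1`, so `1 - x` factors out twice; a linear bound in `1
  -- - x` is enough.
  have h4 : 2 * wellPrimitive x - 2 * wellPrimitive 1
      = - (2 * (1 - x) ^ 2 * (x + 2) / 3 / √2) := by unfold wellPrimitive; ring
  rw [h4, abs_neg, abs_of_nonneg (by
    apply div_nonneg _ (Real.sqrt_nonneg _)
    have : 0 ≤ x + 2 := by linarith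
    positivity)]
  calc 2 * (1 - x) ^ 2 * (x + 2) / 3 / √2 ≤ 2 * (1 - x) ^ 2 * (x + 2) / 3 / 1 := by
        have : 0 ≤ x + 2 := by linarith
        gcongr
        exact one_le_sqrt_two
    _ ≤ 4 * (1 - x) := by nlinarith [mul_pos (sub_pos.2 h1) (neg_lt_iff_pos_add.1 h2)]
    _ ≤ _ := by linarith

/-- The substitution `t = r / ε` produces the factor `ε²`; this is the origin of the quadratic error
in the elastica energy. -/
theorem integral_sq_mul_peak_le {ε δ : ℝ} (hε : 0 < ε) (hδ : 0 < δ) :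
    ∫ r in (-δ)..δ, r ^ 2 * peak ε r ≤ 64 * Real.pi * ε ^ 2 := by
  have h1 : ∀ r, r ^ 2 * peak ε r = ε * ((r / ε) ^ 2 * profileSlope (r / ε) ^ 2) := by
    intro r; unfold peak; field_simp
  simp_rw [h1]
  rw [intervalIntegral.integral_const_mul,
    intervalIntegral.integral_comp_div (fun t => t ^ 2 * profileSlope t ^ 2) hε.ne']
  have hc := continuous_profileSlope
  have h2 : ∫ t in (-δ / ε)..(δ / ε), t ^ 2 * profileSlope t ^ 2
      ≤ ∫ t in (-δ / ε)..(δ / ε), 64 * (1 + t ^ 2)⁻¹ := by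
    apply intervalIntegral.integral_mono_on
    · gcongr; linarith
    · exact Continuous.intervalIntegrable (by fun_prop) _ _
    · apply Continuous.intervalIntegrable
      have : ∀ t : ℝ, 1 + t ^ 2 ≠ 0 := fun t => by positivity
      fun_prop (disch := assumption)
    · intro t _; exact sq_mul_profileSlope_sq_le t
  rw [intervalIntegral.integral_const_mul, integral_inv_one_add_sq] at h2
  have h3 := Real.arctan_lt_pi_div_two (δ / ε)
  have h4 := Real.neg_pi_div_two_lt_arctan (-δ / ε)
  have h5 : ∫ t in (-δ / ε)..(δ / ε), t ^ 2 * profileSlope t ^ 2 ≤ 64 * Real.pi := by linarith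
  calc ε * (ε • ∫ t in (-δ / ε)..(δ / ε), t ^ 2 * profileSlope t ^ 2)
      ≤ ε * (ε • (64 * Real.pi)) := by
        simp only [smul_eq_mul]; gcongr
    _ = _ := by simp only [smul_eq_mul]; ring

/-! ### The truncated profile -/

section qCut

variable {η : ℝ → ℝ} {δ ε : ℝ}

theorem qCut_neg (hη : IsCutoff η) (r : ℝ) : qCut η δ ε (-r) = -qCut η δ ε r := by
  unfold qCut
  rw [show 2 * -r / δ = -(2 * r / δ) by ring, hη.even, neg_div, q_neg, Real.sign_neg]
  ring

theorem qCut_eq_of_pos {r : ℝ} (hr : 0 < r) :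
    qCut η δ ε r = 1 - η (2 * r / δ) * (1 - q (r / ε)) := by
  unfold qCut
  rw [Real.sign_of_pos hr]
  ring

theorem qCut_eventuallyEq_of_pos {r : ℝ} (hr : 0 < r) :
    qCut η δ ε =ᶠ[𝓝 r] fun r => 1 - η (2 * r / δ) * (1 - q (r / ε)) := by
  filter_upwards [lt_mem_nhds hr] with x hx using qCut_eq_of_pos hx

theorem qCut_eq_of_abs_le (hη : IsCutoff η) (hδ : 0 < δ) {r : ℝ} (hr : |r| ≤ δ / 2) :
    qCut η δ ε r = q (r / ε) := by
  unfold qCut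
  rw [abs_le] at hr
  rw [hη.eq_one]
  · ring
  · constructor
    · rw [le_div_iff₀ hδ]; linarith
    · rw [div_le_iff₀ hδ]; linarith

theorem qCut_eventuallyEq_of_abs_lt (hη : IsCutoff η) (hδ : 0 < δ) {r : ℝ} (hr : |r| < δ / 2) :
    qCut η δ ε =ᶠ[𝓝 r] fun r => q (r / ε) := by
  filter_upwards [continuous_abs.continuousAt.eventually_lt_const hr] with x hx
    using qCut_eq_of_abs_le hη hδ hx.le

theorem qCut_eq_one (hη : IsCutoff η) (hδ : 0 < δ) {r : ℝ} (hr : δ ≤ r) : qCut η δ ε r = 1 := by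
  rw [qCut_eq_of_pos (hδ.trans_le hr), hη.eq_zero]
  · ring
  · rw [abs_of_nonneg (div_nonneg (by linarith) hδ.le), le_div_iff₀ hδ]
    linarith

theorem qCut_eq_neg_one (hη : IsCutoff η) (hδ : 0 < δ) {r : ℝ} (hr : r ≤ -δ) :
    qCut η δ ε r = -1 := by
  rw [← neg_neg r, qCut_neg hη, qCut_eq_one hη hδ (by linarith)]

/-- The jump of `sgn` at `0` is invisible because its factor vanishes for `|r| ≤ δ/2`. The negative
half line follows by oddness. -/
theorem contDiff_qCut (hη : IsCutoff η) (hδ : 0 < δ) : ContDiff ℝ ∞ (qCut η δ ε) := by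
  have h0 : ContDiff ℝ ∞ (fun r => q (r / ε)) := contDiff_q.comp (contDiff_id.div_const _)
  have h1 : ContDiff ℝ ∞ (fun r => 1 - η (2 * r / δ) * (1 - q (r / ε))) :=
    contDiff_const.sub ((hη.smooth.comp ((contDiff_const.mul contDiff_id).div_const _)).mul
      (contDiff_const.sub h0))
  have hpos : ∀ r, 0 < r → ContDiffAt ℝ ∞ (qCut η δ ε) r := fun r hr =>
    h1.contDiffAt.congr_of_eventuallyEq (qCut_eventuallyEq_of_pos hr)
  rw [contDiff_iff_contDiffAt]
  intro r
  rcases lt_trichotomy r 0 with h | h | h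
  · have h2 : qCut η δ ε = fun x => -qCut η δ ε (-x) := by
      funext x; rw [qCut_neg hη, neg_neg]
    rw [h2]
    exact ((hpos (-r) (by linarith)).comp r contDiff_neg.contDiffAt).neg
  · subst h
    exact h0.contDiffAt.congr_of_eventuallyEq
      (qCut_eventuallyEq_of_abs_lt hη hδ (by simpa using by positivity))
  · exact hpos r h

theorem contDiff_deriv_qCut (hη : IsCutoff η) (hδ : 0 < δ) :
    ContDiff ℝ ∞ (deriv (qCut η δ ε)) :=
  (contDiff_infty_iff_deriv.1 (contDiff_qCut hη hδ)).2

theorem continuous_deriv_qCut (hη : IsCutoff η) (hδ : 0 < δ) :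
    Continuous (deriv (qCut η δ ε)) := (contDiff_deriv_qCut hη hδ).continuous

theorem continuous_deriv_deriv_qCut (hη : IsCutoff η) (hδ : 0 < δ) :
    Continuous (deriv (deriv (qCut η δ ε))) :=
  (contDiff_infty_iff_deriv.1 (contDiff_deriv_qCut hη hδ)).2.continuous

theorem abs_qCut_le_one (hη : IsCutoff η) (r : ℝ) : |qCut η δ ε r| ≤ 1 := by
  unfold qCut
  have h0 := hη.nonneg (2 * r / δ)
  have h1 := hη.le_one (2 * r / δ)
  have hq1 := q_lt_one (r / ε)
  have hq2 := neg_one_lt_q (r / ε)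
  have hs : Real.sign r ≤ 1 ∧ -1 ≤ Real.sign r := by
    rcases Real.sign_apply_eq r with h | h | h <;> rw [h] <;> norm_num
  rw [abs_le]
  constructor
  · nlinarith [mul_nonneg h0 (neg_lt_iff_pos_add.1 hq2).le,
      mul_nonneg (sub_nonneg.2 h1) (neg_le_iff_add_nonneg.1 hs.2)]
  · nlinarith [mul_nonneg h0 (sub_nonneg.2 hq1.le), mul_nonneg (sub_nonneg.2 h1)
      (sub_nonneg.2 hs.1)]

theorem deriv_qCut_neg (hη : IsCutoff η) (r : ℝ) :
    deriv (qCut η δ ε) (-r) = deriv (qCut η δ ε) r := by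
  have h2 : qCut η δ ε = fun x => -qCut η δ ε (-x) := by
    funext x; rw [qCut_neg hη, neg_neg]
  conv_rhs => rw [h2]
  rw [deriv.fun_neg, deriv_comp_neg, neg_neg]

theorem deriv_deriv_qCut_neg (hη : IsCutoff η) (r : ℝ) :
    deriv (deriv (qCut η δ ε)) (-r) = -deriv (deriv (qCut η δ ε)) r := by
  have h2 : deriv (qCut η δ ε) = fun x => deriv (qCut η δ ε) (-x) := by
    funext x; rw [deriv_qCut_neg hη]
  conv_rhs => rw [h2]
  rw [deriv_comp_neg, neg_neg]

theorem hasDerivAt_q_div (r : ℝ) :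
    HasDerivAt (fun r => q (r / ε)) (profileSlope (r / ε) / ε) r := by
  have h1 : HasDerivAt (fun r : ℝ => r / ε) (1 / ε) r := (hasDerivAt_id r).div_const _
  refine ((hasDerivAt_q _).comp r h1).congr_deriv ?_
  unfold profileSlope; ring

theorem hasDerivAt_profileSlope_div (r : ℝ) :
    HasDerivAt (fun r => profileSlope (r / ε) / ε)
      (-(q (r / ε) * (1 - q (r / ε) ^ 2)) / ε ^ 2) r := by
  have h1 : HasDerivAt (fun r : ℝ => r / ε) (1 / ε) r := (hasDerivAt_id r).div_const _
  refine (((hasDerivAt_profileSlope _).comp r h1).div_const ε).congr_deriv ?_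
  ring

theorem deriv_qCut_eventuallyEq_of_abs_lt (hη : IsCutoff η) (hδ : 0 < δ) {r : ℝ}
    (hr : |r| < δ / 2) :
    deriv (qCut η δ ε) =ᶠ[𝓝 r] fun r => profileSlope (r / ε) / ε :=
  (qCut_eventuallyEq_of_abs_lt hη hδ hr).deriv.trans
    (.of_eq (funext fun r => (hasDerivAt_q_div r).deriv))

theorem deriv_qCut_of_abs_lt (hη : IsCutoff η) (hδ : 0 < δ) {r : ℝ} (hr : |r| < δ / 2) :
    deriv (qCut η δ ε) r = profileSlope (r / ε) / ε :=
  (deriv_qCut_eventuallyEq_of_abs_lt hη hδ hr).eq_of_nhds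

theorem deriv_deriv_qCut_of_abs_lt (hη : IsCutoff η) (hδ : 0 < δ) {r : ℝ} (hr : |r| < δ / 2) :
    deriv (deriv (qCut η δ ε)) r = -(q (r / ε) * (1 - q (r / ε) ^ 2)) / ε ^ 2 := by
  rw [(deriv_qCut_eventuallyEq_of_abs_lt hη hδ hr).deriv_eq]
  exact (hasDerivAt_profileSlope_div r).deriv

theorem hasDerivAt_cutoff (hη : IsCutoff η) (r : ℝ) :
    HasDerivAt (fun r => η (2 * r / δ)) (2 / δ * deriv η (2 * r / δ)) r := by
  have h1 : HasDerivAt (fun r : ℝ => 2 * r / δ) (2 / δ) r := by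
    refine (((hasDerivAt_id r).const_mul 2).div_const δ).congr_deriv (by simp)
  have := ((hη.smooth.differentiable (by simp)) (2 * r / δ)).hasDerivAt.comp r h1
  exact this.congr_deriv (by ring)

theorem hasDerivAt_deriv_cutoff (hη : IsCutoff η) (r : ℝ) :
    HasDerivAt (fun r => 2 / δ * deriv η (2 * r / δ))
      ((2 / δ) ^ 2 * deriv (deriv η) (2 * r / δ)) r := by
  have h1 : HasDerivAt (fun r : ℝ => 2 * r / δ) (2 / δ) r := by
    refine (((hasDerivAt_id r).const_mul 2).div_const δ).congr_deriv (by simp)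
  have h2 : ContDiff ℝ ∞ (deriv η) := (contDiff_infty_iff_deriv.1 hη.smooth).2
  have := (((h2.differentiable (by simp)) (2 * r / δ)).hasDerivAt.comp r h1).const_mul (2 / δ)
  exact this.congr_deriv (by ring)

theorem hasDerivAt_qCut_of_pos (hη : IsCutoff η) {r : ℝ} (hr : 0 < r) :
    HasDerivAt (qCut η δ ε) (-(2 / δ * deriv η (2 * r / δ)) * (1 - q (r / ε)) +
      η (2 * r / δ) * (profileSlope (r / ε) / ε)) r := by
  have h := (((hasDerivAt_cutoff (δ := δ) hη r).mul
    ((hasDerivAt_q_div (ε := ε) r).const_sub 1)).const_sub 1)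
  refine (h.congr_of_eventuallyEq (qCut_eventuallyEq_of_pos hr)).congr_deriv ?_
  ring

theorem deriv_deriv_qCut_of_pos (hη : IsCutoff η) {r : ℝ} (hr : 0 < r) :
    deriv (deriv (qCut η δ ε)) r = -((2 / δ) ^ 2 * deriv (deriv η) (2 * r / δ)) * (1 - q (r / ε)) +
      2 * (2 / δ * deriv η (2 * r / δ)) * (profileSlope (r / ε) / ε) +
      η (2 * r / δ) * (-(q (r / ε) * (1 - q (r / ε) ^ 2)) / ε ^ 2) := by
  have h1 : deriv (qCut η δ ε) =ᶠ[𝓝 r] fun r => -(2 / δ * deriv η (2 * r / δ)) * (1 - q (r / ε)) +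
      η (2 * r / δ) * (profileSlope (r / ε) / ε) := by
    filter_upwards [lt_mem_nhds hr] with x hx using (hasDerivAt_qCut_of_pos hη hx).deriv
  rw [h1.deriv_eq]
  have h := ((hasDerivAt_deriv_cutoff (δ := δ) hη r).neg.mul
    ((hasDerivAt_q_div (ε := ε) r).const_sub 1)).add
    ((hasDerivAt_cutoff (δ := δ) hη r).mul (hasDerivAt_profileSlope_div (ε := ε) r))
  refine (h.congr_deriv ?_).deriv
  simp only [Pi.neg_apply]
  ring

/-- The monotonicity of the cut-off and `q < 1` give the sign for `r > 0`. It lets `‖∇u_ε‖` be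
replaced by `q_ε'` without absolute value in the winding number. -/
theorem deriv_qCut_nonneg (hη : IsCutoff η) (hδ : 0 < δ) (hε : 0 < ε) (r : ℝ) :
    0 ≤ deriv (qCut η δ ε) r := by
  have hpos : ∀ r, 0 < r → 0 ≤ deriv (qCut η δ ε) r := by
    intro r hr
    rw [(hasDerivAt_qCut_of_pos hη hr).deriv]
    have h1 := hη.deriv_nonpos (2 * r / δ) (by positivity)
    have h2 := q_lt_one (r / ε)
    have h3 := hη.nonneg (2 * r / δ)
    have h4 := profileSlope_nonneg (r / ε)
    have h5 : 0 ≤ 1 - q (r / ε) := by linarith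
    have h6 : 0 ≤ -(2 / δ * deriv η (2 * r / δ)) := by
      rw [neg_nonneg]; exact mul_nonpos_of_nonneg_of_nonpos (by positivity) h1
    positivity
  rcases lt_trichotomy r 0 with h | h | h
  · rw [← deriv_qCut_neg hη]; exact hpos _ (by linarith)
  · rw [deriv_qCut_of_abs_lt hη hδ (by rw [h]; simpa using by positivity)]
    have := profileSlope_nonneg (r / ε)
    positivity
  · exact hpos r h

/-- In the transition layer of the cut-off, the truncated profile is exponentially close to `1`. -/
theorem exists_qCut_tail_bound (hη : IsCutoff η) (hδ : 0 < δ) :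
    ∃ C, 0 < C ∧ ∀ ε, 0 < ε → ε ≤ 1 → ∀ r, δ / 2 ≤ r → r ≤ δ →
      |1 - qCut η δ ε r| ≤ C * Real.exp (-(δ / 2) / ε) ∧
      |deriv (qCut η δ ε) r| ≤ C * Real.exp (-(δ / 2) / ε) / ε ∧
      |deriv (deriv (qCut η δ ε)) r| ≤ C * Real.exp (-(δ / 2) / ε) / ε ^ 2 := by
  have hd1 : ContDiff ℝ ∞ (deriv η) := (contDiff_infty_iff_deriv.1 hη.smooth).2
  have hd2 : ContDiff ℝ ∞ (deriv (deriv η)) := (contDiff_infty_iff_deriv.1 hd1).2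
  obtain ⟨M₁, hM₁⟩ := isCompact_Icc.exists_bound_of_continuousOn (s := Icc (1 : ℝ) 2)
    hd1.continuous.continuousOn
  obtain ⟨M₂, hM₂⟩ := isCompact_Icc.exists_bound_of_continuousOn (s := Icc (1 : ℝ) 2)
    hd2.continuous.continuousOn
  have hM₁0 : 0 ≤ M₁ := (norm_nonneg _).trans (hM₁ 1 (by simp))
  have hM₂0 : 0 ≤ M₂ := (norm_nonneg _).trans (hM₂ 1 (by simp))
  -- The sum of the constants for the value and the first and second derivatives. The numbers 2 and
  -- 4 come from `1 - q ≤ 2E` and from the bounds `4E` for the slope and for `q(1 - q²)`.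
  refine ⟨2 + (2 / δ * M₁ * 2 + 4) + ((2 / δ) ^ 2 * M₂ * 2 + 2 * (2 / δ * M₁) * 4 + 4),
    by positivity, ?_⟩
  intro ε hε hε1 r hr1 hr2
  set C := 2 + (2 / δ * M₁ * 2 + 4) + ((2 / δ) ^ 2 * M₂ * 2 + 2 * (2 / δ * M₁) * 4 + 4) with hC
  set E := Real.exp (-(δ / 2) / ε) with hE
  have hE0 : 0 < E := Real.exp_pos _
  have hr0 : 0 < r := by linarith
  set w := 1 - q (r / ε) with hw
  have hq1 := q_lt_one (r / ε)
  have hq2 := neg_one_lt_q (r / ε)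
  have hw0 : 0 ≤ w := by rw [hw]; linarith
  have hwE : w ≤ 2 * E := by
    refine (one_sub_q_le _).trans ?_
    rw [hE]
    gcongr
    rw [neg_div]
    have h1 : 0 < r / ε := by positivity
    have h2 : δ / 2 / ε ≤ r / ε := by gcongr
    nlinarith [one_le_sqrt_two]
  have hx : 2 * r / δ ∈ Icc (1 : ℝ) 2 := by
    constructor
    · rw [le_div_iff₀ hδ]; linarith
    · rw [div_le_iff₀ hδ]; linarith
  have h1 := hM₁ _ hx
  have h2 := hM₂ _ hx
  rw [Real.norm_eq_abs] at h1 h2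
  set x := 2 * r / δ with hxdef
  have hη0 : |η x| ≤ 1 := by rw [abs_of_nonneg (hη.nonneg x)]; exact hη.le_one x
  have hs : |profileSlope (r / ε)| ≤ 4 * E := by
    rw [abs_of_nonneg (profileSlope_nonneg _)]
    linarith [profileSlope_le (r / ε)]
  have hs2 : |q (r / ε) * (1 - q (r / ε) ^ 2)| ≤ 4 * E := by
    have : q (r / ε) * (1 - q (r / ε) ^ 2) = q (r / ε) * (1 + q (r / ε)) * w := by rw [hw]; ring
    rw [this, abs_mul, abs_of_nonneg hw0]
    have : |q (r / ε) * (1 + q (r / ε))| ≤ 2 := by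
      rw [abs_le]; constructor <;> nlinarith
    calc _ ≤ 2 * w := by gcongr
      _ ≤ _ := by linarith
  have hwabs : |w| ≤ 2 * E := by rwa [abs_of_nonneg hw0]
  have hinv : 1 ≤ 1 / ε := by rw [le_div_iff₀ hε]; linarith
  have hinv2 : 1 / ε ≤ 1 / ε ^ 2 := by
    rw [div_le_div_iff₀ hε (by positivity)]; nlinarith
  refine ⟨?_, ?_, ?_⟩
  · rw [qCut_eq_of_pos hr0, sub_sub_cancel, abs_mul]
    calc |η x| * |w| ≤ 1 * (2 * E) := by gcongr
      _ ≤ C * E := by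
        rw [one_mul]; gcongr; rw [hC, add_assoc]
        exact le_add_of_nonneg_right (by positivity)
  · rw [(hasDerivAt_qCut_of_pos hη hr0).deriv]
    calc |-(2 / δ * deriv η x) * w + η x * (profileSlope (r / ε) / ε)|
        ≤ |-(2 / δ * deriv η x) * w| + |η x * (profileSlope (r / ε) / ε)| := abs_add_le _ _
      _ = 2 / δ * |deriv η x| * |w| * 1 + |η x| * (|profileSlope (r / ε)| * (1 / ε)) := by
        simp only [abs_mul, abs_neg, abs_div, abs_of_pos hε, abs_of_pos hδ, abs_two]
        ring
      _ ≤ 2 / δ * M₁ * (2 * E) * (1 / ε) + 1 * (4 * E * (1 / ε)) := by gcongr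
      _ = (2 / δ * M₁ * 2 + 4) * E / ε := by ring
      _ ≤ C * E / ε := by
        gcongr
        rw [hC]
        have : 0 ≤ (2 / δ) ^ 2 * M₂ * 2 + 2 * (2 / δ * M₁) * 4 + 4 := by positivity
        linarith
  · rw [deriv_deriv_qCut_of_pos hη hr0]
    calc |-((2 / δ) ^ 2 * deriv (deriv η) x) * w +
          2 * (2 / δ * deriv η x) * (profileSlope (r / ε) / ε) +
          η x * (-(q (r / ε) * (1 - q (r / ε) ^ 2)) / ε ^ 2)|
        ≤ |-((2 / δ) ^ 2 * deriv (deriv η) x) * w| +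
          |2 * (2 / δ * deriv η x) * (profileSlope (r / ε) / ε)| +
          |η x * (-(q (r / ε) * (1 - q (r / ε) ^ 2)) / ε ^ 2)| := abs_add_three _ _ _
      _ = (2 / δ) ^ 2 * |deriv (deriv η) x| * |w| * 1 +
          2 * (2 / δ * |deriv η x|) * |profileSlope (r / ε)| * (1 / ε) +
          |η x| * (|q (r / ε) * (1 - q (r / ε) ^ 2)| * (1 / ε ^ 2)) := by
        simp only [abs_mul, abs_neg, abs_div, abs_of_pos hε, abs_pow, abs_of_pos hδ, abs_two]
        ring
      _ ≤ (2 / δ) ^ 2 * M₂ * (2 * E) * (1 / ε ^ 2) +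
          2 * (2 / δ * M₁) * (4 * E) * (1 / ε ^ 2) + 1 * (4 * E * (1 / ε ^ 2)) := by
        gcongr
        exact hinv.trans hinv2
      _ = ((2 / δ) ^ 2 * M₂ * 2 + 2 * (2 / δ * M₁) * 4 + 4) * E / ε ^ 2 := by ring
      _ ≤ C * E / ε ^ 2 := by
        gcongr
        rw [hC]
        have : 0 ≤ 2 / δ * M₁ * 2 := by positivity
        linarith

end qCut

/-! ### One-dimensional asymptotics -/

/-- A family of functions that is exponentially small, uniformly on `[-δ, δ]`. -/
def ExpSmall (δ : ℝ) (g : ℝ → ℝ → ℝ) : Prop :=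
  ∃ c, 0 < c ∧ ∃ C, 0 ≤ C ∧ ∀ ε, 0 < ε → ε ≤ 1 → ∀ r ∈ Icc (-δ) δ,
    |g ε r| ≤ C * Real.exp (-c / ε)

theorem exp_neg_div_le_of_le {c c' ε : ℝ} (hε : 0 < ε) (h : c ≤ c') :
    Real.exp (-c' / ε) ≤ Real.exp (-c / ε) := by
  gcongr

/-- Half of the exponent is sacrificed to absorb `ε⁻²`: with `y = c/(2ε)`, `e^y ≥ y²/2` gives the
constant `8/c²`. -/
theorem exp_neg_div_div_sq_le {c ε : ℝ} (hc : 0 < c) (hε : 0 < ε) :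
    Real.exp (-c / ε) / ε ^ 2 ≤ 8 / c ^ 2 * Real.exp (-(c / 2) / ε) := by
  have h1 : Real.exp (-c / ε) = Real.exp (-(c / 2) / ε) * Real.exp (-(c / 2 / ε)) := by
    rw [← Real.exp_add]; ring_nf
  have h2 : (c / 2 / ε) ^ 2 / 2 ≤ Real.exp (c / 2 / ε) := by
    have := Real.quadratic_le_exp_of_nonneg (x := c / 2 / ε) (by positivity)
    have h3 : 0 ≤ c / 2 / ε := by positivity
    linarith
  have h4 : Real.exp (-(c / 2 / ε)) / ε ^ 2 ≤ 8 / c ^ 2 := by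
    rw [Real.exp_neg, div_le_iff₀ (by positivity), inv_le_iff_one_le_mul₀ (Real.exp_pos _)]
    calc (1 : ℝ) = 8 / c ^ 2 * ε ^ 2 * ((c / 2 / ε) ^ 2 / 2) := by field_simp; norm_num
      _ ≤ _ := by gcongr
  calc Real.exp (-c / ε) / ε ^ 2
      = Real.exp (-(c / 2) / ε) * (Real.exp (-(c / 2 / ε)) / ε ^ 2) := by rw [h1]; ring
    _ ≤ Real.exp (-(c / 2) / ε) * (8 / c ^ 2) := by gcongr
    _ = _ := by ring

namespace ExpSmall

variable {δ : ℝ} {g h : ℝ → ℝ → ℝ}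

theorem of_div_sq_bound (c C : ℝ) (hc : 0 < c) (hC : 0 ≤ C)
    (H : ∀ ε, 0 < ε → ε ≤ 1 → ∀ r ∈ Icc (-δ) δ, |g ε r| ≤ C * (Real.exp (-c / ε) / ε ^ 2)) :
    ExpSmall δ g := by
  refine ⟨c / 2, by positivity, C * (8 / c ^ 2), by positivity, fun ε hε hε1 r hr => ?_⟩
  refine (H ε hε hε1 r hr).trans ?_
  rw [mul_assoc]
  gcongr
  exact exp_neg_div_div_sq_le hc hε

/-- Polynomial growth in `1/ε` is harmless against exponential decay, at the price of a smaller
rate. -/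
theorem mul_of_bound (hg : ExpSmall δ g) (K : ℝ) (hK : 0 ≤ K)
    (H : ∀ ε, 0 < ε → ε ≤ 1 → ∀ r ∈ Icc (-δ) δ, |h ε r| ≤ K / ε ^ 2) :
    ExpSmall δ fun ε r => g ε r * h ε r := by
  obtain ⟨c, hc, C, hC, H'⟩ := hg
  refine of_div_sq_bound c (C * K) hc (by positivity) fun ε hε hε1 r hr => ?_
  rw [abs_mul]
  calc |g ε r| * |h ε r| ≤ (C * Real.exp (-c / ε)) * (K / ε ^ 2) :=
        mul_le_mul (H' ε hε hε1 r hr) (H ε hε hε1 r hr) (abs_nonneg _) (by positivity)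
    _ = _ := by ring

theorem mul_continuousOn (hg : ExpSmall δ g) {k : ℝ → ℝ} (hk : ContinuousOn k (Icc (-δ) δ)) :
    ExpSmall δ fun ε r => g ε r * k r := by
  obtain ⟨K, hK⟩ := isCompact_Icc.exists_bound_of_continuousOn hk
  refine hg.mul_of_bound (|K|) (abs_nonneg _) fun ε hε hε1 r hr => ?_
  refine ((hK r hr).trans (le_abs_self K)).trans ?_
  rw [le_div_iff₀ (by positivity)]
  have : ε ^ 2 ≤ 1 := pow_le_one₀ hε.le hε1
  nlinarith [abs_nonneg K]

theorem integral_isBigO (hδ : 0 < δ) (hg : ExpSmall δ g) :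
    ∃ c, 0 < c ∧ (fun ε => ∫ r in (-δ)..δ, g ε r) =O[𝓝[>] 0] fun ε => Real.exp (-c / ε) := by
  obtain ⟨c, hc, C, hC, H⟩ := hg
  refine ⟨c, hc, IsBigO.of_bound (C * |δ - -δ|) ?_⟩
  filter_upwards [Ioc_mem_nhdsGT (zero_lt_one' ℝ)] with ε hε
  have := intervalIntegral.norm_integral_le_of_norm_le_const (a := -δ) (b := δ) (f := g ε)
    (C := C * Real.exp (-c / ε)) fun r hr => by
      rw [uIoc_of_le (by linarith)] at hr
      exact H ε hε.1 hε.2 r (Ioc_subset_Icc_self hr)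
  refine this.trans (le_of_eq ?_)
  rw [Real.norm_eq_abs, Real.abs_exp]
  ring

end ExpSmall

theorem isBigO_exp_of_le {c c' : ℝ} (h : c ≤ c') {f : ℝ → ℝ}
    (hf : f =O[𝓝[>] 0] fun ε => Real.exp (-c' / ε)) :
    f =O[𝓝[>] 0] fun ε => Real.exp (-c / ε) := by
  refine hf.trans (IsBigO.of_bound 1 ?_)
  filter_upwards [self_mem_nhdsWithin] with ε hε
  rw [Real.norm_eq_abs, Real.norm_eq_abs, Real.abs_exp, Real.abs_exp, one_mul]
  exact exp_neg_div_le_of_le hε h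

theorem exp_isBigO_sq {c : ℝ} (hc : 0 < c) :
    (fun ε : ℝ => Real.exp (-c / ε)) =O[𝓝[>] 0] fun ε => ε ^ 2 := by
  refine IsBigO.of_bound (8 / c ^ 2) ?_
  filter_upwards [self_mem_nhdsWithin] with ε hε
  have hε : 0 < ε := hε
  rw [Real.norm_eq_abs, Real.norm_eq_abs, Real.abs_exp, abs_of_pos (by positivity)]
  rw [← div_le_iff₀ (by positivity)]
  refine (exp_neg_div_div_sq_le hc hε).trans ?_
  have : Real.exp (-(c / 2) / ε) ≤ 1 := by
    rw [Real.exp_le_one_iff, neg_div]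
    have : 0 < c / 2 / ε := by positivity
    linarith
  calc _ ≤ 8 / c ^ 2 * 1 := by gcongr
    _ = _ := mul_one _

theorem integral_peak_isBigO {δ : ℝ} (hδ : 0 < δ) :
    (fun ε => (∫ r in (-δ)..δ, peak ε r) - c₀) =O[𝓝[>] 0] fun ε => Real.exp (-δ / ε) := by
  refine IsBigO.of_bound 8 ?_
  filter_upwards [self_mem_nhdsWithin] with ε hε
  rw [Real.norm_eq_abs, Real.norm_eq_abs, Real.abs_exp]
  exact abs_integral_peak_sub_le hε hδ

theorem integral_eq_zero_of_odd {f : ℝ → ℝ} (hf : ∀ r, f (-r) = -f r) (δ : ℝ) :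
    ∫ r in (-δ)..δ, f r = 0 := by
  have h := intervalIntegral.integral_comp_neg (a := -δ) (b := δ) f
  simp only [hf, intervalIntegral.integral_neg, neg_neg] at h
  linarith

/-! ### Energy density and Allen-Cahn defect of the truncated profile -/

section densities

variable (η : ℝ → ℝ) (δ : ℝ)

/-- The energy density of the truncated profile. -/
noncomputable def profileEnergy (ε r : ℝ) : ℝ :=
  ε / 2 * deriv (qCut η δ ε) r ^ 2 + 1 / ε * W (qCut η δ ε r)

/-- The defect of the truncated profile in the one-dimensional Allen-Cahn equation. -/
noncomputable def profileDefect (ε r : ℝ) : ℝ :=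
  -ε * deriv (deriv (qCut η δ ε)) r + 1 / ε * deriv W (qCut η δ ε r)

variable {η δ}

theorem continuous_profileEnergy (hη : IsCutoff η) (hδ : 0 < δ) (ε : ℝ) :
    Continuous (profileEnergy η δ ε) := by
  unfold profileEnergy
  have h1 := continuous_deriv_qCut (ε := ε) hη hδ
  have h2 := (contDiff_qCut (ε := ε) hη hδ).continuous
  have h3 := continuous_W.comp h2
  simp only [Function.comp_def] at h3
  fun_prop

theorem continuous_profileDefect (hη : IsCutoff η) (hδ : 0 < δ) (ε : ℝ) :
    Continuous (profileDefect η δ ε) := by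
  unfold profileDefect
  have h1 := continuous_deriv_deriv_qCut (ε := ε) hη hδ
  have h2 := (contDiff_qCut (ε := ε) hη hδ).continuous
  have h3 := continuous_deriv_W.comp h2
  simp only [Function.comp_def] at h3
  fun_prop

theorem W_neg (x : ℝ) : W (-x) = W x := by unfold W; ring

theorem profileEnergy_neg (hη : IsCutoff η) (ε r : ℝ) :
    profileEnergy η δ ε (-r) = profileEnergy η δ ε r := by
  unfold profileEnergy
  rw [deriv_qCut_neg hη, qCut_neg hη, W_neg]

theorem profileDefect_neg (hη : IsCutoff η) (ε r : ℝ) :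
    profileDefect η δ ε (-r) = -profileDefect η δ ε r := by
  unfold profileDefect
  rw [deriv_deriv_qCut_neg hη, qCut_neg hη, deriv_W, deriv_W]
  ring

theorem profileEnergy_of_abs_lt (hη : IsCutoff η) (hδ : 0 < δ) {ε r : ℝ} (hr : |r| < δ / 2) :
    profileEnergy η δ ε r = peak ε r := by
  unfold profileEnergy peak
  rw [deriv_qCut_of_abs_lt hη hδ hr, qCut_eq_of_abs_le hη hδ hr.le, profileSlope_sq]
  rcases eq_or_ne ε 0 with rfl | hε
  · simp
  have h := profileSlope_sq (r / ε)
  rw [div_pow, h]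
  field_simp
  ring

theorem eps_mul_deriv_sq_of_abs_lt (hη : IsCutoff η) (hδ : 0 < δ) {ε r : ℝ} (hr : |r| < δ / 2) :
    ε * deriv (qCut η δ ε) r ^ 2 = peak ε r := by
  unfold peak
  rw [deriv_qCut_of_abs_lt hη hδ hr]
  rcases eq_or_ne ε 0 with rfl | hε
  · simp
  field_simp

/-- The rescaled form of `q'' = W'(q)`. -/
theorem profileDefect_of_abs_lt (hη : IsCutoff η) (hδ : 0 < δ) {ε r : ℝ} (hr : |r| < δ / 2) :
    profileDefect η δ ε r = 0 := by
  unfold profileDefect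
  rw [deriv_deriv_qCut_of_abs_lt hη hδ hr, qCut_eq_of_abs_le hη hδ hr.le, deriv_W]
  rcases eq_or_ne ε 0 with rfl | hε
  · simp
  field_simp
  ring

/-- An even family which vanishes near `0` and is exponentially small in the transition layer. -/
theorem ExpSmall.of_layer {g : ℝ → ℝ → ℝ} (hδ : 0 < δ) (heven : ∀ ε r, |g ε (-r)| = |g ε r|)
    (hzero : ∀ ε r, |r| < δ / 2 → g ε r = 0) (C : ℝ) (hC : 0 ≤ C)
    (H : ∀ ε, 0 < ε → ε ≤ 1 → ∀ r, δ / 2 ≤ r → r ≤ δ →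
      |g ε r| ≤ C * (Real.exp (-(δ / 2) / ε) / ε ^ 2)) :
    ExpSmall δ g := by
  refine ExpSmall.of_div_sq_bound (δ / 2) C (by positivity) hC fun ε hε hε1 r hr => ?_
  have key : ∀ r, 0 ≤ r → r ≤ δ → |g ε r| ≤ C * (Real.exp (-(δ / 2) / ε) / ε ^ 2) := by
    intro r hr0 hr1
    by_cases h : r < δ / 2
    · rw [hzero ε r (by rwa [abs_of_nonneg hr0]), abs_zero]
      positivity
    · exact H ε hε hε1 r (not_lt.1 h) hr1
  rcases le_total 0 r with h | h
  · exact key r h hr.2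
  · rw [← heven]
    exact key (-r) (by linarith) (by linarith [hr.1])

/-- One factor of the squared slope supplies the decay, the other is bounded by `1`. -/
theorem peak_le_of_ge (hδ : 0 < δ) {ε r : ℝ} (hε : 0 < ε) (hε1 : ε ≤ 1) (hr : δ / 2 ≤ r) :
    |peak ε r| ≤ 16 * (Real.exp (-(δ / 2) / ε) / ε ^ 2) := by
  rw [abs_of_nonneg (peak_nonneg hε r)]
  unfold peak
  have h1 := profileSlope_le_exp (r / ε)
  have h2 := profileSlope_le_one (r / ε)
  have h0 := profileSlope_nonneg (r / ε)
  have h3 : Real.exp (-|r / ε|) ≤ Real.exp (-(δ / 2) / ε) := by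
    rw [abs_of_nonneg (by apply div_nonneg (by linarith) hε.le), ← neg_div]
    gcongr
  have h4 : ε⁻¹ ≤ 1 / ε ^ 2 := by
    rw [inv_eq_one_div, div_le_div_iff₀ hε (by positivity)]; nlinarith
  calc ε⁻¹ * profileSlope (r / ε) ^ 2 ≤ 1 / ε ^ 2 * (4 * Real.exp (-(δ / 2) / ε) * 1) := by
        rw [sq]; gcongr; exact h1.trans (by gcongr)
    _ ≤ 16 * (Real.exp (-(δ / 2) / ε) / ε ^ 2) := by
        have : 0 < Real.exp (-(δ / 2) / ε) / ε ^ 2 := by positivity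
        calc _ = 4 * (Real.exp (-(δ / 2) / ε) / ε ^ 2) := by ring
          _ ≤ _ := by gcongr; norm_num

theorem expSmall_eps_mul_deriv_sq_sub_peak (hη : IsCutoff η) (hδ : 0 < δ) :
    ExpSmall δ fun ε r => ε * deriv (qCut η δ ε) r ^ 2 - peak ε r := by
  obtain ⟨C, hC, H⟩ := exists_qCut_tail_bound hη hδ
  refine ExpSmall.of_layer hδ (fun ε r => by rw [deriv_qCut_neg hη, peak_neg])
    (fun ε r hr => by rw [eps_mul_deriv_sq_of_abs_lt hη hδ hr, sub_self]) (C ^ 2 + 16)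
    (by positivity) fun ε hε hε1 r hr1 hr2 => ?_
  obtain ⟨-, h2, -⟩ := H ε hε hε1 r hr1 hr2
  set E := Real.exp (-(δ / 2) / ε) with hE
  have hE1 : E ≤ 1 := by
    rw [hE, Real.exp_le_one_iff, neg_div]
    have : 0 < δ / 2 / ε := by positivity
    linarith
  have hE0 : 0 < E := Real.exp_pos _
  calc |ε * deriv (qCut η δ ε) r ^ 2 - peak ε r|
      ≤ |ε * deriv (qCut η δ ε) r ^ 2| + |peak ε r| := abs_sub _ _
    _ = ε * |deriv (qCut η δ ε) r| ^ 2 + |peak ε r| := by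
      rw [abs_mul, abs_of_pos hε, abs_pow]
    _ ≤ 1 * (C * E / ε) ^ 2 + 16 * (E / ε ^ 2) := by
      gcongr
      exact peak_le_of_ge hδ hε hε1 hr1
    _ = (C ^ 2 * E + 16) * (E / ε ^ 2) := by ring
    _ ≤ (C ^ 2 * 1 + 16) * (E / ε ^ 2) := by gcongr
    _ = _ := by ring

theorem expSmall_profileEnergy_sub_peak (hη : IsCutoff η) (hδ : 0 < δ) :
    ExpSmall δ fun ε r => profileEnergy η δ ε r - peak ε r := by
  obtain ⟨C, hC, H⟩ := exists_qCut_tail_bound hη hδ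
  refine ExpSmall.of_layer hδ (fun ε r => by rw [profileEnergy_neg hη, peak_neg])
    (fun ε r hr => by rw [profileEnergy_of_abs_lt hη hδ hr, sub_self]) (C ^ 2 + C ^ 2 + 16)
    (by positivity) fun ε hε hε1 r hr1 hr2 => ?_
  obtain ⟨h1, h2, -⟩ := H ε hε hε1 r hr1 hr2
  set E := Real.exp (-(δ / 2) / ε) with hE
  have hE1 : E ≤ 1 := by
    rw [hE, Real.exp_le_one_iff, neg_div]
    have : 0 < δ / 2 / ε := by positivity
    linarith
  have hE0 : 0 < E := Real.exp_pos _
  -- `W(x) = (1 - x)² (1 + x)²/4`, and the last factor is at most `1` on `[-1, 1]`.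
  have hW : |W (qCut η δ ε r)| ≤ |1 - qCut η δ ε r| ^ 2 := by
    have h4 := abs_le.1 (abs_qCut_le_one (δ := δ) (ε := ε) hη r)
    set x := qCut η δ ε r
    rw [abs_of_nonneg (by unfold W; positivity), sq_abs]
    unfold W
    have : 1 / 4 * (1 - x ^ 2) ^ 2 = (1 - x) ^ 2 * ((1 + x) ^ 2 / 4) := by ring
    rw [this]
    apply mul_le_of_le_one_right (sq_nonneg _)
    nlinarith
  have hinv2 : 1 / ε ≤ 1 / ε ^ 2 := by
    rw [div_le_div_iff₀ hε (by positivity)]; nlinarith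
  calc |profileEnergy η δ ε r - peak ε r|
      ≤ |profileEnergy η δ ε r| + |peak ε r| := abs_sub _ _
    _ ≤ |ε / 2 * deriv (qCut η δ ε) r ^ 2| + |1 / ε * W (qCut η δ ε r)| + |peak ε r| := by
      gcongr; exact abs_add_le _ _
    _ = ε / 2 * |deriv (qCut η δ ε) r| ^ 2 + 1 / ε * |W (qCut η δ ε r)| + |peak ε r| := by
      rw [abs_mul, abs_mul, abs_of_pos (by positivity : 0 < ε / 2),
        abs_of_pos (by positivity : 0 < 1 / ε), abs_pow]
    _ ≤ 1 * (C * E / ε) ^ 2 + 1 / ε ^ 2 * (C * E) ^ 2 + 16 * (E / ε ^ 2) := by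
      gcongr
      · linarith
      · exact hW.trans (by gcongr)
      · exact peak_le_of_ge hδ hε hε1 hr1
    _ = (C ^ 2 * E + C ^ 2 * E + 16) * (E / ε ^ 2) := by ring
    _ ≤ (C ^ 2 * 1 + C ^ 2 * 1 + 16) * (E / ε ^ 2) := by gcongr
    _ = _ := by ring

theorem expSmall_profileDefect (hη : IsCutoff η) (hδ : 0 < δ) :
    ExpSmall δ (profileDefect η δ) := by
  obtain ⟨C, hC, H⟩ := exists_qCut_tail_bound hη hδ
  refine ExpSmall.of_layer hδ (fun ε r => by rw [profileDefect_neg hη, abs_neg])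
    (fun ε r hr => profileDefect_of_abs_lt hη hδ hr) (C + 2 * C)
    (by positivity) fun ε hε hε1 r hr1 hr2 => ?_
  obtain ⟨h1, -, h3⟩ := H ε hε hε1 r hr1 hr2
  set E := Real.exp (-(δ / 2) / ε) with hE
  have hE0 : 0 < E := Real.exp_pos _
  have hW : |deriv W (qCut η δ ε r)| ≤ 2 * |1 - qCut η δ ε r| := by
    have h4 := abs_le.1 (abs_qCut_le_one (δ := δ) (ε := ε) hη r)
    set x := qCut η δ ε r
    have : deriv W x = -(x * (1 + x)) * (1 - x) := by rw [deriv_W]; ring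
    rw [this, abs_mul, abs_neg]
    gcongr
    rw [abs_le]; constructor <;> nlinarith
  have hinv2 : 1 / ε ≤ 1 / ε ^ 2 := by
    rw [div_le_div_iff₀ hε (by positivity)]; nlinarith
  unfold profileDefect
  calc |-ε * deriv (deriv (qCut η δ ε)) r + 1 / ε * deriv W (qCut η δ ε r)|
      ≤ |-ε * deriv (deriv (qCut η δ ε)) r| + |1 / ε * deriv W (qCut η δ ε r)| := abs_add_le _ _
    _ = ε * |deriv (deriv (qCut η δ ε)) r| + 1 / ε * |deriv W (qCut η δ ε r)| := by
      rw [abs_mul, abs_mul, abs_neg, abs_of_pos hε, abs_of_pos (by positivity : 0 < 1 / ε)]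
    _ ≤ 1 * (C * E / ε ^ 2) + 1 / ε ^ 2 * (2 * (C * E)) := by
      gcongr
      exact hW.trans (by gcongr)
    _ = _ := by ring

theorem exists_deriv_qCut_bound (hη : IsCutoff η) (hδ : 0 < δ) :
    ∃ K, 0 ≤ K ∧ ∀ ε, 0 < ε → ε ≤ 1 → ∀ r ∈ Icc (-δ) δ, |deriv (qCut η δ ε) r| ≤ K / ε := by
  obtain ⟨C, hC, H⟩ := exists_qCut_tail_bound hη hδ
  refine ⟨C + 1, by positivity, fun ε hε hε1 r hr => ?_⟩
  have key : ∀ r, 0 ≤ r → r ≤ δ → |deriv (qCut η δ ε) r| ≤ (C + 1) / ε := by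
    intro r hr0 hr1
    by_cases h : r < δ / 2
    · rw [deriv_qCut_of_abs_lt hη hδ (by rwa [abs_of_nonneg hr0]),
        abs_of_nonneg (div_nonneg (profileSlope_nonneg _) hε.le)]
      gcongr
      linarith [profileSlope_le_one (r / ε)]
    · refine (H ε hε hε1 r (not_lt.1 h) hr1).2.1.trans ?_
      gcongr
      have : Real.exp (-(δ / 2) / ε) ≤ 1 := by
        rw [Real.exp_le_one_iff, neg_div]
        have : 0 < δ / 2 / ε := by positivity
        linarith
      nlinarith
  rcases le_total 0 r with h | h
  · exact key r h hr.2
  · rw [← deriv_qCut_neg hη]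
    exact key (-r) (by linarith) (by linarith [hr.1])

theorem inv_le_inv_sq {K ε : ℝ} (hK : 0 ≤ K) (hε : 0 < ε) (hε1 : ε ≤ 1) : K / ε ≤ K / ε ^ 2 := by
  apply div_le_div_of_nonneg_left hK (by positivity)
  nlinarith

theorem expSmall_profileDefect_mul_deriv (hη : IsCutoff η) (hδ : 0 < δ) :
    ExpSmall δ fun ε r => profileDefect η δ ε r * deriv (qCut η δ ε) r := by
  obtain ⟨K, hK, H⟩ := exists_deriv_qCut_bound hη hδ
  exact (expSmall_profileDefect hη hδ).mul_of_bound K hK fun ε hε hε1 r hr =>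
    (H ε hε hε1 r hr).trans (inv_le_inv_sq hK hε hε1)

/-- Written as a product so that one factor supplies the decay and the other only needs the crude
bound `C/ε`. -/
theorem expSmall_profileDefect_sq (hη : IsCutoff η) (hδ : 0 < δ) :
    ExpSmall δ fun ε r => profileDefect η δ ε r * (profileDefect η δ ε r / ε) := by
  have h := expSmall_profileDefect hη hδ
  obtain ⟨c, hc, C, hC, H⟩ := h
  refine (expSmall_profileDefect hη hδ).mul_of_bound C hC fun ε hε hε1 r hr => ?_
  rw [abs_div, abs_of_pos hε]
  refine le_trans ?_ (inv_le_inv_sq hC hε hε1)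
  gcongr
  refine (H ε hε hε1 r hr).trans ?_
  have : Real.exp (-c / ε) ≤ 1 := by
    rw [Real.exp_le_one_iff, neg_div]
    have : 0 < c / ε := by positivity
    linarith
  nlinarith

end densities

/-! ### Asymptotics of the integrals in the normal variable -/

section oneDimensional

variable {η : ℝ → ℝ} {δ : ℝ}

theorem tendsto_exp_neg_div {c : ℝ} (hc : 0 < c) :
    Tendsto (fun ε : ℝ => Real.exp (-c / ε)) (𝓝[>] 0) (𝓝 0) := by
  refine Real.tendsto_exp_atBot.comp ?_
  refine (tendsto_neg_atTop_atBot.comp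
    ((tendsto_inv_nhdsGT_zero (𝕜 := ℝ)).const_mul_atTop hc)).congr fun ε => ?_
  simp only [Function.comp]
  ring

theorem integral_isBigO_of_peak (hδ : 0 < δ) {g : ℝ → ℝ → ℝ} (hg : ∀ ε, Continuous (g ε))
    (h : ExpSmall δ fun ε r => g ε r - peak ε r) :
    ∃ c, 0 < c ∧ (fun ε => (∫ r in (-δ)..δ, g ε r) - c₀) =O[𝓝[>] 0]
      fun ε => Real.exp (-c / ε) := by
  obtain ⟨c, hc, H⟩ := h.integral_isBigO hδ
  refine ⟨min c δ, lt_min hc hδ, ?_⟩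
  have := (isBigO_exp_of_le (min_le_left c δ) H).add
    (isBigO_exp_of_le (min_le_right c δ) (integral_peak_isBigO hδ))
  refine this.congr_left fun ε => ?_
  rw [intervalIntegral.integral_sub ((hg ε).intervalIntegrable _ _)
    ((continuous_peak ε).intervalIntegrable _ _)]
  ring

/-- The weight `L - b r` is the averaged Jacobian, with `b = 2π` in the application. The energy
density is even, so the linear term integrates to zero and leaves only the error in the mass. -/
theorem profileLength_isBigO (hη : IsCutoff η) (hδ : 0 < δ) (L b : ℝ) :
    ∃ c, 0 < c ∧ (fun ε => 1 / c₀ * (∫ r in (-δ)..δ, profileEnergy η δ ε r * (L - b * r)) - L)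
      =O[𝓝[>] 0] fun ε => Real.exp (-c / ε) := by
  obtain ⟨c, hc, H⟩ := integral_isBigO_of_peak hδ (continuous_profileEnergy hη hδ)
    (expSmall_profileEnergy_sub_peak hη hδ)
  refine ⟨c, hc, (H.const_mul_left (L / c₀)).congr_left fun ε => ?_⟩
  have he := continuous_profileEnergy hη hδ ε
  have h0 : ∫ r in (-δ)..δ, b * (profileEnergy η δ ε r * r) = 0 :=
    integral_eq_zero_of_odd (fun r => by rw [profileEnergy_neg hη]; ring) δ
  have h1 : ∫ r in (-δ)..δ, profileEnergy η δ ε r * (L - b * r)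
      = L * ∫ r in (-δ)..δ, profileEnergy η δ ε r := by
    rw [← intervalIntegral.integral_const_mul, ← sub_eq_zero,
      ← intervalIntegral.integral_sub (Continuous.intervalIntegrable (by fun_prop) _ _)
      (Continuous.intervalIntegrable (by fun_prop) _ _), ← neg_eq_zero, ← h0,
      ← intervalIntegral.integral_neg]
    congr 1
    ext r
    ring
  rw [h1]
  field_simp [c₀_pos.ne']

/-- The defect term is exponentially small. The other term has the constant weight `b`, so no
expansion in `r` is needed and the error stays exponential. -/
theorem profileWinding_isBigO (hη : IsCutoff η) (hδ : 0 < δ) (L b : ℝ) :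
    ∃ c, 0 < c ∧ (fun ε => 1 / c₀ * (∫ r in (-δ)..δ,
        (profileDefect η δ ε r * deriv (qCut η δ ε) r * (L - b * r)
          + b * (ε * deriv (qCut η δ ε) r ^ 2))) - b)
      =O[𝓝[>] 0] fun ε => Real.exp (-c / ε) := by
  have hf := fun ε => continuous_deriv_qCut (ε := ε) hη hδ
  have ha := continuous_profileDefect hη hδ
  obtain ⟨c₁, hc₁, H₁⟩ := integral_isBigO_of_peak hδ
    (g := fun ε r => ε * deriv (qCut η δ ε) r ^ 2)
    (fun ε => by have := hf ε; fun_prop) (expSmall_eps_mul_deriv_sq_sub_peak hη hδ)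
  obtain ⟨c₂, hc₂, H₂⟩ := ((expSmall_profileDefect_mul_deriv hη hδ).mul_continuousOn
    (k := fun r => L - b * r) (by fun_prop)).integral_isBigO hδ
  refine ⟨min c₁ c₂, lt_min hc₁ hc₂, ?_⟩
  have := ((isBigO_exp_of_le (min_le_left c₁ c₂) H₁).const_mul_left (b / c₀)).add
    ((isBigO_exp_of_le (min_le_right c₁ c₂) H₂).const_mul_left (1 / c₀))
  refine this.congr_left fun ε => ?_
  have hfε := hf ε
  have haε := ha ε
  rw [intervalIntegral.integral_add (Continuous.intervalIntegrable (by fun_prop) _ _)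
      (Continuous.intervalIntegrable (by fun_prop) _ _), intervalIntegral.integral_const_mul b]
  field_simp [c₀_pos.ne']
  ring

/-- Three moments of the peak: the constant term sees its mass, the linear term vanishes by
evenness, and the remainder is controlled by the second moment. -/
theorem integral_peak_mul_isBigO (hδ : 0 < δ) {A R : ℝ → ℝ} {B K M : ℝ}
    (hA : ContinuousOn A (Icc (-δ) δ))
    (hAR : ∀ r ∈ Icc (-δ) δ, A r = B + K * r + r ^ 2 * R r)
    (hR : ∀ r ∈ Icc (-δ) δ, |R r| ≤ M) :
    (fun ε => (∫ r in (-δ)..δ, peak ε r * A r) - c₀ * B) =O[𝓝[>] 0] fun ε => ε ^ 2 := by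
  have hle : -δ ≤ δ := by linarith
  have h1 : (fun ε => B * ((∫ r in (-δ)..δ, peak ε r) - c₀)) =O[𝓝[>] 0] fun ε => ε ^ 2 :=
    ((integral_peak_isBigO hδ).trans (exp_isBigO_sq hδ)).const_mul_left B
  have hint : ∀ ε, IntervalIntegrable (fun r => peak ε r * A r) volume (-δ) δ := fun ε => by
    apply ContinuousOn.intervalIntegrable
    rw [uIcc_of_le hle]
    exact (continuous_peak ε).continuousOn.mul hA
  have h2 : (fun ε => ∫ r in (-δ)..δ, (peak ε r * A r - (B * peak ε r + K * (r * peak ε r))))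
      =O[𝓝[>] 0] fun ε => ε ^ 2 := by
    refine IsBigO.of_bound (M * (64 * Real.pi)) ?_
    filter_upwards [self_mem_nhdsWithin] with ε hε
    have hε : 0 < ε := hε
    have hM : 0 ≤ M := (abs_nonneg _).trans (hR 0 (by constructor <;> linarith))
    have hp := continuous_peak ε
    calc ‖∫ r in (-δ)..δ, (peak ε r * A r - (B * peak ε r + K * (r * peak ε r)))‖
        ≤ ∫ r in (-δ)..δ, M * (r ^ 2 * peak ε r) := by
          apply intervalIntegral.norm_integral_le_of_norm_le hle
          · filter_upwards with r hr
            have hr' := Ioc_subset_Icc_self hr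
            have e : peak ε r * A r - (B * peak ε r + K * (r * peak ε r))
                = R r * (r ^ 2 * peak ε r) := by rw [hAR r hr']; ring
            rw [e, Real.norm_eq_abs, abs_mul,
              abs_of_nonneg (mul_nonneg (sq_nonneg r) (peak_nonneg hε r))]
            exact mul_le_mul_of_nonneg_right (hR r hr')
              (mul_nonneg (sq_nonneg r) (peak_nonneg hε r))
          · exact Continuous.intervalIntegrable (by fun_prop) _ _
      _ = M * ∫ r in (-δ)..δ, r ^ 2 * peak ε r := intervalIntegral.integral_const_mul _ _
      _ ≤ M * (64 * Real.pi * ε ^ 2) := by gcongr; exact integral_sq_mul_peak_le hε hδ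
      _ = M * (64 * Real.pi) * ‖ε ^ 2‖ := by
        rw [Real.norm_eq_abs, abs_of_nonneg (by positivity)]; ring
  refine (h1.add h2).congr_left fun ε => ?_
  have hp := continuous_peak ε
  have h0 : ∫ r in (-δ)..δ, K * (r * peak ε r) = 0 :=
    integral_eq_zero_of_odd (fun r => by rw [peak_neg]; ring) δ
  rw [intervalIntegral.integral_sub (hint ε) (Continuous.intervalIntegrable (by fun_prop) _ _),
    intervalIntegral.integral_add (Continuous.intervalIntegrable (by fun_prop) _ _)
      (Continuous.intervalIntegrable (by fun_prop) _ _), h0, intervalIntegral.integral_const_mul]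
  ring

/-- The integrand is the squared curvature expanded: the two terms containing the defect are
exponentially small. In the application `A(r)` is the integral of `κ²/(1 - rκ)` along the curve. -/
theorem profileElastica_isBigO (hη : IsCutoff η) (hδ : 0 < δ) (L b : ℝ) {A R : ℝ → ℝ} {B K M : ℝ}
    (hA : ContinuousOn A (Icc (-δ) δ))
    (hAR : ∀ r ∈ Icc (-δ) δ, A r = B + K * r + r ^ 2 * R r)
    (hR : ∀ r ∈ Icc (-δ) δ, |R r| ≤ M) :
    (fun ε => 1 / c₀ * (∫ r in (-δ)..δ,
        (profileDefect η δ ε r * (profileDefect η δ ε r / ε) * (L - b * r)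
          + 2 * b * (profileDefect η δ ε r * deriv (qCut η δ ε) r)
          + ε * deriv (qCut η δ ε) r ^ 2 * A r)) - B)
      =O[𝓝[>] 0] fun ε => ε ^ 2 := by
  have hle : -δ ≤ δ := by linarith
  obtain ⟨c₁, hc₁, H₁⟩ := ((expSmall_profileDefect_sq hη hδ).mul_continuousOn
    (k := fun r => L - b * r) (by fun_prop)).integral_isBigO hδ
  obtain ⟨c₂, hc₂, H₂⟩ := ((expSmall_profileDefect_mul_deriv hη hδ)).integral_isBigO hδ
  obtain ⟨c₃, hc₃, H₃⟩ := ((expSmall_eps_mul_deriv_sq_sub_peak hη hδ).mul_continuousOn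
    hA).integral_isBigO hδ
  have H₄ := integral_peak_mul_isBigO hδ hA hAR hR
  have := ((((H₁.trans (exp_isBigO_sq hc₁)).add
    ((H₂.trans (exp_isBigO_sq hc₂)).const_mul_left (2 * b))).add
    (H₃.trans (exp_isBigO_sq hc₃))).add H₄).const_mul_left (1 / c₀)
  refine this.congr_left fun ε => ?_
  have hfε := continuous_deriv_qCut (ε := ε) hη hδ
  have haε := continuous_profileDefect hη hδ ε
  have hp := continuous_peak ε
  have i1 : IntervalIntegrable (fun r => peak ε r * A r) volume (-δ) δ := by
    apply ContinuousOn.intervalIntegrable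
    rw [uIcc_of_le hle]
    exact hp.continuousOn.mul hA
  have i2 : IntervalIntegrable (fun r => ε * deriv (qCut η δ ε) r ^ 2 * A r) volume (-δ) δ := by
    apply ContinuousOn.intervalIntegrable
    rw [uIcc_of_le hle]
    exact ContinuousOn.mul (by fun_prop) hA
  have e3 : ∫ r in (-δ)..δ, (ε * deriv (qCut η δ ε) r ^ 2 - peak ε r) * A r
      = (∫ r in (-δ)..δ, ε * deriv (qCut η δ ε) r ^ 2 * A r) - ∫ r in (-δ)..δ, peak ε r * A r := by
    rw [← intervalIntegral.integral_sub i2 i1]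
    congr 1; ext r; ring
  rw [intervalIntegral.integral_add (Continuous.intervalIntegrable (by fun_prop) _ _) i2,
    intervalIntegral.integral_add (Continuous.intervalIntegrable (by fun_prop) _ _)
    (Continuous.intervalIntegrable (by fun_prop) _ _), intervalIntegral.integral_const_mul (2 * b),
    e3]
  field_simp [c₀_pos.ne']
  ring

/-- The functions `peak ε / c₀` form an approximate identity: nonnegative, of mass tending to `1`,
and uniformly small away from `0`. -/
theorem tendsto_integral_peak_mul (hδ : 0 < δ) {g : ℝ → ℝ} (hg : ContinuousOn g (Icc (-δ) δ)) :
    Tendsto (fun ε => ∫ r in (-δ)..δ, peak ε r * g r) (𝓝[>] 0) (𝓝 (c₀ * g 0)) := by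
  have hle : -δ ≤ δ := by linarith
  have h0mem : Icc (-δ) δ ∈ 𝓝 (0 : ℝ) := Icc_mem_nhds (by linarith) hδ
  have h := tendsto_setIntegral_peak_smul_of_integrableOn_of_tendsto (μ := volume)
    (s := Ioc (-δ) δ) (t := Ioc (-δ) δ) (x₀ := (0 : ℝ)) (l := 𝓝[>] (0 : ℝ))
    (φ := fun ε r => c₀⁻¹ * peak ε r) (g := g) (a := g 0) measurableSet_Ioc measurableSet_Ioc
    le_rfl self_mem_nhdsWithin measure_Ioc_lt_top.ne ?_ ?_ ?_ ?_ ?_ ?_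
  · have h2 := h.const_mul c₀
    refine h2.congr fun ε => ?_
    rw [intervalIntegral.integral_of_le hle, ← integral_const_mul]
    congr 1; ext r
    have := c₀_pos.ne'
    simp only [smul_eq_mul]
    field_simp
  · filter_upwards [self_mem_nhdsWithin] with ε hε r _
    exact mul_nonneg (inv_nonneg.2 c₀_pos.le) (peak_nonneg hε r)
  · intro u hu h0
    obtain ⟨ρ, hρ, hρu⟩ := Metric.isOpen_iff.1 hu 0 h0
    have hlim : Tendsto (fun ε : ℝ => c₀⁻¹ * (16 * (8 / ρ ^ 2 * Real.exp (-(ρ / 2) / ε))))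
        (𝓝[>] 0) (𝓝 0) := by
      have := (((tendsto_exp_neg_div (half_pos hρ)).const_mul (8 / ρ ^ 2)).const_mul 16).const_mul
        c₀⁻¹
      simpa using this
    rw [Metric.tendstoUniformlyOn_iff]
    intro κ hκ
    filter_upwards [hlim.eventually_lt_const hκ, Ioc_mem_nhdsGT (zero_lt_one' ℝ)] with ε hε hε1 r hr
    have hr1 : ρ ≤ |r| := by
      by_contra hcon
      exact hr.2 (hρu (by simpa using not_le.1 hcon))
    have hp : |peak ε r| ≤ 16 * (Real.exp (-ρ / ε) / ε ^ 2) := by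
      have h3 : peak ε r = peak ε |r| := by
        rcases abs_choice r with h | h <;> rw [h]
        rw [peak_neg]
      rw [h3]
      have := peak_le_of_ge (δ := 2 * ρ) (by positivity) hε1.1 hε1.2 (r := |r|) (by linarith)
      rwa [show 2 * ρ / 2 = ρ by ring] at this
    rw [Pi.zero_apply, dist_zero_left, norm_mul, Real.norm_eq_abs, Real.norm_eq_abs,
      abs_of_pos (inv_pos.2 c₀_pos)]
    refine lt_of_le_of_lt ?_ hε
    have := c₀_pos
    gcongr
    refine hp.trans ?_
    gcongr
    exact exp_neg_div_div_sq_le hρ hε1.1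
  · have h1 : Tendsto (fun ε => (∫ r in (-δ)..δ, peak ε r) - c₀) (𝓝[>] 0) (𝓝 0) :=
      (integral_peak_isBigO hδ).trans_tendsto (tendsto_exp_neg_div hδ)
    have h2 := (h1.add_const c₀).const_mul c₀⁻¹
    simp only [sub_add_cancel, zero_add, inv_mul_cancel₀ c₀_pos.ne'] at h2
    refine h2.congr fun ε => ?_
    rw [intervalIntegral.integral_of_le hle, ← integral_const_mul]
  · filter_upwards with ε
    have := continuous_peak ε
    exact Continuous.aestronglyMeasurable (by fun_prop)
  · exact (hg.integrableOn_compact isCompact_Icc).mono_set Ioc_subset_Icc_self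
  · exact ((hg 0 (mem_of_mem_nhds h0mem)).continuousAt h0mem).tendsto.mono_left
      nhdsWithin_le_nhds

theorem tendsto_integral_profileEnergy_mul (hη : IsCutoff η) (hδ : 0 < δ) {g : ℝ → ℝ}
    (hg : ContinuousOn g (Icc (-δ) δ)) :
    Tendsto (fun ε => 1 / c₀ * ∫ r in (-δ)..δ, profileEnergy η δ ε r * g r) (𝓝[>] 0)
      (𝓝 (g 0)) := by
  have hle : -δ ≤ δ := by linarith
  obtain ⟨c, hc, H⟩ := ((expSmall_profileEnergy_sub_peak hη hδ).mul_continuousOn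
    hg).integral_isBigO hδ
  have h1 := ((H.trans_tendsto (tendsto_exp_neg_div hc)).add
    (tendsto_integral_peak_mul hδ hg)).const_mul (1 / c₀)
  have e : 1 / c₀ * (0 + c₀ * g 0) = g 0 := by field_simp [c₀_pos.ne']; ring
  rw [e] at h1
  refine h1.congr fun ε => ?_
  have i1 : IntervalIntegrable (fun r => peak ε r * g r) volume (-δ) δ := by
    apply ContinuousOn.intervalIntegrable
    rw [uIcc_of_le hle]
    exact (continuous_peak ε).continuousOn.mul hg
  have i2 : IntervalIntegrable (fun r => profileEnergy η δ ε r * g r) volume (-δ) δ := by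
    apply ContinuousOn.intervalIntegrable
    rw [uIcc_of_le hle]
    exact (continuous_profileEnergy hη hδ ε).continuousOn.mul hg
  congr 1
  simp_rw [sub_mul]
  rw [intervalIntegral.integral_sub i2 i1]
  ring

end oneDimensional

/-! ### Plane vectors -/

/-- Rotation by `π/2`. -/
noncomputable def rot : Plane →L[ℝ] Plane :=
  LinearMap.toContinuousLinearMap
    { toFun := fun v => !₂[-v 1, v 0]
      map_add' := fun v w => by ext i; fin_cases i <;> simp [add_comm]
      map_smul' := fun c v => by ext i; fin_cases i <;> simp }

/-- The identification of the plane with `ℂ`. -/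
noncomputable def toComplex : Plane →L[ℝ] ℂ :=
  LinearMap.toContinuousLinearMap
    { toFun := fun v => ⟨v 0, v 1⟩
      map_add' := fun v w => by apply Complex.ext <;> simp
      map_smul' := fun c v => by apply Complex.ext <;> simp }

@[simp] theorem rot_apply_zero (v : Plane) : rot v 0 = -v 1 := by simp [rot]

@[simp] theorem rot_apply_one (v : Plane) : rot v 1 = v 0 := by simp [rot]

@[simp] theorem toComplex_re (v : Plane) : (toComplex v).re = v 0 := by simp [toComplex]

@[simp] theorem toComplex_im (v : Plane) : (toComplex v).im = v 1 := by simp [toComplex]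

theorem plane_inner (v w : Plane) : inner ℝ v w = v 0 * w 0 + v 1 * w 1 := by
  simp [PiLp.inner_apply, Fin.sum_univ_two, mul_comm]

theorem plane_norm_sq (v : Plane) : ‖v‖ ^ 2 = v 0 ^ 2 + v 1 ^ 2 := by
  rw [← real_inner_self_eq_norm_sq, plane_inner]; ring

theorem plane_ext {v w : Plane} (h0 : v 0 = w 0) (h1 : v 1 = w 1) : v = w := by
  ext i; fin_cases i
  · exact h0
  · exact h1

theorem toComplex_eq_zero {v : Plane} : toComplex v = 0 ↔ v = 0 := by
  constructor
  · intro h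
    have h0 := congrArg Complex.re h
    have h1 := congrArg Complex.im h
    simp at h0 h1
    exact plane_ext (by simpa using h0) (by simpa using h1)
  · rintro rfl; simp

theorem toComplex_rot (v : Plane) : toComplex (rot v) = Complex.I * toComplex v := by
  apply Complex.ext <;> simp

theorem inner_rot_self (v : Plane) : inner ℝ (rot v) v = 0 := by
  simp [plane_inner]; ring

theorem inner_self_rot (v : Plane) : inner ℝ v (rot v) = 0 := by
  simp [plane_inner]; ring

theorem norm_rot (v : Plane) : ‖rot v‖ = ‖v‖ := by
  rw [← sq_eq_sq₀ (norm_nonneg _) (norm_nonneg _), plane_norm_sq, plane_norm_sq]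
  simp; ring

theorem rot_rot (v : Plane) : rot (rot v) = -v := by
  apply plane_ext <;> simp

/-- Decomposition of a vector in a positively oriented orthonormal frame. -/
theorem frame_decomposition {t : Plane} (ht : ‖t‖ = 1) (w : Plane) :
    w = (inner ℝ w t : ℝ) • t + (inner ℝ w (rot t) : ℝ) • rot t := by
  have h : t 0 ^ 2 + t 1 ^ 2 = 1 := by rw [← plane_norm_sq, ht]; norm_num
  apply plane_ext
  · simp [plane_inner]
    linear_combination (-(w 0)) * h
  · simp [plane_inner]
    linear_combination (-(w 1)) * h

/-! ### Admissible curves -/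

/-- The unit normal, obtained by rotating the tangent. -/
noncomputable def normal (γ : ℝ → Plane) (s : ℝ) : Plane := rot (deriv γ s)

/-- The signed curvature. -/
noncomputable def curvature (γ : ℝ → Plane) (s : ℝ) : ℝ :=
  inner ℝ (deriv (deriv γ) s) (normal γ s)

namespace IsAdmissible

variable {L : ℝ} {γ : ℝ → Plane}

theorem contDiff_deriv (hγ : IsAdmissible L γ) : ContDiff ℝ 1 (deriv γ) :=
  ((contDiff_succ_iff_deriv (n := 1)).1 (by
    rw [one_add_one_eq_two]; exact hγ.contDiff)).2.2

theorem differentiable (hγ : IsAdmissible L γ) : Differentiable ℝ γ :=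
  hγ.contDiff.differentiable (by simp)

theorem hasDerivAt (hγ : IsAdmissible L γ) (s : ℝ) : HasDerivAt γ (deriv γ s) s :=
  (hγ.differentiable s).hasDerivAt

theorem continuous (hγ : IsAdmissible L γ) : Continuous γ := hγ.contDiff.continuous

theorem continuous_deriv (hγ : IsAdmissible L γ) : Continuous (deriv γ) :=
  hγ.contDiff_deriv.continuous

theorem hasDerivAt_deriv (hγ : IsAdmissible L γ) (s : ℝ) :
    HasDerivAt (deriv γ) (deriv (deriv γ) s) s :=
  ((hγ.contDiff_deriv.differentiable (by simp)) s).hasDerivAt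

theorem continuous_deriv_deriv (hγ : IsAdmissible L γ) : Continuous (deriv (deriv γ)) :=
  hγ.contDiff_deriv.continuous_deriv le_rfl

theorem contDiff_normal (hγ : IsAdmissible L γ) : ContDiff ℝ 1 (normal γ) :=
  rot.contDiff.comp hγ.contDiff_deriv

theorem continuous_normal (hγ : IsAdmissible L γ) : Continuous (normal γ) :=
  hγ.contDiff_normal.continuous

theorem continuous_curvature (hγ : IsAdmissible L γ) : Continuous (curvature γ) :=
  hγ.continuous_deriv_deriv.inner hγ.continuous_normal

theorem norm_normal (hγ : IsAdmissible L γ) (s : ℝ) : ‖normal γ s‖ = 1 := by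
  rw [normal, norm_rot, hγ.unit_speed]

/-- Differentiate `|γ'|² = 1`. -/
theorem inner_deriv_deriv_deriv (hγ : IsAdmissible L γ) (s : ℝ) :
    inner ℝ (deriv (deriv γ) s) (deriv γ s) = 0 := by
  have h1 := (hγ.hasDerivAt_deriv s).inner ℝ (hγ.hasDerivAt_deriv s)
  have h2 : (fun t => (inner ℝ (deriv γ t) (deriv γ t) : ℝ)) = fun _ => 1 := by
    funext t; rw [real_inner_self_eq_norm_sq, hγ.unit_speed]; norm_num
  rw [h2] at h1
  have h3 := h1.unique (hasDerivAt_const s (1 : ℝ))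
  rw [real_inner_comm (deriv (deriv γ) s)] at h3
  linarith

theorem deriv_deriv_eq (hγ : IsAdmissible L γ) (s : ℝ) :
    deriv (deriv γ) s = curvature γ s • normal γ s := by
  conv_lhs => rw [frame_decomposition (hγ.unit_speed s) (deriv (deriv γ) s)]
  rw [hγ.inner_deriv_deriv_deriv, zero_smul, zero_add]
  rfl

theorem norm_deriv_deriv_sq (hγ : IsAdmissible L γ) (s : ℝ) :
    ‖deriv (deriv γ) s‖ ^ 2 = curvature γ s ^ 2 := by
  rw [hγ.deriv_deriv_eq, norm_smul, hγ.norm_normal, mul_one, Real.norm_eq_abs, sq_abs]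

theorem hasDerivAt_normal (hγ : IsAdmissible L γ) (s : ℝ) :
    HasDerivAt (normal γ) (-curvature γ s • deriv γ s) s := by
  have h := rot.hasFDerivAt.comp_hasDerivAt s (hγ.hasDerivAt_deriv s)
  refine h.congr_deriv ?_
  rw [hγ.deriv_deriv_eq, map_smul, normal, rot_rot, smul_neg, neg_smul]

theorem periodic_deriv (hγ : IsAdmissible L γ) : Function.Periodic (deriv γ) L := by
  intro s
  have : (fun s => γ (s + L)) = γ := funext hγ.closed
  conv_rhs => rw [← this]
  rw [deriv_comp_add_const]

theorem periodic_deriv_deriv (hγ : IsAdmissible L γ) : Function.Periodic (deriv (deriv γ)) L := by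
  intro s
  have : (fun s => deriv γ (s + L)) = deriv γ := funext hγ.periodic_deriv
  conv_rhs => rw [← this]
  rw [deriv_comp_add_const]

theorem periodic_normal (hγ : IsAdmissible L γ) : Function.Periodic (normal γ) L := by
  intro s; unfold normal; rw [hγ.periodic_deriv]

theorem periodic_curvature (hγ : IsAdmissible L γ) : Function.Periodic (curvature γ) L := by
  intro s; unfold curvature; rw [hγ.periodic_deriv_deriv, hγ.periodic_normal]

theorem trace_eq_range (hγ : IsAdmissible L γ) (hL : 0 < L) : trace L γ = range γ := by
  have := hγ.closed.image_Icc hL 0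
  rwa [zero_add] at this

theorem exists_curvature_bound (hγ : IsAdmissible L γ) (hL : 0 < L) :
    ∃ K, 0 < K ∧ ∀ s, |curvature γ s| ≤ K := by
  obtain ⟨K, hK⟩ := isCompact_Icc.exists_bound_of_continuousOn (s := Icc 0 L)
    hγ.continuous_curvature.continuousOn
  refine ⟨|K| + 1, by positivity, fun s => ?_⟩
  obtain ⟨t, ht, h⟩ := hγ.periodic_curvature.exists_mem_Ico₀ hL s
  rw [h]
  have := hK t (Ico_subset_Icc_self ht)
  rw [Real.norm_eq_abs] at this
  linarith [le_abs_self K]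

/-- Simplicity on one period, transported to the whole line by reducing both parameters modulo `L`.
-/
theorem eq_iff (hγ : IsAdmissible L γ) (hL : 0 < L) {s t : ℝ} :
    γ s = γ t ↔ ∃ n : ℤ, s = t + n * L := by
  constructor
  · intro h
    have key : ∀ x, γ (toIcoMod hL 0 x) = γ x := fun x => by
      rw [toIcoMod, hγ.closed.sub_zsmul_eq]
    have h1 : γ (toIcoMod hL 0 s) = γ (toIcoMod hL 0 t) := by rw [key, key, h]
    have hm : ∀ x, toIcoMod hL 0 x ∈ Ico 0 L := fun x => by
      simpa using toIcoMod_mem_Ico hL 0 x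
    have h2 := hγ.simple (hm s) (hm t) h1
    refine ⟨toIcoDiv hL 0 s - toIcoDiv hL 0 t, ?_⟩
    have e1 := toIcoMod_add_toIcoDiv_zsmul hL 0 s
    have e2 := toIcoMod_add_toIcoDiv_zsmul hL 0 t
    rw [zsmul_eq_mul] at e1 e2
    push_cast
    linarith
  · rintro ⟨n, rfl⟩
    have := hγ.closed.int_mul n
    exact this t

theorem ne_of_lt (hγ : IsAdmissible L γ) (hL : 0 < L) {s h : ℝ} (h0 : 0 < h) (h1 : h < L) :
    γ (s + h) ≠ γ s := by
  intro h2
  obtain ⟨n, hn⟩ := (hγ.eq_iff hL).1 h2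
  have h3 : h = n * L := by linarith
  have h4 : (0 : ℝ) < n := by
    by_contra hc
    nlinarith [not_lt.1 hc]
  have h5 : (n : ℝ) < 1 := by
    by_contra hc
    nlinarith [not_lt.1 hc]
  have h6 : 0 < n := by exact_mod_cast h4
  have h7 : n < 1 := by exact_mod_cast h5
  omega

/-! ### Reparametrization -/

theorem shift (hγ : IsAdmissible L γ) (hL : 0 < L) (a : ℝ) : IsAdmissible L fun s => γ (s + a) where
  contDiff := hγ.contDiff.comp (contDiff_id.add contDiff_const)
  closed := fun s => by
    change γ (s + L + a) = γ (s + a)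
    rw [add_right_comm, hγ.closed]
  simple := by
    intro s hs t ht h
    obtain ⟨n, hn⟩ := (hγ.eq_iff hL).1 h
    have h3 : s - t = n * L := by linarith
    have h4 : (n : ℝ) < 1 := by
      by_contra hc
      nlinarith [not_lt.1 hc, hs.1, hs.2, ht.1, ht.2]
    have h5 : (-1 : ℝ) < n := by
      by_contra hc
      nlinarith [not_lt.1 hc, hs.1, hs.2, ht.1, ht.2]
    have h6 : n < 1 := by exact_mod_cast h4
    have h7 : -1 < n := by exact_mod_cast h5
    have h8 : n = 0 := by omega
    rw [h8] at h3
    push_cast at h3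
    linarith
  unit_speed := fun s => by rw [deriv_comp_add_const, hγ.unit_speed]
  mem_disk := fun s => hγ.mem_disk _

theorem reverse (hγ : IsAdmissible L γ) (hL : 0 < L) : IsAdmissible L fun s => γ (-s) where
  contDiff := hγ.contDiff.comp contDiff_neg
  closed := fun s => by
    change γ (-(s + L)) = γ (-s)
    rw [← hγ.closed (-(s + L))]; ring_nf
  simple := by
    intro s hs t ht h
    obtain ⟨n, hn⟩ := (hγ.eq_iff hL).1 h
    have h3 : t - s = n * L := by linarith
    have h4 : (n : ℝ) < 1 := by
      by_contra hc
      nlinarith [not_lt.1 hc, hs.1, hs.2, ht.1, ht.2]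
    have h5 : (-1 : ℝ) < n := by
      by_contra hc
      nlinarith [not_lt.1 hc, hs.1, hs.2, ht.1, ht.2]
    have h6 : n < 1 := by exact_mod_cast h4
    have h7 : -1 < n := by exact_mod_cast h5
    have h8 : n = 0 := by omega
    rw [h8] at h3
    push_cast at h3
    linarith
  unit_speed := fun s => by rw [deriv_comp_neg, norm_neg, hγ.unit_speed]
  mem_disk := fun s => hγ.mem_disk _

theorem trace_shift (hγ : IsAdmissible L γ) (hL : 0 < L) (a : ℝ) :
    trace L (fun s => γ (s + a)) = trace L γ := by
  rw [(hγ.shift hL a).trace_eq_range hL, hγ.trace_eq_range hL]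
  exact (Equiv.addRight a).surjective.range_comp γ

theorem trace_reverse (hγ : IsAdmissible L γ) (hL : 0 < L) :
    trace L (fun s => γ (-s)) = trace L γ := by
  rw [(hγ.reverse hL).trace_eq_range hL, hγ.trace_eq_range hL]
  exact (Equiv.neg ℝ).surjective.range_comp γ

theorem elastica_shift (hγ : IsAdmissible L γ) (a : ℝ) :
    elastica L (fun s => γ (s + a)) = elastica L γ := by
  unfold elastica
  have h1 : deriv (fun s => γ (s + a)) = fun s => deriv γ (s + a) := by
    funext s; rw [deriv_comp_add_const]
  simp_rw [h1, deriv_comp_add_const]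
  rw [intervalIntegral.integral_comp_add_right (fun s => ‖deriv (deriv γ) s‖ ^ 2)]
  have hp : Function.Periodic (fun s => ‖deriv (deriv γ) s‖ ^ 2) L := fun s => by
    simp only [hγ.periodic_deriv_deriv s]
  have := hp.intervalIntegral_add_eq a 0
  rw [zero_add] at this
  rw [zero_add, add_comm L a, this]

theorem elastica_reverse (hγ : IsAdmissible L γ) :
    elastica L (fun s => γ (-s)) = elastica L γ := by
  unfold elastica
  have h1 : deriv (fun s => γ (-s)) = fun s => -deriv γ (-s) := by
    funext s; rw [deriv_comp_neg]
  have h2 : ∀ s, ‖deriv (deriv fun s => γ (-s)) s‖ ^ 2 = ‖deriv (deriv γ) (-s)‖ ^ 2 := by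
    intro s
    rw [h1, deriv.fun_neg, deriv_comp_neg, neg_neg]
  simp_rw [h2]
  rw [intervalIntegral.integral_comp_neg (fun s => ‖deriv (deriv γ) s‖ ^ 2)]
  have hp : Function.Periodic (fun s => ‖deriv (deriv γ) s‖ ^ 2) L := fun s => by
    simp only [hγ.periodic_deriv_deriv s]
  have := hp.intervalIntegral_add_eq (-L) 0
  rw [neg_add_cancel, zero_add] at this
  rw [neg_zero, this]

end IsAdmissible

/-! ### Normalization of the parametrization -/

/-- The curve starts at a lowest point of its trace, where it is traversed in direction `e₁`. -/
structure StartsAtBottom (γ : ℝ → Plane) : Prop where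
  le : ∀ s, γ 0 1 ≤ γ s 1
  tangent_zero : deriv γ 0 0 = 1
  tangent_one : deriv γ 0 1 = 0

/-- At a minimum of the height the unit tangent is horizontal, hence `e₁` or `-e₁`; in the second
case the orientation is reversed. Trace and elastica energy are unaffected, so this normalization
costs nothing. -/
theorem IsAdmissible.exists_startsAtBottom {L : ℝ} {γ : ℝ → Plane} (hγ : IsAdmissible L γ)
    (hL : 0 < L) : ∃ β, IsAdmissible L β ∧ StartsAtBottom β ∧ trace L β = trace L γ ∧
      elastica L β = elastica L γ := by
  have hcont : Continuous fun s => γ s 1 := (EuclideanSpace.proj (1 : Fin 2)).continuous.comp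
    hγ.continuous
  obtain ⟨a, -, ha⟩ := isCompact_Icc.exists_isMinOn (s := Icc 0 L) ⟨0, by simp [hL.le]⟩
    hcont.continuousOn
  have hmin : ∀ s, γ a 1 ≤ γ s 1 := by
    intro s
    obtain ⟨t, ht, h⟩ := hγ.closed.exists_mem_Ico₀ hL s
    rw [h]
    exact ha (Ico_subset_Icc_self ht)
  have h1 : deriv γ a 1 = 0 := by
    have hd : HasDerivAt (fun s => γ s 1) (deriv γ a 1) a :=
      (EuclideanSpace.proj (𝕜 := ℝ) (1 : Fin 2)).hasFDerivAt.comp_hasDerivAt a (hγ.hasDerivAt a)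
    exact IsLocalMin.hasDerivAt_eq_zero (Filter.Eventually.of_forall hmin) hd
  have h2 : deriv γ a 0 = 1 ∨ deriv γ a 0 = -1 := by
    have := plane_norm_sq (deriv γ a)
    rw [hγ.unit_speed, h1] at this
    exact sq_eq_one_iff.1 (by linarith)
  rcases h2 with h2 | h2
  · refine ⟨fun s => γ (s + a), hγ.shift hL a, ⟨?_, ?_, ?_⟩, hγ.trace_shift hL a,
      hγ.elastica_shift a⟩
    · intro s; simpa using hmin (s + a)
    · rw [deriv_comp_add_const, zero_add, h2]
    · rw [deriv_comp_add_const, zero_add, h1]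
  · have hβ := hγ.reverse hL
    refine ⟨fun s => γ (-(s + -a)), hβ.shift hL (-a), ⟨?_, ?_, ?_⟩, ?_, ?_⟩
    · intro s; simpa using hmin (-(s + -a))
    · rw [deriv_comp_add_const (fun s => γ (-s)), deriv_comp_neg]; simp [h2]
    · rw [deriv_comp_add_const (fun s => γ (-s)), deriv_comp_neg]; simp [h1]
    · rw [hβ.trace_shift hL (-a), hγ.trace_reverse hL]
    · rw [hβ.elastica_shift (-a), hγ.elastica_reverse]

/-! ### Hopf's Umlaufsatz -/

/-- A continuous logarithm exists because a normed space is contractible. It provides angle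
functions both for the Umlaufsatz and for the separation of the plane. -/
theorem exists_continuous_exp_eq {E : Type*} [NormedAddCommGroup E] [NormedSpace ℝ E]
    {g : E → ℂ} (hg : Continuous g) (h0 : ∀ x, g x ≠ 0) :
    ∃ f : E → ℂ, Continuous f ∧ ∀ x, Complex.exp (f x) = g x := by
  have : ContractibleSpace (univ : Set E) := convex_univ.contractibleSpace univ_nonempty
  obtain ⟨f, hf, hfg⟩ := Complex.exists_continuousOn_eqOn_exp_comp (U := (univ : Set E))
    (SimplyConnectedSpace.ofContractible (univ : Set E)) isOpen_univ hg.continuousOn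
    (by simpa using h0)
  exact ⟨f, continuousOn_univ.1 hf, fun x => hfg (mem_univ x)⟩

/-- A continuous angle starting at `0` that ends outside `[0, π]` would pass through values with
negative sine. -/
theorem angle_mem_of_sin_nonneg {f : ℝ → ℝ} {L : ℝ} (hL : 0 ≤ L) (hf : Continuous f)
    (h0 : f 0 = 0) (hs : ∀ t ∈ Icc 0 L, 0 ≤ Real.sin (f t)) : f L ∈ Icc 0 Real.pi := by
  have hpi := Real.pi_pos
  constructor
  · by_contra hc
    rw [not_le] at hc
    -- The truncation keeps the intermediate value in `(-π, 0)` however far below `f L` lies.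
    set v := max (f L) (-(Real.pi / 2)) with hv
    have hv1 : v ∈ Icc (f L) (f 0) := by
      rw [h0]
      exact ⟨le_max_left _ _, max_le hc.le (by linarith)⟩
    obtain ⟨t, ht, htv⟩ := intermediate_value_Icc' hL hf.continuousOn hv1
    have := hs t ht
    rw [htv] at this
    have h2 : v < 0 := max_lt hc (by linarith)
    have h3 : -Real.pi < v := lt_of_lt_of_le (by linarith) (le_max_right _ _)
    exact absurd this (not_le.2 (Real.sin_neg_of_neg_of_neg_pi_lt h2 h3))
  · by_contra hc
    rw [not_le] at hc
    set v := min (f L) (3 * Real.pi / 2) with hv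
    have h2 : Real.pi < v := lt_min hc (by linarith)
    have hv1 : v ∈ Icc (f 0) (f L) := by
      rw [h0]
      exact ⟨by linarith, min_le_left _ _⟩
    obtain ⟨t, ht, htv⟩ := intermediate_value_Icc hL hf.continuousOn hv1
    have := hs t ht
    rw [htv] at this
    have h3 : v ≤ 3 * Real.pi / 2 := min_le_right _ _
    have h4 : 0 < Real.sin (v - Real.pi) := Real.sin_pos_of_pos_of_lt_pi (by linarith) (by linarith)
    rw [Real.sin_sub_pi] at h4
    linarith

theorem eq_pi_of_sin_nonneg {f : ℝ → ℝ} {L : ℝ} (hL : 0 ≤ L) (hf : Continuous f)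
    (h0 : f 0 = 0) (hs : ∀ t ∈ Icc 0 L, 0 ≤ Real.sin (f t)) (hcos : Real.cos (f L) = -1) :
    f L = Real.pi :=
  Real.injOn_cos (angle_mem_of_sin_nonneg hL hf h0 hs) ⟨Real.pi_pos.le, le_rfl⟩
    (by rw [hcos, Real.cos_pi])

theorem eq_zero_of_cos_eq_one {f : ℝ → ℝ} {L : ℝ} (hL : 0 ≤ L) (hf : Continuous f)
    (h0 : f 0 = 0) (hs : ∀ t ∈ Icc 0 L, Real.cos (f t) = 1) : f L = 0 := by
  have h1 : ∀ t ∈ Icc 0 L, 0 ≤ Real.sin (f t) := fun t ht => by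
    have := Real.sin_sq_add_cos_sq (f t)
    rw [hs t ht] at this
    have : Real.sin (f t) = 0 := by nlinarith
    rw [this]
  exact Real.injOn_cos (angle_mem_of_sin_nonneg hL hf h0 h1) ⟨le_rfl, Real.pi_pos.le⟩
    (by rw [hs L ⟨hL, le_rfl⟩, Real.cos_zero])

/-- The difference quotient `(γ (s + h) - γ s) / h`, continuously extended to `h = 0`. -/
noncomputable def chordQuotient (γ : ℝ → Plane) (s h : ℝ) : Plane :=
  ∫ x in (0 : ℝ)..1, deriv γ (s + x * h)

/-- A continuous positive multiple of the chord `γ (s + h) - γ s`, for `0 < h < L`, which extends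
to a multiple of `± γ' s` at `h = 0` and `h = L`. -/
noncomputable def chordDirection (L : ℝ) (γ : ℝ → Plane) (s h : ℝ) : Plane :=
  chordQuotient γ s h - chordQuotient γ (s + h) (L - h)

namespace IsAdmissible

variable {L : ℝ} {γ : ℝ → Plane}

theorem continuous_chordQuotient (hγ : IsAdmissible L γ) :
    Continuous fun p : ℝ × ℝ => chordQuotient γ p.1 p.2 := by
  unfold chordQuotient
  apply intervalIntegral.continuous_parametric_intervalIntegral_of_continuous'
  have := hγ.continuous_deriv
  simp only [Function.uncurry_def]
  fun_prop

theorem smul_chordQuotient (hγ : IsAdmissible L γ) (s h : ℝ) :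
    h • chordQuotient γ s h = γ (s + h) - γ s := by
  unfold chordQuotient
  have h1 : ∀ x ∈ uIcc (0 : ℝ) 1, HasDerivAt (fun x => γ (s + x * h)) (h • deriv γ (s + x * h)) x := by
    intro x _
    have h2 : HasDerivAt (fun x : ℝ => s + x * h) h x := by
      simpa using ((hasDerivAt_id x).mul_const h).const_add s
    exact (hγ.hasDerivAt _).scomp x h2
  have hc := hγ.continuous_deriv
  rw [← intervalIntegral.integral_smul, intervalIntegral.integral_eq_sub_of_hasDerivAt h1
    (Continuous.intervalIntegrable (by fun_prop) _ _)]
  simp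

theorem chordQuotient_zero (s : ℝ) : chordQuotient γ s 0 = deriv γ s := by
  simp [chordQuotient]

theorem chordQuotient_period (hγ : IsAdmissible L γ) (hL : 0 < L) (s : ℝ) :
    chordQuotient γ s L = 0 := by
  have := hγ.smul_chordQuotient s L
  rw [hγ.closed, sub_self] at this
  exact (smul_eq_zero.1 this).resolve_left hL.ne'

theorem chordDirection_zero (hγ : IsAdmissible L γ) (hL : 0 < L) (s : ℝ) :
    chordDirection L γ s 0 = deriv γ s := by
  simp [chordDirection, chordQuotient_zero, hγ.chordQuotient_period hL]

theorem chordDirection_period (hγ : IsAdmissible L γ) (hL : 0 < L) (s : ℝ) :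
    chordDirection L γ s L = -deriv γ s := by
  simp [chordDirection, chordQuotient_zero, hγ.chordQuotient_period hL, hγ.periodic_deriv s]

theorem chordDirection_eq (hγ : IsAdmissible L γ) {s h : ℝ} (h0 : 0 < h) (h1 : h < L) :
    chordDirection L γ s h = (1 / h + 1 / (L - h)) • (γ (s + h) - γ s) := by
  have hL : 0 < L - h := by linarith
  have e1 := hγ.smul_chordQuotient s h
  have e2 := hγ.smul_chordQuotient (s + h) (L - h)
  rw [show s + h + (L - h) = s + L by ring, hγ.closed] at e2
  have e3 : chordQuotient γ s h = (1 / h) • (γ (s + h) - γ s) := by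
    rw [← e1, smul_smul, one_div_mul_cancel h0.ne', one_smul]
  have e4 : chordQuotient γ (s + h) (L - h) = (1 / (L - h)) • (γ s - γ (s + h)) := by
    rw [← e2, smul_smul, one_div_mul_cancel hL.ne', one_smul]
  rw [chordDirection, e3, e4]
  module

/-- For `0 < h < L` the chord is nonzero by simplicity; at the end points the direction is plus or
minus the unit tangent. -/
theorem chordDirection_ne_zero (hγ : IsAdmissible L γ) (hL : 0 < L) {s h : ℝ} (hh : h ∈ Icc 0 L) :
    chordDirection L γ s h ≠ 0 := by
  have hd : deriv γ s ≠ 0 := by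
    intro h; have := hγ.unit_speed s; rw [h, norm_zero] at this; norm_num at this
  rcases hh.1.eq_or_lt with h0 | h0
  · rw [← h0, hγ.chordDirection_zero hL]; exact hd
  rcases hh.2.eq_or_lt with h1 | h1
  · rw [h1, hγ.chordDirection_period hL]; exact neg_ne_zero.2 hd
  rw [hγ.chordDirection_eq h0 h1]
  have : 0 < L - h := by linarith
  exact smul_ne_zero (by positivity) (sub_ne_zero.2 (hγ.ne_of_lt hL h0 h1))

/-- The tangent is the exponential of the integrated curvature. -/
theorem toComplex_deriv_eq (hγ : IsAdmissible L γ) (s : ℝ) :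
    toComplex (deriv γ s) =
      toComplex (deriv γ 0) * Complex.exp (((∫ t in (0 : ℝ)..s, curvature γ t : ℝ) : ℂ) * Complex.I) := by
  set ψ : ℝ → ℝ := fun s => ∫ t in (0 : ℝ)..s, curvature γ t with hψ
  have hd : ∀ s, HasDerivAt ψ (curvature γ s) s := fun s =>
    intervalIntegral.integral_hasDerivAt_right (hγ.continuous_curvature.intervalIntegrable _ _)
      (hγ.continuous_curvature.stronglyMeasurableAtFilter _ _) hγ.continuous_curvature.continuousAt
  -- In complex notation `(γ')' = iκ γ'`, so multiplying by the integrating factor gives a constant.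
  have h1 : ∀ s, HasDerivAt (fun s => toComplex (deriv γ s) * Complex.exp (-((ψ s : ℂ) * Complex.I)))
      0 s := by
    intro s
    have e1 := toComplex.hasFDerivAt.comp_hasDerivAt s (hγ.hasDerivAt_deriv s)
    have e2 := ((hd s).ofReal_comp.mul_const Complex.I).neg.cexp
    refine (e1.mul e2).congr_deriv ?_
    simp only [Function.comp_apply]
    rw [hγ.deriv_deriv_eq, map_smul, normal, toComplex_rot, Complex.real_smul]
    ring
  have h2 := is_const_of_deriv_eq_zero (fun s => (h1 s).differentiableAt) (fun s => (h1 s).deriv)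
    s 0
  simp only [hψ, intervalIntegral.integral_same, Complex.ofReal_zero, zero_mul, neg_zero,
    Complex.exp_zero, mul_one] at h2
  rw [← h2, mul_assoc, ← Complex.exp_add, neg_add_cancel, Complex.exp_zero, mul_one]

/-- Hopf's Umlaufsatz for a curve that starts at its lowest point in direction `e₁`. -/
theorem integral_curvature (hγ : IsAdmissible L γ) (hL : 0 < L) (hb : StartsAtBottom γ) :
    ∫ s in (0 : ℝ)..L, curvature γ s = 2 * Real.pi := by
  -- Chord directions are nonzero only on the strip `0 ≤ h ≤ L`; clamping `h` extends them to the
  -- plane, where a single angle function `θ` can be lifted.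
  set clamp : ℝ → ℝ := fun h => max 0 (min h L) with hclamp
  have hcl : ∀ h, clamp h ∈ Icc 0 L := fun h => ⟨le_max_left _ _, max_le hL.le (min_le_right _ _)⟩
  have hcl' : ∀ h ∈ Icc 0 L, clamp h = h := fun h hh => by
    simp only [hclamp]; rw [min_eq_left hh.2, max_eq_right hh.1]
  have hclc : Continuous clamp := by fun_prop
  set G : ℝ × ℝ → ℂ := fun p => toComplex (chordDirection L γ p.1 (clamp p.2)) with hG
  have hGc : Continuous G := by
    apply toComplex.continuous.comp
    unfold chordDirection
    have h1 := hγ.continuous_chordQuotient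
    exact (h1.comp (f := fun p : ℝ × ℝ => (p.1, clamp p.2)) (by fun_prop)).sub
      (h1.comp (f := fun p : ℝ × ℝ => (p.1 + clamp p.2, L - clamp p.2)) (by fun_prop))
  obtain ⟨Θ, hΘc, hΘ⟩ := exists_continuous_exp_eq hGc fun p =>
    mt toComplex_eq_zero.1 (hγ.chordDirection_ne_zero hL (hcl _))
  set θ : ℝ × ℝ → ℝ := fun p => (Θ p).im with hθ
  have hθc : Continuous θ := Complex.continuous_im.comp hΘc
  have hre : ∀ p, (G p).re = Real.exp (Θ p).re * Real.cos (θ p) := fun p => by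
    rw [← hΘ, Complex.exp_re]
  have him : ∀ p, (G p).im = Real.exp (Θ p).re * Real.sin (θ p) := fun p => by
    rw [← hΘ, Complex.exp_im]
  have hnorm : ∀ p, ‖G p‖ = Real.exp (Θ p).re := fun p => by rw [← hΘ, Complex.norm_exp]
  have hG0 : ∀ s, G (s, 0) = toComplex (deriv γ s) := fun s => by
    simp only [hG]; rw [hcl' 0 ⟨le_rfl, hL.le⟩, hγ.chordDirection_zero hL]
  have hGL : ∀ s, G (s, L) = -toComplex (deriv γ s) := fun s => by
    simp only [hG]; rw [hcl' L ⟨hL.le, le_rfl⟩, hγ.chordDirection_period hL, map_neg]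
  have hτ : toComplex (deriv γ 0) = 1 := by
    apply Complex.ext
    · simpa using hb.tangent_zero
    · simpa using hb.tangent_one
  have hτL : deriv γ L = deriv γ 0 := by simpa using hγ.periodic_deriv 0
  have hrot : ∀ p, G p = 1 → Real.cos (θ p) = 1 ∧ Real.sin (θ p) = 0 := fun p hp => by
    have h1 := hnorm p
    have h2 := hre p
    have h3 := him p
    rw [← h1, hp] at h2 h3
    simp at h2 h3
    exact ⟨h2.symm, h3.symm⟩
  have hrot' : ∀ p, G p = -1 → Real.cos (θ p) = -1 ∧ Real.sin (θ p) = 0 := fun p hp => by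
    have h1 := hnorm p
    have h2 := hre p
    have h3 := him p
    rw [← h1, hp] at h2 h3
    simp at h2 h3
    exact ⟨h2.symm, h3.symm⟩
  have hG00 : G (0, 0) = 1 := by rw [hG0, hτ]
  have hG0L : G (0, L) = -1 := by rw [hGL, hτ]
  have hGL0 : G (L, 0) = 1 := by rw [hG0, hτL, hτ]
  set a := θ (0, 0) with ha
  obtain ⟨ca, sa⟩ := hrot _ hG00
  -- first side of the triangle: chords from the lowest point
  have hside1 : ∀ h ∈ Icc 0 L, 0 ≤ Real.sin (θ (0, h)) := by
    intro h hh
    have hpos := Real.exp_pos (Θ (0, h)).re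
    suffices 0 ≤ (G (0, h)).im by
      rw [him] at this; exact nonneg_of_mul_nonneg_right this hpos
    rcases hh.1.eq_or_lt with h0 | h0
    · rw [← h0, hG00]; simp
    rcases hh.2.eq_or_lt with h1 | h1
    · rw [h1, hG0L]; simp
    simp only [hG]
    rw [hcl' h hh, hγ.chordDirection_eq h0 h1, toComplex_im]
    have h2 : 0 < L - h := by linarith
    have := hb.le (0 + h)
    simp only [PiLp.smul_apply, PiLp.sub_apply, smul_eq_mul]
    apply mul_nonneg (by positivity)
    linarith
  -- Second side of the triangle: chords `(t, L - t)` end at the lowest point and never point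
  -- upwards.
  have hside2 : ∀ t ∈ Icc 0 L, Real.sin (θ (t, L - t)) ≤ 0 := by
    intro h hh
    have hpos := Real.exp_pos (Θ (h, L - h)).re
    suffices (G (h, L - h)).im ≤ 0 by
      rw [him] at this; exact nonpos_of_mul_nonpos_right this hpos
    rcases hh.1.eq_or_lt with h0 | h0
    · rw [← h0, sub_zero, hG0L]; simp
    rcases hh.2.eq_or_lt with h1 | h1
    · rw [h1, sub_self, hGL0]; simp
    simp only [hG]
    have h2 : 0 < L - h := by linarith
    rw [hcl' (L - h) ⟨h2.le, by linarith⟩, hγ.chordDirection_eq h2 (by linarith), toComplex_im]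
    have := hb.le h
    have e : γ (h + (L - h)) = γ 0 := by
      rw [show h + (L - h) = 0 + L by ring, hγ.closed]
    rw [e]
    simp only [PiLp.smul_apply, PiLp.sub_apply, smul_eq_mul]
    apply mul_nonpos_of_nonneg_of_nonpos
    · have : L - (L - h) = h := by ring
      rw [this]; positivity
    · linarith
  -- On each of these two sides the direction turns from a horizontal vector to its opposite while
  -- staying in a half plane, so the angle grows by exactly `π`.
  have hθ1 : θ (0, L) - a = Real.pi := by
    apply eq_pi_of_sin_nonneg (f := fun h => θ (0, h) - a) hL.le (by fun_prop) (by simp [ha])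
    · intro t ht
      rw [Real.sin_sub, ca, sa]
      simpa using hside1 t ht
    · rw [Real.cos_sub, ca, sa, (hrot' _ hG0L).1]; simp
  have hθ2 : θ (L, 0) - θ (0, L) = Real.pi := by
    have := eq_pi_of_sin_nonneg (f := fun t => θ (t, L - t) - θ (0, L)) hL.le (by fun_prop)
      (by simp) (fun t ht => by
        rw [Real.sin_sub, (hrot' _ hG0L).1, (hrot' _ hG0L).2]
        simpa using hside2 t ht)
      (by rw [sub_self, Real.cos_sub, (hrot' _ hG0L).1, (hrot _ hGL0).1, (hrot _ hGL0).2]; simp)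
    simpa using this
  have hψc : Continuous fun s => ∫ t in (0 : ℝ)..s, curvature γ t :=
    intervalIntegral.continuous_primitive
      (fun _ _ => hγ.continuous_curvature.intervalIntegrable _ _) 0
  -- Along the third side `h = 0` the direction is the tangent, whose lifted angle is the integrated
  -- curvature up to multiples of `2π`; continuity excludes a jump. The two ways from `(0, 0)` to
  -- `(L, 0)` are then compared.
  have hfin := eq_zero_of_cos_eq_one
    (f := fun s => θ (s, 0) - a - ∫ t in (0 : ℝ)..s, curvature γ t) hL.le (by fun_prop)
    (by simp [ha]) (fun s _ => by
      have h1 := hγ.toComplex_deriv_eq s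
      rw [hτ, one_mul, ← hG0] at h1
      set ψ := ∫ t in (0 : ℝ)..s, curvature γ t
      have h2 : Real.exp (Θ (s, 0)).re = 1 := by
        rw [← hnorm, h1, Complex.norm_exp_ofReal_mul_I]
      have h3 : Real.cos (θ (s, 0)) = Real.cos ψ := by
        have := hre (s, 0)
        rw [h2, h1, Complex.exp_ofReal_mul_I_re] at this
        linarith
      have h4 : Real.sin (θ (s, 0)) = Real.sin ψ := by
        have := him (s, 0)
        rw [h2, h1, Complex.exp_ofReal_mul_I_im] at this
        linarith
      rw [sub_sub, add_comm, ← sub_sub, Real.cos_sub, Real.cos_sub, Real.sin_sub, ca, sa, h3, h4]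
      have := Real.sin_sq_add_cos_sq ψ
      linear_combination this)
  linarith

end IsAdmissible

/-! ### Tubular neighbourhoods -/

/-- Normal coordinates around a curve. -/
noncomputable def tube (γ : ℝ → Plane) (s r : ℝ) : Plane := γ s + r • normal γ s

/-- `ρ` is a radius for which normal coordinates are injective and nondegenerate. -/
structure IsTubeRadius (γ : ℝ → Plane) (ρ : ℝ) : Prop where
  pos : 0 < ρ
  curvature_le : ∀ s, |curvature γ s| * ρ ≤ 1 / 2
  inj : ∀ s t r r', |r| < ρ → |r'| < ρ → tube γ s r = tube γ t r' → γ s = γ t ∧ r = r'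

theorem IsTubeRadius.one_sub_ge {γ : ℝ → Plane} {ρ : ℝ} (hρ : IsTubeRadius γ ρ) {r : ℝ}
    (hr : |r| ≤ ρ) (s : ℝ) : 1 / 2 ≤ 1 - r * curvature γ s := by
  have h1 := hρ.curvature_le s
  have h2 : |r * curvature γ s| ≤ 1 / 2 := by
    rw [abs_mul, mul_comm]
    refine le_trans ?_ h1
    gcongr
  linarith [(abs_le.1 h2).2]

theorem tube_zero (γ : ℝ → Plane) (s : ℝ) : tube γ s 0 = γ s := by simp [tube]

namespace IsAdmissible

variable {L : ℝ} {γ : ℝ → Plane}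

theorem dist_tube (hγ : IsAdmissible L γ) (s r : ℝ) : dist (tube γ s r) (γ s) = |r| := by
  simp [tube, norm_smul, hγ.norm_normal]

theorem continuous_tube (hγ : IsAdmissible L γ) : Continuous fun p : ℝ × ℝ => tube γ p.1 p.2 := by
  unfold tube
  have h1 := hγ.continuous
  have h2 := hγ.continuous_normal
  fun_prop

theorem norm_normal_sub_le (hγ : IsAdmissible L γ) {K : ℝ} (hK : ∀ s, |curvature γ s| ≤ K)
    (s t : ℝ) : ‖normal γ s - normal γ t‖ ≤ K * |s - t| := by
  have := convex_univ.norm_image_sub_le_of_norm_hasDerivWithin_le (f := normal γ) (C := K)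
    (fun x _ => (hγ.hasDerivAt_normal x).hasDerivWithinAt) (fun x _ => by
      rw [norm_smul, norm_neg, hγ.unit_speed, mul_one]; exact hK x) (mem_univ t) (mem_univ s)
  simpa using this

theorem norm_deriv_sub_le (hγ : IsAdmissible L γ) {K : ℝ} (hK : ∀ s, |curvature γ s| ≤ K)
    (s t : ℝ) : ‖deriv γ s - deriv γ t‖ ≤ K * |s - t| := by
  have := hγ.norm_normal_sub_le hK s t
  rwa [normal, normal, ← map_sub, norm_rot] at this

theorem norm_sub_sub_smul_le (hγ : IsAdmissible L γ) {K : ℝ} (hK : ∀ s, |curvature γ s| ≤ K)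
    (s t : ℝ) : ‖γ s - γ t - (s - t) • deriv γ t‖ ≤ K * |s - t| * |s - t| := by
  have hK0 : 0 ≤ K := (abs_nonneg _).trans (hK 0)
  have h := (convex_uIcc t s).norm_image_sub_le_of_norm_hasDerivWithin_le
    (f := fun x => γ x - x • deriv γ t) (f' := fun x => deriv γ x - (1 : ℝ) • deriv γ t)
    (C := K * |s - t|)
    (fun x _ => ((hγ.hasDerivAt x).sub ((hasDerivAt_id x).smul_const _)).hasDerivWithinAt)
    (fun x hx => by
      rw [one_smul]
      refine (hγ.norm_deriv_sub_le hK x t).trans ?_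
      exact mul_le_mul_of_nonneg_left (abs_sub_left_of_mem_uIcc hx) hK0)
    left_mem_uIcc right_mem_uIcc
  rw [Real.norm_eq_abs] at h
  refine le_trans (le_of_eq ?_) h
  congr 1
  module

/-- Compactness and simplicity; periodicity in `s` reduces to one period. -/
theorem exists_chord_lower_bound (hγ : IsAdmissible L γ) (hL : 0 < L) {a : ℝ} (ha : 0 < a) :
    ∃ m, 0 < m ∧ ∀ s h, a ≤ h → h ≤ L - a → m ≤ ‖γ (s + h) - γ s‖ := by
  have hc := hγ.continuous
  obtain ⟨m, hm, H⟩ := (isCompact_Icc.prod isCompact_Icc :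
    IsCompact ((Icc 0 L) ×ˢ (Icc a (L - a)))).exists_forall_le'
    (f := fun p : ℝ × ℝ => ‖γ (p.1 + p.2) - γ p.1‖) (a := 0) (by fun_prop)
    (fun p hp => norm_pos_iff.2 (sub_ne_zero.2 (hγ.ne_of_lt hL (ha.trans_le hp.2.1)
      (by linarith [hp.2.2]))))
  refine ⟨m, hm, fun s h h1 h2 => ?_⟩
  have hp : Function.Periodic (fun s => ‖γ (s + h) - γ s‖) L := fun s => by
    simp only
    rw [add_right_comm, hγ.closed, hγ.closed]
  obtain ⟨t, ht, e⟩ := hp.exists_mem_Ico₀ hL s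
  rw [e]
  exact H (t, h) ⟨Ico_subset_Icc_self ht, h1, h2⟩

/-- Project the equality onto the tangent at `t`: the main term is `s - t`, while the Taylor error
of the curve and the variation of the normal contribute at most `|s - t|/4` each. -/
theorem eq_of_tube_eq_of_near (hγ : IsAdmissible L γ) {K : ℝ} (hK : ∀ s, |curvature γ s| ≤ K)
    {s t r r' : ℝ} (hst : K * |s - t| ≤ 1 / 4) (hr : |r| * K ≤ 1 / 4)
    (h : tube γ s r = tube γ t r') : s = t := by
  have hT := hγ.norm_sub_sub_smul_le hK s t
  have hN := hγ.norm_normal_sub_le hK s t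
  have e1 : γ s - γ t = r' • normal γ t - r • normal γ s := by
    unfold tube at h
    rw [sub_eq_sub_iff_add_eq_add, h, add_comm]
  have e2 : (inner ℝ (normal γ t) (deriv γ t) : ℝ) = 0 := inner_rot_self _
  have e3 : (inner ℝ (deriv γ t) (deriv γ t) : ℝ) = 1 := by
    rw [real_inner_self_eq_norm_sq, hγ.unit_speed]; norm_num
  have e4 : (inner ℝ (γ s - γ t - (s - t) • deriv γ t) (deriv γ t) : ℝ)
      = -r * inner ℝ (normal γ s - normal γ t) (deriv γ t) - (s - t) := by
    rw [e1]
    simp only [inner_sub_left, real_inner_smul_left, e2, e3]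
    ring
  have b1 : |(inner ℝ (γ s - γ t - (s - t) • deriv γ t) (deriv γ t) : ℝ)| ≤ K * |s - t| * |s - t| := by
    refine (abs_real_inner_le_norm _ _).trans ?_
    rwa [hγ.unit_speed, mul_one]
  have b2 : |(inner ℝ (normal γ s - normal γ t) (deriv γ t) : ℝ)| ≤ K * |s - t| := by
    refine (abs_real_inner_le_norm _ _).trans ?_
    rwa [hγ.unit_speed, mul_one]
  rw [e4] at b1
  set z : ℝ := inner ℝ (normal γ s - normal γ t) (deriv γ t)
  have b3 : |r * z| ≤ 1 / 4 * |s - t| := by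
    rw [abs_mul]
    calc |r| * |z| ≤ |r| * (K * |s - t|) := by gcongr
      _ = |r| * K * |s - t| := by ring
      _ ≤ _ := by gcongr
  have b4 : K * |s - t| * |s - t| ≤ 1 / 4 * |s - t| := by gcongr
  have b5 : |s - t| ≤ |(-r * z - (s - t))| + |r * z| := by
    have := abs_add_le (-(-r * z - (s - t))) (-(r * z))
    rw [abs_neg, abs_neg] at this
    refine le_trans (le_of_eq ?_) this
    congr 1; ring
  have b6 : |s - t| ≤ 0 := by linarith
  exact sub_eq_zero.1 (abs_nonpos_iff.1 b6)

/-- Two scales: parameters within `1/(4K)` modulo `L` are handled by the curvature bound, all others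
by the chord bound `m`, because two normals shorter than `m/2` cannot bridge a chord of length `m`.
-/
theorem exists_isTubeRadius (hγ : IsAdmissible L γ) (hL : 0 < L) : ∃ ρ, IsTubeRadius γ ρ := by
  obtain ⟨K, hK0, hK⟩ := hγ.exists_curvature_bound hL
  have ha : 0 < 1 / (4 * K) := by positivity
  obtain ⟨m, hm, H⟩ := hγ.exists_chord_lower_bound hL ha
  have hKa : ∀ x, x ≤ 1 / (4 * K) → x * K ≤ 1 / 4 := fun x hx => by
    calc x * K ≤ 1 / (4 * K) * K := by gcongr
      _ = 1 / 4 := by field_simp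
  refine ⟨min (1 / (4 * K)) (m / 2), by positivity, fun s => ?_, fun s t r r' hr hr' h => ?_⟩
  · rw [mul_comm]
    calc min (1 / (4 * K)) (m / 2) * |curvature γ s| ≤ 1 / (4 * K) * K := by
          gcongr
          · exact min_le_left _ _
          · exact hK s
      _ ≤ 1 / 2 := by have := hKa _ le_rfl; linarith
  · have hrK : |r| * K ≤ 1 / 4 := hKa _ (hr.le.trans (min_le_left _ _))
    -- Move `t` by periods into `[s, s + L)`; nearness is then possible at either end of this
    -- interval.
    obtain ⟨n, hn1, -⟩ := existsUnique_add_zsmul_mem_Ico hL t s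
    set u := t + n • L with hu
    have hγu : γ u = γ t := by rw [hu]; exact hγ.closed.zsmul n t
    have hνu : normal γ u = normal γ t := by rw [hu]; exact hγ.periodic_normal.zsmul n t
    have htube : tube γ s r = tube γ u r' := by rw [h, tube, tube, hγu, hνu]
    have key : ∀ v, γ v = γ t → normal γ v = normal γ t → |s - v| ≤ 1 / (4 * K) →
        γ s = γ t ∧ r = r' := by
      intro v h1 h2 h3
      have h4 : tube γ s r = tube γ v r' := by rw [h, tube, tube, h1, h2]
      have h5 := hγ.eq_of_tube_eq_of_near hK (by rw [mul_comm]; exact hKa _ h3) hrK h4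
      subst h5
      refine ⟨h1, ?_⟩
      have h6 : (r - r') • normal γ s = 0 := by
        unfold tube at h4
        rw [sub_smul, sub_eq_zero]; exact add_left_cancel h4
      have h7 : normal γ s ≠ 0 := by
        intro h8; have := hγ.norm_normal s; rw [h8, norm_zero] at this; norm_num at this
      exact sub_eq_zero.1 ((smul_eq_zero.1 h6).resolve_right h7)
    by_cases c1 : u - s ≤ 1 / (4 * K)
    · exact key u hγu hνu (by rw [abs_sub_comm, abs_of_nonneg (by linarith [hn1.1])]; exact c1)
    by_cases c2 : L - 1 / (4 * K) ≤ u - s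
    · refine key (u - L) ?_ ?_ ?_
      · rw [hγ.closed.sub_eq, hγu]
      · rw [hγ.periodic_normal.sub_eq, hνu]
      · rw [abs_of_nonneg (by linarith [hn1.2])]; linarith
    · exfalso
      have h1 := H s (u - s) (not_le.1 c1).le (not_le.1 c2).le
      rw [add_sub_cancel] at h1
      have h2 : γ u - γ s = r • normal γ s - r' • normal γ u := by
        unfold tube at htube
        rw [sub_eq_sub_iff_add_eq_add, ← htube, add_comm]
      have h3 : ‖γ u - γ s‖ < m := by
        rw [h2]
        refine (norm_sub_le _ _).trans_lt ?_
        rw [norm_smul, norm_smul, hγ.norm_normal, hγ.norm_normal, Real.norm_eq_abs,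
          Real.norm_eq_abs]
        have := hr.trans_le (min_le_right _ _)
        have := hr'.trans_le (min_le_right _ _)
        linarith
      linarith

theorem isCompact_trace (hγ : IsAdmissible L γ) : IsCompact (trace L γ) :=
  isCompact_Icc.image hγ.continuous

theorem trace_nonempty (hL : 0 < L) : (trace L γ).Nonempty :=
  ⟨γ 0, 0, ⟨le_rfl, hL.le⟩, rfl⟩

theorem mem_trace (hγ : IsAdmissible L γ) (hL : 0 < L) (s : ℝ) : γ s ∈ trace L γ := by
  rw [hγ.trace_eq_range hL]; exact mem_range_self s

/-- Every point of the plane lies on a normal to the curve through a nearest point. -/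
theorem exists_tube_eq (hγ : IsAdmissible L γ) (hL : 0 < L) (x : Plane) :
    ∃ s r, tube γ s r = x ∧ |r| = Metric.infDist x (trace L γ) := by
  obtain ⟨y, ⟨s, -, rfl⟩, hs⟩ := hγ.isCompact_trace.exists_infDist_eq_dist (trace_nonempty hL) x
  have hmin : ∀ t, ‖x - γ s‖ ^ 2 ≤ ‖x - γ t‖ ^ 2 := fun t => by
    have := Metric.infDist_le_dist_of_mem (hγ.mem_trace hL t) (x := x)
    rw [hs, dist_eq_norm, dist_eq_norm] at this
    gcongr
  have hd : HasDerivAt (fun t => ‖x - γ t‖ ^ 2) (2 * inner ℝ (x - γ s) (-deriv γ s)) s :=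
    ((hγ.hasDerivAt s).const_sub x).norm_sq
  have h0 := IsLocalMin.hasDerivAt_eq_zero (Filter.Eventually.of_forall hmin) hd
  have h1 : (inner ℝ (x - γ s) (deriv γ s) : ℝ) = 0 := by
    rw [inner_neg_right] at h0; linarith
  have h2 := frame_decomposition (hγ.unit_speed s) (x - γ s)
  rw [h1, zero_smul, zero_add] at h2
  refine ⟨s, inner ℝ (x - γ s) (rot (deriv γ s)), ?_, ?_⟩
  · rw [tube, normal, ← h2]; abel
  · rw [hs, dist_eq_norm]
    conv_rhs => rw [h2]
    rw [norm_smul, norm_rot, hγ.unit_speed, mul_one, Real.norm_eq_abs]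

/-- A nearest point yields a second representation whose normal coordinate has modulus at most
`|r|`, and injectivity identifies the two. -/
theorem infDist_tube (hγ : IsAdmissible L γ) (hL : 0 < L) {ρ : ℝ} (hρ : IsTubeRadius γ ρ)
    {r : ℝ} (hr : |r| < ρ) (s : ℝ) : Metric.infDist (tube γ s r) (trace L γ) = |r| := by
  obtain ⟨t, r', h1, h2⟩ := hγ.exists_tube_eq hL (tube γ s r)
  have h3 : Metric.infDist (tube γ s r) (trace L γ) ≤ |r| := by
    rw [← hγ.dist_tube s r]
    exact Metric.infDist_le_dist_of_mem (hγ.mem_trace hL s)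
  have h4 := (hρ.inj t s r' r (by rw [h2]; exact h3.trans_lt hr) hr h1).2
  rw [← h2, h4]

end IsAdmissible

/-! ### Jacobian and local inverses of normal coordinates -/

/-- The Jacobian of normal coordinates. -/
noncomputable def tubeDeriv (γ : ℝ → Plane) (s r : ℝ) : Plane →L[ℝ] Plane :=
  (EuclideanSpace.proj (𝕜 := ℝ) (0 : Fin 2)).smulRight ((1 - r * curvature γ s) • deriv γ s) +
    (EuclideanSpace.proj (𝕜 := ℝ) (1 : Fin 2)).smulRight (normal γ s)

theorem tubeDeriv_apply (γ : ℝ → Plane) (s r : ℝ) (v : Plane) :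
    tubeDeriv γ s r v = v 0 • ((1 - r * curvature γ s) • deriv γ s) + v 1 • normal γ s := by
  simp [tubeDeriv]

namespace IsAdmissible

variable {L : ℝ} {γ : ℝ → Plane}

theorem det_tubeDeriv (hγ : IsAdmissible L γ) (s r : ℝ) :
    (tubeDeriv γ s r).det = 1 - r * curvature γ s := by
  have h : deriv γ s 0 ^ 2 + deriv γ s 1 ^ 2 = 1 := by
    rw [← plane_norm_sq, hγ.unit_speed]; norm_num
  rw [ContinuousLinearMap.det, ← LinearMap.det_toMatrix (EuclideanSpace.basisFun (Fin 2) ℝ).toBasis,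
    Matrix.det_fin_two]
  simp [LinearMap.toMatrix_apply, tubeDeriv_apply, normal]
  linear_combination (1 - r * curvature γ s) * h

/-- The Jacobian of normal coordinates as an isomorphism. -/
noncomputable def tubeDerivEquiv (hγ : IsAdmissible L γ) (s r : ℝ)
    (h : 1 - r * curvature γ s ≠ 0) : Plane ≃L[ℝ] Plane :=
  ContinuousLinearEquiv.equivOfInverse (tubeDeriv γ s r)
    (((1 - r * curvature γ s)⁻¹ • innerSL ℝ (deriv γ s)).smulRight (EuclideanSpace.single 0 1)
      + (innerSL ℝ (normal γ s)).smulRight (EuclideanSpace.single 1 1))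
    (fun v => by
      have h : deriv γ s 0 ^ 2 + deriv γ s 1 ^ 2 = 1 := by
        rw [← plane_norm_sq, hγ.unit_speed]; norm_num
      apply plane_ext
      · simp [tubeDeriv_apply, plane_inner, normal]
        field_simp
        linear_combination (v 0 * (1 - r * curvature γ s)) * h
      · simp [tubeDeriv_apply, plane_inner, normal]
        linear_combination (v 1) * h)
    (fun v => by
      conv_rhs => rw [frame_decomposition (hγ.unit_speed s) v]
      simp only [tubeDeriv_apply]
      rw [smul_smul]
      simp [normal, real_inner_comm, h, mul_comm])

theorem hasFDerivAt_tube (hγ : IsAdmissible L γ) (p : Plane) :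
    HasFDerivAt (fun p : Plane => tube γ (p 0) (p 1)) (tubeDeriv γ (p 0) (p 1)) p := by
  have h0 : HasFDerivAt (fun p : Plane => p 0) (EuclideanSpace.proj (𝕜 := ℝ) (0 : Fin 2)) p :=
    (EuclideanSpace.proj (𝕜 := ℝ) (0 : Fin 2)).hasFDerivAt
  have h1 : HasFDerivAt (fun p : Plane => p 1) (EuclideanSpace.proj (𝕜 := ℝ) (1 : Fin 2)) p :=
    (EuclideanSpace.proj (𝕜 := ℝ) (1 : Fin 2)).hasFDerivAt
  have h2 := (hγ.hasDerivAt (p 0)).hasFDerivAt.comp p h0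
  have h3 := (hγ.hasDerivAt_normal (p 0)).hasFDerivAt.comp p h0
  refine (h2.add (h1.smul h3)).congr_fderiv ?_
  ext v
  simp [tubeDeriv_apply]
  ring

theorem contDiff_tube (hγ : IsAdmissible L γ) :
    ContDiff ℝ 1 (fun p : Plane => tube γ (p 0) (p 1)) := by
  have h0 : ContDiff ℝ 1 (fun p : Plane => p 0) := (EuclideanSpace.proj (𝕜 := ℝ) (0 : Fin 2)).contDiff
  have h1 : ContDiff ℝ 1 (fun p : Plane => p 1) := (EuclideanSpace.proj (𝕜 := ℝ) (1 : Fin 2)).contDiff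
  exact ((hγ.contDiff.of_le (by norm_num)).comp h0).add (h1.smul (hγ.contDiff_normal.comp h0))

/-- Normal coordinates have `C¹` local inverses. -/
theorem exists_local_coordinates (hγ : IsAdmissible L γ) {s₀ r₀ : ℝ}
    (h : 1 - r₀ * curvature γ s₀ ≠ 0) :
    ∃ S R : Plane → ℝ, ContDiffAt ℝ 1 S (tube γ s₀ r₀) ∧ ContDiffAt ℝ 1 R (tube γ s₀ r₀) ∧
      S (tube γ s₀ r₀) = s₀ ∧ R (tube γ s₀ r₀) = r₀ ∧
      ∀ᶠ x in 𝓝 (tube γ s₀ r₀), tube γ (S x) (R x) = x := by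
  set p : Plane := !₂[s₀, r₀] with hp
  have hp0 : p 0 = s₀ := by simp [hp]
  have hp1 : p 1 = r₀ := by simp [hp]
  have hf' : HasFDerivAt (fun p : Plane => tube γ (p 0) (p 1))
      (hγ.tubeDerivEquiv s₀ r₀ h : Plane →L[ℝ] Plane) p := by
    have := hγ.hasFDerivAt_tube p
    rw [hp0, hp1] at this
    exact this
  have hf : ContDiffAt ℝ 1 (fun p : Plane => tube γ (p 0) (p 1)) p := hγ.contDiff_tube.contDiffAt
  have hs := hf.hasStrictFDerivAt' hf' (by norm_num)
  set g := hf.localInverse hf' (by norm_num) with hg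
  have hgC : ContDiffAt ℝ 1 g (tube γ s₀ r₀) := by
    have := hf.to_localInverse hf' (by norm_num)
    simpa only [hp0, hp1] using this
  have hgp : g (tube γ s₀ r₀) = p := by
    have := hf.localInverse_apply_image hf' (by norm_num)
    simpa only [hp0, hp1] using this
  refine ⟨fun x => g x 0, fun x => g x 1,
    (EuclideanSpace.proj (𝕜 := ℝ) (0 : Fin 2)).contDiff.contDiffAt.comp _ hgC,
    (EuclideanSpace.proj (𝕜 := ℝ) (1 : Fin 2)).contDiff.contDiffAt.comp _ hgC,
    by simp only [hgp, hp0], by simp only [hgp, hp1], ?_⟩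
  have := hs.eventually_right_inverse
  simp only [hp0, hp1] at this
  exact this

/-- Differentiate `tube γ (S x) (R x) = x` and take components along the normal and the tangent. The
gradient of `R` involves only `S`, so `R` is better than the inverse function theorem tells. -/
theorem hasFDerivAt_of_tube_eq (hγ : IsAdmissible L γ) {S R : Plane → ℝ} {x : Plane}
    (hS : DifferentiableAt ℝ S x) (hR : DifferentiableAt ℝ R x)
    (h : ∀ᶠ y in 𝓝 x, tube γ (S y) (R y) = y) (h0 : 1 - R x * curvature γ (S x) ≠ 0) :
    HasFDerivAt R (innerSL ℝ (normal γ (S x))) x ∧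
    HasFDerivAt S ((1 - R x * curvature γ (S x))⁻¹ • innerSL ℝ (deriv γ (S x))) x := by
  have h1 := (hγ.hasDerivAt (S x)).hasFDerivAt.comp x hS.hasFDerivAt
  have h2 := (hγ.hasDerivAt_normal (S x)).hasFDerivAt.comp x hS.hasFDerivAt
  have h3 := h1.add (hR.hasFDerivAt.smul h2)
  have h4 : HasFDerivAt (fun y => tube γ (S y) (R y)) (ContinuousLinearMap.id ℝ Plane) x :=
    (hasFDerivAt_id x).congr_of_eventuallyEq h
  have h5 := h3.unique h4
  have hττ : (inner ℝ (deriv γ (S x)) (deriv γ (S x)) : ℝ) = 1 := by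
    rw [real_inner_self_eq_norm_sq, hγ.unit_speed]; norm_num
  have hνν : (inner ℝ (normal γ (S x)) (normal γ (S x)) : ℝ) = 1 := by
    rw [real_inner_self_eq_norm_sq, hγ.norm_normal]; norm_num
  have hτν : (inner ℝ (deriv γ (S x)) (normal γ (S x)) : ℝ) = 0 := inner_self_rot _
  have hντ : (inner ℝ (normal γ (S x)) (deriv γ (S x)) : ℝ) = 0 := inner_rot_self _
  have h6 : ∀ v, fderiv ℝ S x v • deriv γ (S x) + (R x • (fderiv ℝ S x v •
      (-curvature γ (S x) • deriv γ (S x))) + fderiv ℝ R x v • normal γ (S x)) = v := by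
    intro v
    have := congrArg (fun A : Plane →L[ℝ] Plane => A v) h5
    simpa using this
  constructor
  · refine hR.hasFDerivAt.congr_fderiv (ContinuousLinearMap.ext fun v => ?_)
    have h7 := congrArg (fun w => (inner ℝ (normal γ (S x)) w : ℝ)) (h6 v)
    simp only [inner_add_right, real_inner_smul_right, hντ, hνν] at h7
    rw [innerSL_apply_apply, ← h7]
    ring
  · refine hS.hasFDerivAt.congr_fderiv (ContinuousLinearMap.ext fun v => ?_)
    have h7 := congrArg (fun w => (inner ℝ (deriv γ (S x)) w : ℝ)) (h6 v)
    simp only [inner_add_right, real_inner_smul_right, hτν, hττ] at h7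
    simp only [smul_apply, innerSL_apply_apply, smul_eq_mul]
    rw [← h7]
    field_simp
    ring

end IsAdmissible

/-! ### Functions of the normal coordinate -/

theorem laplacian_plane (u : Plane → ℝ) (x : Plane) :
    (Δ u) x = ∑ i : Fin 2, fderiv ℝ (fderiv ℝ u) x (EuclideanSpace.single i 1)
      (EuclideanSpace.single i 1) := by
  rw [InnerProductSpace.laplacian_eq_iteratedFDeriv_orthonormalBasis u
    (EuclideanSpace.basisFun (Fin 2) ℝ)]
  simp [iteratedFDeriv_two_apply]

namespace IsAdmissible

variable {L : ℝ} {γ : ℝ → Plane}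

/-- Regularity, gradient and Laplacian of a function of the normal coordinate. -/
theorem comp_normalCoordinate (hγ : IsAdmissible L γ) {ρ : ℝ} (hρ : IsTubeRadius γ ρ)
    {d : Plane → ℝ} (hd : ∀ s r, |r| < ρ → d (tube γ s r) = r) {f : ℝ → ℝ} (hf : ContDiff ℝ 2 f)
    (s₀ : ℝ) {r₀ : ℝ} (hr₀ : |r₀| < ρ) :
    ContDiffAt ℝ 2 (fun x => f (d x)) (tube γ s₀ r₀) ∧
    ∇ (fun x => f (d x)) (tube γ s₀ r₀) = deriv f r₀ • normal γ s₀ ∧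
    (Δ fun x => f (d x)) (tube γ s₀ r₀) = deriv (deriv f) r₀ -
      deriv f r₀ * curvature γ s₀ / (1 - r₀ * curvature γ s₀) := by
  have hne : ∀ {r s}, |r| < ρ → 1 - r * curvature γ s ≠ 0 := fun {r s} hr => by
    have := hρ.one_sub_ge hr.le s
    linarith
  obtain ⟨S, R, hS, hR, hS0, hR0, heq⟩ := hγ.exists_local_coordinates (hne (s := s₀) hr₀)
  set x₀ := tube γ s₀ r₀ with hx₀
  have hRρ : ∀ᶠ x in 𝓝 x₀, |R x| < ρ :=
    (continuous_abs.continuousAt.comp hR.continuousAt).eventually_lt_const (by simpa [hR0] using hr₀)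
  have hderiv : ∀ᶠ x in 𝓝 x₀, HasFDerivAt R (innerSL ℝ (normal γ (S x))) x ∧
      HasFDerivAt S ((1 - R x * curvature γ (S x))⁻¹ • innerSL ℝ (deriv γ (S x))) x := by
    filter_upwards [heq.eventually_nhds, hRρ, hS.eventually (by simp), hR.eventually (by simp)]
      with x h1 h2 h3 h4
    exact hγ.hasFDerivAt_of_tube_eq (h3.differentiableAt (by simp)) (h4.differentiableAt (by simp))
      h1 (hne h2)
  have hdR : ∀ᶠ x in 𝓝 x₀, d x = R x := by
    filter_upwards [heq, hRρ] with x h1 h2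
    conv_lhs => rw [← h1]
    exact hd _ _ h2
  set u : Plane → ℝ := fun x => f (d x) with hu
  have hfd : ∀ r, HasDerivAt f (deriv f r) r := fun r =>
    (hf.differentiable (by simp) r).hasDerivAt
  have hf1 : ContDiff ℝ 1 (deriv f) := ((contDiff_succ_iff_deriv (n := 1)).1 (by
    rw [one_add_one_eq_two]; exact hf)).2.2
  have hfdd : ∀ r, HasDerivAt (deriv f) (deriv (deriv f) r) r := fun r =>
    (hf1.differentiable (by simp) r).hasDerivAt
  -- The differential of `u` near the point. It is `C¹` because `f'`, the normal and the local
  -- coordinates are, which makes `u` a `C²` function although the coordinates are only known to be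
  -- `C¹`.
  set F : Plane → Plane →L[ℝ] ℝ := fun x => deriv f (R x) • innerSL ℝ (normal γ (S x)) with hF
  have hFd : ∀ᶠ x in 𝓝 x₀, HasFDerivAt u (F x) x := by
    filter_upwards [hderiv, hdR.eventually_nhds] with x h1 h2
    have h3 : u =ᶠ[𝓝 x] fun y => f (R y) := h2.mono fun y hy => by simp only [hu, hy]
    refine HasFDerivAt.congr_of_eventuallyEq ?_ h3
    exact (hfd (R x)).comp_hasFDerivAt x h1.1
  have hFC : ContDiffAt ℝ 1 F x₀ :=
    (hf1.contDiffAt.comp x₀ hR).smul ((innerSL ℝ (E := Plane)).contDiff.contDiffAt.comp x₀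
      (hγ.contDiff_normal.contDiffAt.comp x₀ hS))
  have hfu : fderiv ℝ u =ᶠ[𝓝 x₀] F := hFd.mono fun x hx => hx.fderiv
  refine ⟨?_, ?_, ?_⟩
  · have := (contDiffAt_succ_iff_hasFDerivAt (n := 1) (f := u) (x := x₀) (𝕜 := ℝ)).2
      ⟨F, ⟨_, hFd, fun x hx => hx⟩, hFC⟩
    exact this
  · have h1 := hfu.eq_of_nhds
    rw [gradient, h1, hF]
    simp only [hR0, hS0]
    rw [map_smul]
    congr 1
    exact (InnerProductSpace.toDual ℝ Plane).symm_apply_apply (normal γ s₀)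
  -- The Hessian is diagonal in the frame of normal and tangent; its trace is read off from the
  -- standard basis because both frame vectors have norm one.
  · have hsecond : ∀ v, fderiv ℝ (fderiv ℝ u) x₀ v v =
        deriv (deriv f) r₀ * (inner ℝ (normal γ s₀) v : ℝ) ^ 2 -
        deriv f r₀ * curvature γ s₀ / (1 - r₀ * curvature γ s₀) *
          (inner ℝ (deriv γ s₀) v : ℝ) ^ 2 := by
      intro v
      rw [hfu.fderiv_eq]
      have h1 : HasFDerivAt (fun x => F x v) ((fderiv ℝ F x₀).flip v) x₀ :=
        HasFDerivAt.congr_fderiv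
          ((hFC.differentiableAt (by simp)).hasFDerivAt.clm_apply (hasFDerivAt_const v x₀)) (by
            ext w; simp)
      obtain ⟨hR', hS'⟩ := hderiv.self_of_nhds
      rw [hS0, hR0] at hS'
      rw [hS0] at hR'
      have e1 : HasFDerivAt (fun x => deriv f (R x)) _ x₀ :=
        HasDerivAt.comp_hasFDerivAt x₀ (hfdd (R x₀)) hR'
      have e2 : HasFDerivAt (fun x => normal γ (S x)) _ x₀ :=
        (hγ.hasDerivAt_normal (S x₀)).hasFDerivAt.comp x₀ hS'
      have e3 := e1.mul (e2.inner ℝ (hasFDerivAt_const v x₀))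
      have e4 := congrArg (fun A : Plane →L[ℝ] ℝ => A v) (h1.unique e3)
      simp only [ContinuousLinearMap.flip_apply] at e4
      rw [e4]
      simp [hR0, hS0, real_inner_smul_left]
      ring
    rw [laplacian_plane, Fin.sum_univ_two, hsecond, hsecond]
    have hτ : deriv γ s₀ 0 ^ 2 + deriv γ s₀ 1 ^ 2 = 1 := by
      rw [← plane_norm_sq, hγ.unit_speed]; norm_num
    have hν : normal γ s₀ 0 ^ 2 + normal γ s₀ 1 ^ 2 = 1 := by
      rw [← plane_norm_sq, hγ.norm_normal]; norm_num
    simp only [EuclideanSpace.inner_single_right]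
    simp only [one_mul, conj_trivial]
    linear_combination deriv (deriv f) r₀ * hν -
      deriv f r₀ * curvature γ s₀ / (1 - r₀ * curvature γ s₀) * hτ

end IsAdmissible

/-! ### Separation of the plane -/

/-- The values lie in the discrete set `π + 2πℤ`; on a connected set a change would pass through a
point strictly between two of them. -/
theorem constant_of_cos_eq_neg_one {T : Set Plane} (hT : IsPreconnected T) {g : Plane → ℝ}
    (hg : ContinuousOn g T) (hcos : ∀ x ∈ T, Real.cos (g x) = -1) {a b : Plane} (ha : a ∈ T)
    (hb : b ∈ T) : g a = g b := by
  have key : ∀ a ∈ T, ∀ b ∈ T, ¬ g a < g b := by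
    intro a ha b hb hab
    have hpi := Real.pi_pos
    set v := min (g b) (g a + Real.pi) with hv
    obtain ⟨x, hx, hxv⟩ := hT.intermediate_value ha hb hg
      (show v ∈ Icc (g a) (g b) from ⟨le_min hab.le (by linarith), min_le_left _ _⟩)
    have h1 := hcos x hx
    rw [hxv, show v = g a + (v - g a) by ring, Real.cos_add, hcos a ha] at h1
    have h2 : Real.sin (g a) = 0 := by
      have := Real.sin_sq_add_cos_sq (g a)
      rw [hcos a ha] at this
      nlinarith
    rw [h2] at h1
    have h3 : Real.cos (v - g a) = 1 := by linarith
    have h4 : g a < v := lt_min hab (by linarith)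
    have h5 : v ≤ g a + Real.pi := min_le_right _ _
    have := Real.injOn_cos ⟨by linarith, by linarith⟩ ⟨le_rfl, hpi.le⟩
      (h3.trans Real.cos_zero.symm)
    linarith
  exact le_antisymm (not_lt.1 (key b hb a ha)) (not_lt.1 (key a ha b hb))

theorem isPreconnected_norm_ge_one : IsPreconnected {x : Plane | 1 ≤ ‖x‖} := by
  have hrank : 1 < Module.rank ℝ Plane := by
    rw [← Module.finrank_eq_rank]; simp
  have h1 := ((isPreconnected_sphere hrank (0 : Plane) 1).prod
    (isPreconnected_Ici (a := (1 : ℝ)))).image (fun p : Plane × ℝ => p.2 • p.1)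
    (by fun_prop)
  convert h1 using 1
  ext x
  constructor
  · intro (hx : 1 ≤ ‖x‖)
    have : ‖x‖ ≠ 0 := by linarith
    exact ⟨(‖x‖⁻¹ • x, ‖x‖), ⟨by simp [norm_smul, this], hx⟩, by simp [smul_smul, this]⟩
  · rintro ⟨⟨y, t⟩, ⟨hy, ht⟩, rfl⟩
    simp only [mem_sphere_iff_norm, sub_zero, mem_Ici] at hy ht
    simp only [mem_ofPred_eq, norm_smul, hy, mul_one, Real.norm_eq_abs]
    exact ht.trans (le_abs_self t)

theorem inside_locally_constant {Γ : Set Plane} (hΓ : IsClosed Γ) {x : Plane} (hx : x ∉ Γ) :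
    ∀ᶠ y in 𝓝 x, (y ∈ inside Γ ↔ x ∈ inside Γ) := by
  have hopen : IsOpen (connectedComponentIn Γᶜ x) := hΓ.isOpen_compl.connectedComponentIn
  filter_upwards [hopen.mem_nhds (mem_connectedComponentIn hx), hΓ.isOpen_compl.mem_nhds hx]
    with y hy hy'
  simp only [inside, mem_ofPred_eq]
  rw [connectedComponentIn_eq hy]
  exact ⟨fun h => ⟨hx, h.2⟩, fun h => ⟨hy', h.2⟩⟩

/-- The points on the positive normals. -/
def positiveSide (γ : ℝ → Plane) (ρ : ℝ) : Set Plane :=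
  {x | ∃ s r, 0 < r ∧ r < ρ ∧ tube γ s r = x}

/-- The points on the negative normals. -/
def negativeSide (γ : ℝ → Plane) (ρ : ℝ) : Set Plane :=
  {x | ∃ s r, -ρ < r ∧ r < 0 ∧ tube γ s r = x}

open Classical in
/-- The distance from the trace, signed by the side of the curve. -/
noncomputable def normalCoordinate (L : ℝ) (γ : ℝ → Plane) (ρ : ℝ) (x : Plane) : ℝ :=
  if x ∈ positiveSide γ ρ then Metric.infDist x (trace L γ) else -Metric.infDist x (trace L γ)

namespace IsAdmissible

variable {L : ℝ} {γ : ℝ → Plane} {ρ : ℝ}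

theorem isPreconnected_positiveSide (hγ : IsAdmissible L γ) :
    IsPreconnected (positiveSide γ ρ) := by
  have h := (isPreconnected_univ.prod (isPreconnected_Ioo (a := (0 : ℝ)) (b := ρ))).image
    (fun p : ℝ × ℝ => tube γ p.1 p.2) hγ.continuous_tube.continuousOn
  convert h using 1
  ext x
  constructor
  · rintro ⟨s, r, h1, h2, rfl⟩; exact ⟨(s, r), ⟨mem_univ _, h1, h2⟩, rfl⟩
  · rintro ⟨⟨s, r⟩, ⟨-, h1, h2⟩, rfl⟩; exact ⟨s, r, h1, h2, rfl⟩

theorem isPreconnected_negativeSide (hγ : IsAdmissible L γ) :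
    IsPreconnected (negativeSide γ ρ) := by
  have h := (isPreconnected_univ.prod (isPreconnected_Ioo (a := -ρ) (b := (0 : ℝ)))).image
    (fun p : ℝ × ℝ => tube γ p.1 p.2) hγ.continuous_tube.continuousOn
  convert h using 1
  ext x
  constructor
  · rintro ⟨s, r, h1, h2, rfl⟩; exact ⟨(s, r), ⟨mem_univ _, h1, h2⟩, rfl⟩
  · rintro ⟨⟨s, r⟩, ⟨-, h1, h2⟩, rfl⟩; exact ⟨s, r, h1, h2, rfl⟩

theorem tube_mem_trace_iff (hγ : IsAdmissible L γ) (hL : 0 < L) (hρ : IsTubeRadius γ ρ) {s r : ℝ}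
    (hr : |r| < ρ) : tube γ s r ∈ trace L γ ↔ r = 0 := by
  rw [hγ.isCompact_trace.isClosed.mem_iff_infDist_zero (trace_nonempty hL), hγ.infDist_tube hL hρ hr,
    abs_eq_zero]

theorem positiveSide_subset (hγ : IsAdmissible L γ) (hL : 0 < L) (hρ : IsTubeRadius γ ρ) :
    positiveSide γ ρ ⊆ (trace L γ)ᶜ := by
  rintro _ ⟨s, r, h1, h2, rfl⟩ h
  rw [hγ.tube_mem_trace_iff hL hρ (by rw [abs_of_pos h1]; exact h2)] at h
  exact h1.ne' h

theorem negativeSide_subset (hγ : IsAdmissible L γ) (hL : 0 < L) (hρ : IsTubeRadius γ ρ) :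
    negativeSide γ ρ ⊆ (trace L γ)ᶜ := by
  rintro _ ⟨s, r, h1, h2, rfl⟩ h
  rw [hγ.tube_mem_trace_iff hL hρ (by rw [abs_of_neg h2]; linarith)] at h
  exact h2.ne h

theorem normalCoordinate_tube (hγ : IsAdmissible L γ) (hL : 0 < L) (hρ : IsTubeRadius γ ρ) (s : ℝ)
    {r : ℝ} (hr : |r| < ρ) : normalCoordinate L γ ρ (tube γ s r) = r := by
  unfold normalCoordinate
  rw [hγ.infDist_tube hL hρ hr]
  split_ifs with h
  · obtain ⟨t, r', h1, h2, h3⟩ := h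
    have := (hρ.inj t s r' r (by rwa [abs_of_pos h1]) hr h3).2
    rw [← this, abs_of_pos h1]
  · have : r ≤ 0 := by
      by_contra hc
      exact h ⟨s, r, not_le.1 hc, (le_abs_self r).trans_lt hr, rfl⟩
    rw [abs_of_nonpos this, neg_neg]

theorem abs_normalCoordinate (x : Plane) :
    |normalCoordinate L γ ρ x| = Metric.infDist x (trace L γ) := by
  unfold normalCoordinate
  split_ifs
  · exact abs_of_nonneg Metric.infDist_nonneg
  · rw [abs_neg]; exact abs_of_nonneg Metric.infDist_nonneg

/-- The case `f = id` of the regularity statement for functions of the normal coordinate. -/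
theorem continuousAt_normalCoordinate (hγ : IsAdmissible L γ) (hL : 0 < L)
    (hρ : IsTubeRadius γ ρ) {x : Plane} (hx : Metric.infDist x (trace L γ) < ρ) :
    ContinuousAt (normalCoordinate L γ ρ) x := by
  obtain ⟨s, r, rfl, hr⟩ := hγ.exists_tube_eq hL x
  rw [← hr] at hx
  exact (hγ.comp_normalCoordinate hρ (fun s r => hγ.normalCoordinate_tube hL hρ s) contDiff_id
    s hx).1.continuousAt

/-- The two sides of the curve lie in different components of the complement of its trace. -/
theorem separation (hγ : IsAdmissible L γ) (hL : 0 < L) (hρ : IsTubeRadius γ ρ) {T : Set Plane}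
    (hT : IsPreconnected T) (hTΓ : T ⊆ (trace L γ)ᶜ) (hP : (T ∩ positiveSide γ ρ).Nonempty)
    (hN : (T ∩ negativeSide γ ρ).Nonempty) : False := by
  have hρ0 := hρ.pos
  set d := normalCoordinate L γ ρ with hd
  -- A clamped coordinate running from `-1` to `1` across the curve. It may jump by `2` far from the
  -- curve, but `E = e^(iπc)` does not notice this and is continuous on the whole plane.
  set c : Plane → ℝ := fun x => max (-1) (min 1 (d x / (ρ / 2))) with hc
  have hinf : ∀ x, |d x| = Metric.infDist x (trace L γ) := abs_normalCoordinate
  have hdc : ∀ x, |d x| < ρ → ContinuousAt d x := fun x hx =>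
    hγ.continuousAt_normalCoordinate hL hρ (by rwa [← hinf])
  have habs : Continuous fun x => |d x| := by
    simp_rw [hinf]; exact Metric.continuous_infDist_pt _
  have hfar : ∀ x, ρ / 2 < |d x| → c x = Real.sign (d x) := by
    intro x hx
    rcases lt_abs.1 hx with h | h
    · have h1 : 1 ≤ d x / (ρ / 2) := by rw [le_div_iff₀ (by positivity)]; linarith
      rw [Real.sign_of_pos (by linarith)]
      simp only [hc]
      rw [min_eq_left h1]; norm_num
    · have h1 : d x / (ρ / 2) ≤ -1 := by rw [div_le_iff₀ (by positivity)]; linarith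
      rw [Real.sign_of_neg (by linarith)]
      simp only [hc]
      rw [max_eq_left ((min_le_right _ _).trans h1)]
  set E : Plane → ℂ := fun x => Complex.exp (((Real.pi * c x : ℝ) : ℂ) * Complex.I) with hE
  have hEfar : ∀ x, ρ / 2 < |d x| → E x = -1 := by
    intro x hx
    simp only [hE]
    rw [hfar x hx]
    rcases Real.sign_apply_eq_of_ne_zero (d x) (by
      intro h; rw [h, abs_zero] at hx; linarith) with h | h
    · rw [h]; push_cast; rw [mul_neg, mul_one, neg_mul, Complex.exp_neg, Complex.exp_pi_mul_I]
      norm_num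
    · rw [h]; push_cast; rw [mul_one, Complex.exp_pi_mul_I]
  have hcc : ∀ x, |d x| < ρ → ContinuousAt c x := fun x hx => by
    have := hdc x hx
    exact continuousAt_const.max (continuousAt_const.min (this.div_const _))
  have hEc : Continuous E := by
    rw [continuous_iff_continuousAt]
    intro x
    by_cases hx : |d x| < ρ
    · have := hcc x hx
      exact Complex.continuous_exp.continuousAt.comp ((Complex.continuous_ofReal.continuousAt.comp
        (continuousAt_const.mul this)).mul continuousAt_const)
    · have h1 : ρ / 2 < |d x| := by linarith [not_lt.1 hx]
      have h2 : E =ᶠ[𝓝 x] fun _ => -1 :=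
        (habs.continuousAt.eventually_const_lt h1).mono fun y hy => hEfar y hy
      exact continuousAt_const.congr h2.symm
  obtain ⟨Θ, hΘc, hΘ⟩ := exists_continuous_exp_eq hEc fun x => Complex.exp_ne_zero _
  set θ : Plane → ℝ := fun x => (Θ x).im with hθ
  have hθc : Continuous θ := Complex.continuous_im.comp hΘc
  have hEnorm : ∀ x, Real.exp (Θ x).re = 1 := fun x => by
    rw [← Complex.norm_exp, hΘ]; exact Complex.norm_exp_ofReal_mul_I _
  have hcosθ : ∀ x, Real.cos (θ x) = Real.cos (Real.pi * c x) := fun x => by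
    have h1 := congrArg Complex.re (hΘ x)
    simp only [hE] at h1
    rwa [Complex.exp_re, hEnorm, one_mul, Complex.exp_ofReal_mul_I_re] at h1
  have hsinθ : ∀ x, Real.sin (θ x) = Real.sin (Real.pi * c x) := fun x => by
    have h1 := congrArg Complex.im (hΘ x)
    simp only [hE] at h1
    rwa [Complex.exp_im, hEnorm, one_mul, Complex.exp_ofReal_mul_I_im] at h1
  -- Adding `π sgn d` cancels the possible jumps of `πc` away from the curve: `g` is continuous off
  -- the trace with values in `π + 2πℤ`, so it is constant on connected sets avoiding the trace.
  set g : Plane → ℝ := fun x => θ x - Real.pi * c x + Real.pi * Real.sign (d x) with hg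
  have hd0 : ∀ x, x ∈ (trace L γ)ᶜ → d x ≠ 0 := fun x hx h => by
    have h1 := hinf x
    rw [h, abs_zero] at h1
    exact hx ((hγ.isCompact_trace.isClosed.mem_iff_infDist_zero (trace_nonempty hL)).2 h1.symm)
  have hgcos : ∀ x ∈ (trace L γ)ᶜ, Real.cos (g x) = -1 := by
    intro x hx
    simp only [hg]
    have h1 : Real.cos (θ x - Real.pi * c x) = 1 := by
      rw [Real.cos_sub, hcosθ, hsinθ, ← sq, ← sq, Real.cos_sq_add_sin_sq]
    have h2 : Real.sin (θ x - Real.pi * c x) = 0 := by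
      rw [Real.sin_sub, hcosθ, hsinθ]; ring
    rw [Real.cos_add, h1, h2]
    rcases Real.sign_apply_eq_of_ne_zero (d x) (hd0 x hx) with h | h <;> rw [h] <;> simp
  have hgc : ContinuousOn g (trace L γ)ᶜ := by
    intro x hx
    refine ContinuousAt.continuousWithinAt ?_
    by_cases hx' : |d x| < ρ
    · have h1 : (fun y => Real.sign (d y)) =ᶠ[𝓝 x] fun _ => Real.sign (d x) := by
        rcases lt_or_gt_of_ne (hd0 x hx) with h | h
        · filter_upwards [(hdc x hx').eventually_lt_const h] with y hy
          rw [Real.sign_of_neg hy, Real.sign_of_neg h]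
        · filter_upwards [(hdc x hx').eventually_const_lt h] with y hy
          rw [Real.sign_of_pos hy, Real.sign_of_pos h]
      have h2 := hcc x hx'
      exact (hθc.continuousAt.sub (continuousAt_const.mul h2)).add
        (continuousAt_const.mul (continuousAt_const.congr h1.symm))
    · have h1 : ρ / 2 < |d x| := by linarith [not_lt.1 hx']
      refine hθc.continuousAt.congr ?_
      filter_upwards [habs.continuousAt.eventually_const_lt h1] with y hy
      simp only [hg]
      rw [hfar y hy]; ring
  set U := T ∪ positiveSide γ ρ ∪ negativeSide γ ρ with hU
  obtain ⟨xp, hxpT, hxpP⟩ := hP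
  obtain ⟨xn, hxnT, hxnN⟩ := hN
  have hUpre : IsPreconnected U :=
    IsPreconnected.union xn (Or.inl hxnT) hxnN
      (IsPreconnected.union xp hxpT hxpP hT hγ.isPreconnected_positiveSide)
      hγ.isPreconnected_negativeSide
  have hUΓ : U ⊆ (trace L γ)ᶜ := union_subset
    (union_subset hTΓ (hγ.positiveSide_subset hL hρ)) (hγ.negativeSide_subset hL hρ)
  have hconst : ∀ a ∈ U, ∀ b ∈ U, g a = g b := fun a ha b hb =>
    constant_of_cos_eq_neg_one hUpre (hgc.mono hUΓ) (fun x hx => hgcos x (hUΓ hx)) ha hb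
  set k := g xp with hk
  -- On a normal line `θ - πc` is continuous across the curve, whereas constancy of `g` on both
  -- sides would force a jump of `2π`.
  have hline : ContinuousAt (fun r => θ (tube γ 0 r) - Real.pi * c (tube γ 0 r)) 0 := by
    have h1 : Continuous fun r => tube γ 0 r :=
      hγ.continuous_tube.comp (Continuous.prodMk_right (0 : ℝ))
    have h2 : ContinuousAt c (tube γ 0 0) := hcc _ (by
      rw [hd, hγ.normalCoordinate_tube hL hρ 0 (by simpa using hρ0)]; simpa using hρ0)
    exact (hθc.comp h1).continuousAt.sub (continuousAt_const.mul
      (ContinuousAt.comp (f := fun r => tube γ 0 r) h2 h1.continuousAt))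
  have hpos : ∀ r, 0 < r → r < ρ → θ (tube γ 0 r) - Real.pi * c (tube γ 0 r) = k - Real.pi := by
    intro r h1 h2
    have h3 := hconst _ (Or.inl (Or.inr ⟨0, r, h1, h2, rfl⟩)) xp (Or.inl (Or.inl hxpT))
    have h4 : d (tube γ 0 r) = r :=
      hγ.normalCoordinate_tube hL hρ 0 (by rwa [abs_of_pos h1])
    simp only [hg, h4, Real.sign_of_pos h1] at h3
    simp only [hk, hg]
    linarith
  have hneg : ∀ r, -ρ < r → r < 0 → θ (tube γ 0 r) - Real.pi * c (tube γ 0 r) = k + Real.pi := by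
    intro r h1 h2
    have h3 := hconst _ (Or.inr ⟨0, r, h1, h2, rfl⟩) xp (Or.inl (Or.inl hxpT))
    have h4 : d (tube γ 0 r) = r :=
      hγ.normalCoordinate_tube hL hρ 0 (by rw [abs_of_neg h2]; linarith)
    simp only [hg, h4, Real.sign_of_neg h2] at h3
    simp only [hk, hg]
    linarith
  have l1 : Tendsto (fun r => θ (tube γ 0 r) - Real.pi * c (tube γ 0 r)) (𝓝[>] 0)
      (𝓝 (k - Real.pi)) := by
    refine tendsto_const_nhds.congr' ?_
    filter_upwards [Ioo_mem_nhdsGT hρ0] with r hr using (hpos r hr.1 hr.2).symm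
  have l2 : Tendsto (fun r => θ (tube γ 0 r) - Real.pi * c (tube γ 0 r)) (𝓝[<] 0)
      (𝓝 (k + Real.pi)) := by
    refine tendsto_const_nhds.congr' ?_
    filter_upwards [Ioo_mem_nhdsLT (neg_lt_zero.2 hρ0)] with r hr using (hneg r hr.1 hr.2).symm
  have m1 := tendsto_nhds_unique l1 (hline.tendsto.mono_left nhdsWithin_le_nhds)
  have m2 := tendsto_nhds_unique l2 (hline.tendsto.mono_left nhdsWithin_le_nhds)
  have := Real.pi_pos
  linarith

end IsAdmissible

/-! ### The signed distance -/

namespace IsAdmissible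

variable {L : ℝ} {γ : ℝ → Plane} {ρ : ℝ}

theorem tube_zero_apply_one (hb : StartsAtBottom γ) (r : ℝ) : tube γ 0 r 1 = γ 0 1 + r := by
  simp [tube, normal, hb.tangent_zero]

theorem trace_subset_disk (hγ : IsAdmissible L γ) : trace L γ ⊆ disk := by
  rintro _ ⟨s, -, rfl⟩; exact hγ.mem_disk s

/-- The downward ray from the lowest point of the curve. -/
theorem ray_subset (hγ : IsAdmissible L γ) (hL : 0 < L) (hb : StartsAtBottom γ) :
    tube γ 0 '' Iio 0 ⊆ (trace L γ)ᶜ := by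
  rintro _ ⟨r, hr, rfl⟩ h
  rw [hγ.trace_eq_range hL] at h
  obtain ⟨s, hs⟩ := h
  have h1 := hb.le s
  rw [hs, tube_zero_apply_one hb] at h1
  have : r < 0 := hr
  linarith

theorem isPreconnected_ray (hγ : IsAdmissible L γ) : IsPreconnected (tube γ 0 '' Iio 0) :=
  isPreconnected_Iio.image _
    (hγ.continuous_tube.comp (Continuous.prodMk_right (0 : ℝ))).continuousOn

theorem abs_apply_one_le_norm (v : Plane) : |v 1| ≤ ‖v‖ := by
  have := PiLp.norm_apply_le v 1
  rwa [Real.norm_eq_abs] at this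

theorem exists_ray_norm_ge (hb : StartsAtBottom γ) (M : ℝ) :
    ∃ r < 0, M ≤ ‖tube γ 0 r‖ := by
  refine ⟨-(|M| + |γ 0 1| + 1), by have := abs_nonneg M; have := abs_nonneg (γ 0 1); linarith, ?_⟩
  refine le_trans ?_ (abs_apply_one_le_norm _)
  rw [tube_zero_apply_one hb]
  have h1 := le_abs_self M
  have h2 := le_abs_self (γ 0 1)
  have h3 := neg_le_abs (γ 0 1 + -(|M| + |γ 0 1| + 1))
  linarith

theorem ray_mem_negativeSide (hρ : IsTubeRadius γ ρ) :
    tube γ 0 (-(ρ / 2)) ∈ negativeSide γ ρ ∩ tube γ 0 '' Iio 0 := by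
  have := hρ.pos
  exact ⟨⟨0, _, by linarith, by linarith, rfl⟩, ⟨_, by simpa using this, rfl⟩⟩

/-- At the lowest point the negative normal is a downward ray that never meets the trace, so the
whole negative side is connected to infinity. -/
theorem not_mem_inside_of_negativeSide (hγ : IsAdmissible L γ) (hL : 0 < L)
    (hb : StartsAtBottom γ) (hρ : IsTubeRadius γ ρ) {x : Plane} (hx : x ∈ negativeSide γ ρ) :
    x ∉ inside (trace L γ) := by
  rintro ⟨-, hbdd⟩
  have hT : IsPreconnected (negativeSide γ ρ ∪ tube γ 0 '' Iio 0) :=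
    IsPreconnected.union _ (ray_mem_negativeSide hρ).1 (ray_mem_negativeSide hρ).2
      hγ.isPreconnected_negativeSide hγ.isPreconnected_ray
  have hsub := hT.subset_connectedComponentIn (Or.inl hx)
    (union_subset (hγ.negativeSide_subset hL hρ) (hγ.ray_subset hL hb))
  obtain ⟨M, hM⟩ := hbdd.exists_norm_le
  obtain ⟨r, hr, hr'⟩ := exists_ray_norm_ge hb (M + 1)
  have := hM _ (hsub (Or.inr ⟨r, hr, rfl⟩))
  linarith

/-- An unbounded component would reach the complement of the disk, then the downward ray, then the
negative side, contradicting `separation`. -/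
theorem mem_inside_of_positiveSide (hγ : IsAdmissible L γ) (hL : 0 < L)
    (hb : StartsAtBottom γ) (hρ : IsTubeRadius γ ρ) {x : Plane} (hx : x ∈ positiveSide γ ρ) :
    x ∈ inside (trace L γ) := by
  have hxΓ := hγ.positiveSide_subset hL hρ hx
  refine ⟨hxΓ, ?_⟩
  by_contra hbdd
  obtain ⟨y, hy, hy1⟩ : ∃ y ∈ connectedComponentIn (trace L γ)ᶜ x, 1 ≤ ‖y‖ := by
    by_contra hcon
    push Not at hcon
    exact hbdd (isBounded_iff_forall_norm_le.2 ⟨1, fun y hy => (hcon y hy).le⟩)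
  obtain ⟨r, hr, hr1⟩ := exists_ray_norm_ge hb 1
  have h1 : IsPreconnected (connectedComponentIn (trace L γ)ᶜ x ∪ {z : Plane | 1 ≤ ‖z‖}) :=
    IsPreconnected.union y hy hy1 isPreconnected_connectedComponentIn isPreconnected_norm_ge_one
  have h2 := IsPreconnected.union (tube γ 0 r) (Or.inr hr1) (mem_image_of_mem _ hr) h1 hγ.isPreconnected_ray
  refine hγ.separation hL hρ h2 (union_subset (union_subset
    (connectedComponentIn_subset _ _) ?_) (hγ.ray_subset hL hb))
    ⟨x, Or.inl (Or.inl (mem_connectedComponentIn hxΓ)), hx⟩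
    ⟨_, Or.inr (ray_mem_negativeSide hρ).2, (ray_mem_negativeSide hρ).1⟩
  intro z hz hzΓ
  have h3 := hγ.trace_subset_disk hzΓ
  rw [disk, mem_ball_zero_iff] at h3
  have h4 : 1 ≤ ‖z‖ := hz
  linarith

theorem signedDist_tube (hγ : IsAdmissible L γ) (hL : 0 < L) (hb : StartsAtBottom γ)
    (hρ : IsTubeRadius γ ρ) (s r : ℝ) (hr : |r| < ρ) :
    signedDist (trace L γ) (tube γ s r) = r := by
  unfold signedDist
  rw [hγ.infDist_tube hL hρ hr]
  rcases lt_trichotomy r 0 with h | h | h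
  · rw [if_neg (hγ.not_mem_inside_of_negativeSide hL hb hρ
      ⟨s, r, by rw [abs_of_neg h] at hr; linarith, h, rfl⟩), abs_of_neg h, neg_neg]
  · subst h; simp
  · rw [if_pos (hγ.mem_inside_of_positiveSide hL hb hρ
      ⟨s, r, h, by rwa [abs_of_pos h] at hr, rfl⟩), abs_of_pos h]

end IsAdmissible

theorem signedDist_eq_neg_of_norm_ge_one {Γ : Set Plane} (hΓ : Γ ⊆ disk) {x : Plane}
    (hx : 1 ≤ ‖x‖) : signedDist Γ x = -Metric.infDist x Γ := by
  have hsub : {z : Plane | 1 ≤ ‖z‖} ⊆ Γᶜ := by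
    intro z hz hzΓ
    have h3 := hΓ hzΓ
    rw [disk, mem_ball_zero_iff] at h3
    have h4 : 1 ≤ ‖z‖ := hz
    linarith
  unfold signedDist
  rw [if_neg]
  rintro ⟨-, hb⟩
  obtain ⟨M, hM⟩ := (hb.subset (isPreconnected_norm_ge_one.subset_connectedComponentIn hx
    hsub)).exists_norm_le
  have h1 := hM (EuclideanSpace.single 0 (|M| + 1)) (by
    simp only [mem_ofPred_eq, PiLp.norm_single, Real.norm_eq_abs]
    rw [abs_of_pos (by positivity)]
    linarith [abs_nonneg M])
  rw [PiLp.norm_single, Real.norm_eq_abs, abs_of_pos (by positivity)] at h1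
  linarith [le_abs_self M]

/-! ### Regularity and boundary values of the recovery function -/

/-- Away from the transition layer, the recovery function is locally constant. -/
theorem recovery_locally_constant {Γ : Set Plane} (hΓ : IsClosed Γ)
    {η : ℝ → ℝ} (hη : IsCutoff η) {δ ε : ℝ} (hδ : 0 < δ) {x : Plane}
    (hx : δ < Metric.infDist x Γ) :
    ∃ c : ℝ, c ^ 2 = 1 ∧ recovery Γ η δ ε =ᶠ[𝓝 x] fun _ => c := by
  have hxΓ : x ∉ Γ := fun h => by
    rw [Metric.infDist_zero_of_mem h] at hx; linarith
  have hfar := (Metric.continuous_infDist_pt Γ).continuousAt.eventually_const_lt hx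
  by_cases hin : x ∈ inside Γ
  · refine ⟨1, by norm_num, ?_⟩
    filter_upwards [inside_locally_constant hΓ hxΓ, hfar] with y h1 h2
    unfold recovery signedDist
    rw [if_pos (h1.2 hin), qCut_eq_one hη hδ h2.le]
  · refine ⟨-1, by norm_num, ?_⟩
    filter_upwards [inside_locally_constant hΓ hxΓ, hfar] with y h1 h2
    unfold recovery signedDist
    rw [if_neg (mt h1.1 hin), qCut_eq_neg_one hη hδ (by linarith)]

theorem laplacian_of_eventuallyEq_const {u : Plane → ℝ} {x : Plane} {c : ℝ}
    (h : u =ᶠ[𝓝 x] fun _ => c) : ∇ u x = 0 ∧ (Δ u) x = 0 := by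
  constructor
  · rw [gradient, h.fderiv_eq]; simp
  · rw [laplacian_plane, h.fderiv.fderiv_eq]
    simp

namespace IsAdmissible

variable {L : ℝ} {γ : ℝ → Plane} {ρ : ℝ} {η : ℝ → ℝ} {δ : ℝ}

theorem recovery_eq_tube (hγ : IsAdmissible L γ) (hL : 0 < L) (hb : StartsAtBottom γ)
    (hρ : IsTubeRadius γ ρ) (hη : IsCutoff η) (hδ : 0 < δ) (ε s : ℝ) {r : ℝ} (hr : |r| < ρ) :
    recovery (trace L γ) η δ ε (tube γ s r) = qCut η δ ε r ∧
    ContDiffAt ℝ 2 (recovery (trace L γ) η δ ε) (tube γ s r) ∧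
    ∇ (recovery (trace L γ) η δ ε) (tube γ s r) = deriv (qCut η δ ε) r • normal γ s ∧
    (Δ (recovery (trace L γ) η δ ε)) (tube γ s r) = deriv (deriv (qCut η δ ε)) r -
      deriv (qCut η δ ε) r * curvature γ s / (1 - r * curvature γ s) := by
  refine ⟨?_, hγ.comp_normalCoordinate hρ (hγ.signedDist_tube hL hb hρ)
    (contDiff_infty.1 (contDiff_qCut hη hδ) 2) s hr⟩
  unfold recovery
  rw [hγ.signedDist_tube hL hb hρ s r hr]

theorem contDiff_recovery (hγ : IsAdmissible L γ) (hL : 0 < L) (hb : StartsAtBottom γ)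
    (hρ : IsTubeRadius γ ρ) (hη : IsCutoff η) (hδ : 0 < δ) (hδρ : δ < ρ) (ε : ℝ) :
    ContDiff ℝ 2 (recovery (trace L γ) η δ ε) := by
  rw [contDiff_iff_contDiffAt]
  intro x
  obtain ⟨s, r, rfl, hr⟩ := hγ.exists_tube_eq hL x
  by_cases h : |r| < ρ
  · exact (hγ.recovery_eq_tube hL hb hρ hη hδ ε s h).2.1
  · obtain ⟨c, -, hc⟩ := recovery_locally_constant (ε := ε) hγ.isCompact_trace.isClosed
      hη hδ (x := tube γ s r) (by linarith [not_lt.1 h])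
    exact contDiffAt_const.congr_of_eventuallyEq hc

end IsAdmissible

theorem recovery_mem_Icc (Γ : Set Plane) {η : ℝ → ℝ} (hη : IsCutoff η) (δ ε : ℝ) (x : Plane) :
    recovery Γ η δ ε x ∈ Icc (-1 : ℝ) 1 :=
  abs_le.1 (abs_qCut_le_one hη _)

theorem recovery_boundary {Γ : Set Plane} (hΓ : IsClosed Γ) (hΓd : Γ ⊆ disk)
    {η : ℝ → ℝ} (hη : IsCutoff η) {δ : ℝ} (hδ : 0 < δ) (ε : ℝ)
    (hdist : ∀ x : Plane, 1 ≤ ‖x‖ → δ < Metric.infDist x Γ) {x : Plane} (hx : ‖x‖ = 1) :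
    recovery Γ η δ ε x = -1 ∧ inner ℝ (∇ (recovery Γ η δ ε) x) x = 0 := by
  have h1 := hdist x hx.ge
  constructor
  · unfold recovery
    rw [signedDist_eq_neg_of_norm_ge_one hΓd hx.ge, qCut_eq_neg_one hη hδ (by linarith)]
  · obtain ⟨c, -, hc⟩ := recovery_locally_constant (ε := ε) hΓ hη hδ h1
    rw [(laplacian_of_eventuallyEq_const hc).1, inner_zero_left]

theorem exists_infDist_gt {Γ : Set Plane} (hΓ : IsCompact Γ) (hΓn : Γ.Nonempty) (hΓd : Γ ⊆ disk) :
    ∃ ρ, 0 < ρ ∧ ∀ x : Plane, 1 ≤ ‖x‖ → ρ ≤ Metric.infDist x Γ := by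
  obtain ⟨a, ha, hmax⟩ := hΓ.exists_isMaxOn hΓn continuous_norm.continuousOn
  have h1 : ‖a‖ < 1 := by have := hΓd ha; rwa [disk, mem_ball_zero_iff] at this
  refine ⟨1 - ‖a‖, by linarith, fun x hx => ?_⟩
  rw [Metric.le_infDist hΓn]
  intro y hy
  have h2 : ‖y‖ ≤ ‖a‖ := hmax hy
  have h3 := norm_sub_norm_le x y
  rw [dist_eq_norm]
  linarith

/-! ### Integration in normal coordinates -/

theorem measurePreserving_coordinates :
    MeasurePreserving ((MeasurableEquiv.toLp 2 (Fin 2 → ℝ)).symm.trans MeasurableEquiv.finTwoArrow)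
      (volume : Measure Plane) (volume : Measure (ℝ × ℝ)) :=
  (volume_preserving_finTwoArrow ℝ).comp (PiLp.volume_preserving_ofLp (Fin 2))

namespace IsAdmissible

variable {L : ℝ} {γ : ℝ → Plane} {ρ δ : ℝ}

theorem image_Ico (hγ : IsAdmissible L γ) (hL : 0 < L) : γ '' Ico 0 L = trace L γ := by
  rw [hγ.trace_eq_range hL]
  refine Subset.antisymm (image_subset_range _ _) ?_
  rintro _ ⟨s, rfl⟩
  obtain ⟨t, ht, h⟩ := hγ.closed.exists_mem_Ico₀ hL s
  exact ⟨t, ht, h.symm⟩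

/-- Integrals of functions supported in a tubular neighbourhood, in normal coordinates. -/
theorem integral_disk_eq (hγ : IsAdmissible L γ) (hL : 0 < L) (hρ : IsTubeRadius γ ρ)
    (hδρ : δ < ρ) (hdist : ∀ x : Plane, 1 ≤ ‖x‖ → δ < Metric.infDist x (trace L γ))
    {F : Plane → ℝ} (hF : ∀ x, δ < Metric.infDist x (trace L γ) → F x = 0) {H : ℝ × ℝ → ℝ}
    (hFH : ∀ s, ∀ r ∈ Icc (-δ) δ, (1 - r * curvature γ s) * F (tube γ s r) = H (s, r))
    (hH : ContinuousOn H (univ ×ˢ Icc (-δ) δ)) (hδ : 0 < δ) :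
    ∫ x in disk, F x = ∫ r in (-δ)..δ, ∫ s in (0 : ℝ)..L, H (s, r) := by
  -- The half-open period makes the coordinates injective on `S`, while the closed layer `|r| ≤ δ`
  -- is still covered.
  set S : Set Plane := {p | p 0 ∈ Ico 0 L ∧ p 1 ∈ Icc (-δ) δ} with hS
  set e := (MeasurableEquiv.toLp 2 (Fin 2 → ℝ)).symm.trans MeasurableEquiv.finTwoArrow with he
  have hSe : S = e ⁻¹' (Ico 0 L ×ˢ Icc (-δ) δ) := by
    ext p; simp [hS, he]
  have hSm : MeasurableSet S := by
    rw [hSe]; exact e.measurable (measurableSet_Ico.prod measurableSet_Icc)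
  set Φ : Plane → Plane := fun p => tube γ (p 0) (p 1) with hΦ
  have habs : ∀ r ∈ Icc (-δ) δ, |r| < ρ := fun r hr => (abs_le.2 hr).trans_lt hδρ
  have himage : Φ '' S = {x | Metric.infDist x (trace L γ) ≤ δ} := by
    ext x
    constructor
    · rintro ⟨p, ⟨-, h2⟩, rfl⟩
      change Metric.infDist (tube γ (p 0) (p 1)) (trace L γ) ≤ δ
      rw [hγ.infDist_tube hL hρ (habs _ h2)]
      exact abs_le.2 h2
    · intro hx
      obtain ⟨s, r, rfl, hr⟩ := hγ.exists_tube_eq hL x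
      have hr' : |r| ≤ δ := by rw [hr]; exact hx
      have hp : Function.Periodic (fun s => tube γ s r) L := fun s => by
        simp only [tube, hγ.closed s, hγ.periodic_normal s]
      obtain ⟨t, ht, h⟩ := hp.exists_mem_Ico₀ hL s
      refine ⟨!₂[t, r], ⟨by simpa using ht, by simpa using abs_le.1 hr'⟩, ?_⟩
      simpa [hΦ] using h.symm
  have hinj : InjOn Φ S := by
    rintro p ⟨hp0, hp1⟩ p' ⟨hp0', hp1'⟩ h
    obtain ⟨h1, h2⟩ := hρ.inj _ _ _ _ (habs _ hp1) (habs _ hp1') h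
    exact plane_ext (hγ.simple hp0 hp0' h1) h2
  have hsub : Φ '' S ⊆ disk := by
    rw [himage]
    intro x hx
    by_contra hcon
    rw [disk, mem_ball_zero_iff, not_lt] at hcon
    have h1 := hdist x hcon
    have h2 : Metric.infDist x (trace L γ) ≤ δ := hx
    linarith
  have h1 : ∫ x in disk, F x = ∫ x in Φ '' S, F x := by
    refine setIntegral_eq_of_subset_of_forall_sdiff_eq_zero measurableSet_ball hsub ?_
    intro x hx
    apply hF
    have := hx.2
    rw [himage, mem_ofPred_eq, not_le] at this
    exact this
  have h2 : ∫ x in Φ '' S, F x = ∫ p in S, H (e p) := by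
    rw [integral_image_eq_integral_abs_det_fderiv_smul volume hSm
      (fun p _ => (hγ.hasFDerivAt_tube p).hasFDerivWithinAt) hinj]
    refine setIntegral_congr_fun hSm fun p hp => ?_
    have h3 := hρ.one_sub_ge (habs _ hp.2).le (p 0)
    simp only [smul_eq_mul]
    rw [hγ.det_tubeDeriv, abs_of_pos (by linarith)]
    exact hFH _ _ hp.2
  rw [h1, h2, hSe, measurePreserving_coordinates.setIntegral_preimage_emb e.measurableEmbedding]
  have hint : IntegrableOn H (Ico 0 L ×ˢ Icc (-δ) δ) volume := by
    have : IntegrableOn H (Icc 0 L ×ˢ Icc (-δ) δ) volume :=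
      (hH.mono (prod_mono (subset_univ _) le_rfl)).integrableOn_compact
        (isCompact_Icc.prod isCompact_Icc)
    exact this.mono_set (prod_mono Ico_subset_Icc_self le_rfl)
  rw [IntegrableOn, Measure.volume_eq_prod, ← Measure.prod_restrict] at hint
  rw [Measure.volume_eq_prod, ← Measure.prod_restrict, integral_prod_symm _ hint,
    intervalIntegral.integral_of_le (by linarith), integral_Icc_eq_integral_Ioc]
  congr 1
  ext r
  rw [intervalIntegral.integral_of_le hL.le, integral_Ico_eq_integral_Ioc]

/-! ### The length measure of the trace -/

theorem lipschitzWith (hγ : IsAdmissible L γ) : LipschitzWith 1 γ :=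
  lipschitzWith_of_nnnorm_deriv_le hγ.differentiable fun s => by
    rw [← NNReal.coe_le_coe, coe_nnnorm, hγ.unit_speed]; rfl

/-- On parameter pieces of length `h` the curve is so nearly straight that its inverse is
`k`-Lipschitz. The countably many pieces have disjoint images, and their estimates add up. -/
theorem volume_le_mul_hausdorffMeasure (hγ : IsAdmissible L γ) (hL : 0 < L) {A : Set ℝ}
    (hA : MeasurableSet A) (hAL : A ⊆ Ico 0 L) {k : NNReal} (hk : 1 < k) :
    volume A ≤ k * (Measure.hausdorffMeasure 1 : Measure Plane) (γ '' A) := by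
  obtain ⟨K, hK0, hK⟩ := hγ.exists_curvature_bound hL
  have hk1 : (1 : ℝ) < k := by exact_mod_cast hk
  set h : ℝ := (1 - (k : ℝ)⁻¹) / K with hh
  have hkinv : (k : ℝ)⁻¹ < 1 := inv_lt_one_of_one_lt₀ hk1
  have hh0 : 0 < h := div_pos (by linarith) hK0
  set B : ℤ → Set ℝ := fun n => A ∩ {s | ⌊s / h⌋ = n} with hB
  have hBm : ∀ n, MeasurableSet (B n) := fun n =>
    hA.inter ((Int.measurable_floor.comp (measurable_id.div_const h)) (measurableSet_singleton n))
  have hBA : A = ⋃ n, B n := by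
    ext s; simp [hB]
  have hBsub : ∀ n, B n ⊆ Ico 0 L := fun n => inter_subset_left.trans hAL
  have hdisj : Pairwise (fun m n => Disjoint (B m) (B n)) := by
    intro m n hmn
    rw [Set.disjoint_left]
    rintro s ⟨-, h1⟩ ⟨-, h2⟩
    exact hmn (h1.symm.trans h2)
  have hchord : ∀ n, ∀ s ∈ B n, ∀ t ∈ B n, |s - t| ≤ k * ‖γ s - γ t‖ := by
    intro n s hs t ht
    have e1 : ⌊s / h⌋ = ⌊t / h⌋ := hs.2.trans ht.2.symm
    have e2 := Int.abs_sub_lt_one_of_floor_eq_floor e1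
    rw [← sub_div, abs_div, abs_of_pos hh0, div_lt_one hh0] at e2
    have e3 := hγ.norm_sub_sub_smul_le hK s t
    have e4 : |s - t| ≤ ‖γ s - γ t‖ + K * |s - t| * |s - t| := by
      have := norm_sub_norm_le ((s - t) • deriv γ t) (γ s - γ t)
      rw [norm_smul, hγ.unit_speed, mul_one, Real.norm_eq_abs,
        norm_sub_rev ((s - t) • deriv γ t)] at this
      linarith
    have e5 : K * |s - t| ≤ 1 - (k : ℝ)⁻¹ := by
      calc K * |s - t| ≤ K * h := by gcongr
        _ = _ := by rw [hh]; field_simp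
    have e6 : (k : ℝ)⁻¹ * |s - t| ≤ ‖γ s - γ t‖ := by
      nlinarith [abs_nonneg (s - t)]
    rwa [inv_mul_le_iff₀ (by linarith)] at e6
  set g := Function.invFunOn γ (Ico 0 L) with hg
  have hgγ : ∀ s ∈ Ico 0 L, g (γ s) = s := fun s hs => hγ.simple.leftInvOn_invFunOn hs
  have hpiece : ∀ n, volume (B n) ≤ k * (Measure.hausdorffMeasure 1 : Measure Plane) (γ '' B n) := by
    intro n
    have hlip : LipschitzOnWith k g (γ '' B n) := by
      apply LipschitzOnWith.of_dist_le_mul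
      rintro _ ⟨s, hs, rfl⟩ _ ⟨t, ht, rfl⟩
      rw [hgγ s (hBsub n hs), hgγ t (hBsub n ht), Real.dist_eq, dist_eq_norm]
      exact hchord n s hs t ht
    have h1 := hlip.hausdorffMeasure_image_le (d := 1) zero_le_one
    have h2 : g '' (γ '' B n) = B n := by
      rw [image_image]
      ext s
      constructor
      · rintro ⟨t, ht, rfl⟩; simpa only [hgγ t (hBsub n ht)] using ht
      · intro hs; exact ⟨s, hs, hgγ s (hBsub n hs)⟩
    rw [h2, hausdorffMeasure_real] at h1
    simpa using h1
  have himg : ∀ n, MeasurableSet (γ '' B n) := fun n =>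
    (hBm n).image_of_continuousOn_injOn hγ.continuous.continuousOn (hγ.simple.mono (hBsub n))
  have hdisj' : Pairwise (fun m n => Disjoint (γ '' B m) (γ '' B n)) := by
    intro m n hmn
    rw [Set.disjoint_left]
    rintro _ ⟨s, hs, rfl⟩ ⟨t, ht, hts⟩
    have := hγ.simple (hBsub n ht) (hBsub m hs) hts
    rw [this] at ht
    exact Set.disjoint_left.1 (hdisj hmn) hs ht
  calc volume A = ∑' n, volume (B n) := by
        conv_lhs => rw [hBA]
        exact measure_iUnion hdisj hBm
    _ ≤ ∑' n, k * (Measure.hausdorffMeasure 1 : Measure Plane) (γ '' B n) :=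
        ENNReal.tsum_le_tsum hpiece
    _ = k * ∑' n, (Measure.hausdorffMeasure 1 : Measure Plane) (γ '' B n) := ENNReal.tsum_mul_left
    _ = k * (Measure.hausdorffMeasure 1 : Measure Plane) (γ '' A) := by
        rw [← measure_iUnion hdisj' himg, ← image_iUnion, ← hBA]

/-- One inequality holds because unit speed is `1`-Lipschitz, the other by letting `k ↓ 1`. -/
theorem hausdorffMeasure_image (hγ : IsAdmissible L γ) (hL : 0 < L) {A : Set ℝ}
    (hA : MeasurableSet A) (hAL : A ⊆ Ico 0 L) :
    (Measure.hausdorffMeasure 1 : Measure Plane) (γ '' A) = volume A := by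
  apply le_antisymm
  · have := hγ.lipschitzWith.hausdorffMeasure_image_le (d := 1) zero_le_one A
    rw [hausdorffMeasure_real] at this
    simpa using this
  · have hlim : Tendsto (fun k : NNReal => (k : ENNReal) *
        (Measure.hausdorffMeasure 1 : Measure Plane) (γ '' A)) (𝓝[>] 1)
        (𝓝 (((1 : NNReal) : ENNReal) * (Measure.hausdorffMeasure 1 : Measure Plane) (γ '' A))) :=
      ENNReal.Tendsto.mul_const
        ((ENNReal.continuous_coe.tendsto _).mono_left nhdsWithin_le_nhds) (Or.inl (by simp))
    rw [ENNReal.coe_one, one_mul] at hlim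
    refine ge_of_tendsto hlim ?_
    filter_upwards [self_mem_nhdsWithin] with k hk
    exact hγ.volume_le_mul_hausdorffMeasure hL hA hAL hk

theorem map_restrict_volume (hγ : IsAdmissible L γ) (hL : 0 < L) :
    Measure.map γ (volume.restrict (Ico 0 L)) =
      (Measure.hausdorffMeasure 1 : Measure Plane).restrict (trace L γ) := by
  ext B hB
  have hm := hγ.continuous.measurable
  rw [Measure.map_apply hm hB, Measure.restrict_apply (hm hB), Measure.restrict_apply hB,
    ← hγ.image_Ico hL, ← image_preimage_inter,
    hγ.hausdorffMeasure_image hL ((hm hB).inter measurableSet_Ico) inter_subset_right]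

theorem integral_trace (hγ : IsAdmissible L γ) (hL : 0 < L) {ξ : Plane → ℝ}
    (hξ : ContinuousOn ξ disk) :
    ∫ x in trace L γ, ξ x ∂(Measure.hausdorffMeasure 1) = ∫ s in (0 : ℝ)..L, ξ (γ s) := by
  have h1 : AEStronglyMeasurable ξ
      ((Measure.hausdorffMeasure 1 : Measure Plane).restrict (trace L γ)) :=
    (hξ.mono hγ.trace_subset_disk).aestronglyMeasurable hγ.isCompact_trace.measurableSet
  rw [← hγ.map_restrict_volume hL] at h1 ⊢
  rw [integral_map hγ.continuous.measurable.aemeasurable h1,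
    intervalIntegral.integral_of_le hL.le, integral_Ico_eq_integral_Ioc]

end IsAdmissible

/-! ### The recovery sequence -/

/-- Clamping `r` reduces to an integrand continuous on the whole plane. -/
theorem continuousOn_integral_of_continuousOn {L δ : ℝ} (hδ : 0 < δ) {H : ℝ × ℝ → ℝ}
    (hH : ContinuousOn H (univ ×ˢ Icc (-δ) δ)) :
    ContinuousOn (fun r => ∫ s in (0 : ℝ)..L, H (s, r)) (Icc (-δ) δ) := by
  set clamp : ℝ → ℝ := fun r => max (-δ) (min r δ) with hclamp
  have hc : Continuous fun p : ℝ × ℝ => H (p.2, clamp p.1) := by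
    rw [← continuousOn_univ]
    refine hH.comp (f := fun p : ℝ × ℝ => (p.2, clamp p.1)) (by fun_prop) fun p _ =>
      ⟨mem_univ _, le_max_left _ _, max_le (by linarith) (min_le_right _ _)⟩
  have h1 : Continuous fun r => ∫ s in (0 : ℝ)..L, H (s, clamp r) :=
    intervalIntegral.continuous_parametric_intervalIntegral_of_continuous' hc 0 L
  refine h1.continuousOn.congr fun r hr => ?_
  have : clamp r = r := by simp only [hclamp]; rw [min_eq_left hr.2, max_eq_right hr.1]
  simp only [this]

theorem energyDensity_nonneg {ε : ℝ} (hε : 0 < ε) (u : Plane → ℝ) (x : Plane) :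
    0 ≤ energyDensity ε u x := by
  unfold energyDensity W; positivity

theorem continuous_energyDensity {ε : ℝ} {u : Plane → ℝ} (hu : ContDiff ℝ 2 u) :
    Continuous (energyDensity ε u) := by
  unfold energyDensity
  have h1 : Continuous (∇ u) :=
    (InnerProductSpace.toDual ℝ Plane).symm.continuous.comp (hu.continuous_fderiv (by simp))
  have h2 := continuous_W.comp hu.continuous
  simp only [Function.comp_def] at h2
  fun_prop

theorem integral_interfaceMeasure {ε : ℝ} (hε : 0 < ε) {u : Plane → ℝ} (hu : ContDiff ℝ 2 u)
    (ξ : Plane → ℝ) :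
    ∫ x, ξ x ∂(interfaceMeasure ε u) = 1 / c₀ * ∫ x in disk, energyDensity ε u x * ξ x := by
  unfold interfaceMeasure
  have hc := continuous_energyDensity (ε := ε) hu
  rw [integral_withDensity_eq_integral_toReal_smul (by fun_prop)
    (Eventually.of_forall fun x => ENNReal.ofReal_lt_top), ← integral_const_mul]
  congr 1
  ext x
  have := c₀_pos
  rw [ENNReal.toReal_ofReal (mul_nonneg (by positivity) (energyDensity_nonneg hε u x)), smul_eq_mul]
  ring

/-- The exponential wins against any power, as seen after the substitution `1/ε`. -/
theorem tendsto_rpow_mul_sq {f : ℝ → ℝ} {c : ℝ} (hc : 0 < c)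
    (hf : f =O[𝓝[>] 0] fun ε => Real.exp (-c / ε)) (α : ℝ) :
    Tendsto (fun ε => ε ^ (-α) * f ε ^ 2) (𝓝[>] 0) (𝓝 0) := by
  have h1 : (fun ε => ε ^ (-α) * f ε ^ 2) =O[𝓝[>] 0]
      fun ε => ε ^ (-α) * Real.exp (-c / ε) ^ 2 := (isBigO_refl _ _).mul (hf.pow 2)
  refine h1.trans_tendsto ?_
  have h2 := (tendsto_rpow_mul_exp_neg_mul_atTop_nhds_zero α (2 * c) (by positivity)).comp
    (tendsto_inv_nhdsGT_zero (𝕜 := ℝ))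
  refine h2.congr' ?_
  filter_upwards [self_mem_nhdsWithin] with ε hε
  have hε : 0 < ε := hε
  simp only [Function.comp_apply]
  rw [Real.inv_rpow hε.le, Real.rpow_neg hε.le, ← Real.exp_nat_mul]
  congr 2
  push_cast
  ring

theorem tendsto_of_sub_isBigO_sq {f : ℝ → ℝ} {B : ℝ}
    (hf : (fun ε => f ε - B) =O[𝓝[>] 0] fun ε => ε ^ 2) : Tendsto f (𝓝[>] 0) (𝓝 B) := by
  have h : Tendsto (fun ε : ℝ => ε ^ 2) (𝓝[>] 0) (𝓝 0) :=
    ((continuous_pow 2).tendsto' 0 0 (by simp)).mono_left nhdsWithin_le_nhds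
  have := (hf.trans_tendsto h).add_const B
  simpa using this

theorem tendsto_totalEnergy {L B : ℝ} {u : ℝ → Plane → ℝ} {c c' : ℝ} (hc : 0 < c) (hc' : 0 < c')
    (hL : (fun ε => diffuseLength ε (u ε) - L) =O[𝓝[>] 0] fun ε => Real.exp (-c / ε))
    (hT : (fun ε => diffuseWinding ε (u ε) - 2 * Real.pi) =O[𝓝[>] 0]
      fun ε => Real.exp (-c' / ε))
    (hB : (fun ε => diffuseElastica ε (u ε) - B) =O[𝓝[>] 0] fun ε => ε ^ 2) (α β : ℝ) :
    Tendsto (fun ε => totalEnergy L α β ε (u ε)) (𝓝[>] 0) (𝓝 B) := by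
  have := ((tendsto_of_sub_isBigO_sq hB).add (tendsto_rpow_mul_sq hc hL α)).add
    (tendsto_rpow_mul_sq hc' hT β)
  simpa [totalEnergy] using this

/-! ### Reduction of the functionals to one-dimensional integrals -/

/-- A curve with an injective tubular neighbourhood of radius `ρ` in the disk, together with a
cut-off at scale `δ < ρ`. -/
structure RecoveryData (L : ℝ) (γ : ℝ → Plane) (ρ δ : ℝ) (η : ℝ → ℝ) : Prop where
  length_pos : 0 < L
  admissible : IsAdmissible L γ
  startsAtBottom : StartsAtBottom γ
  tubeRadius : IsTubeRadius γ ρ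
  cutoff : IsCutoff η
  pos : 0 < δ
  lt : δ < ρ
  lt_infDist : ∀ x : Plane, 1 ≤ ‖x‖ → δ < Metric.infDist x (trace L γ)

namespace RecoveryData

variable {L ρ δ : ℝ} {γ : ℝ → Plane} {η : ℝ → ℝ}

theorem abs_lt (D : RecoveryData L γ ρ δ η) {r : ℝ} (hr : r ∈ Icc (-δ) δ) : |r| < ρ :=
  (abs_le.2 hr).trans_lt D.lt

theorem one_sub_ne_zero (D : RecoveryData L γ ρ δ η) {r : ℝ} (hr : r ∈ Icc (-δ) δ) (s : ℝ) :
    1 - r * curvature γ s ≠ 0 := by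
  have := D.tubeRadius.one_sub_ge (D.abs_lt hr).le s
  linarith

theorem tube_mem_disk (D : RecoveryData L γ ρ δ η) (s : ℝ) {r : ℝ} (hr : r ∈ Icc (-δ) δ) :
    tube γ s r ∈ disk := by
  by_contra hcon
  rw [disk, mem_ball_zero_iff, not_lt] at hcon
  have h1 := D.lt_infDist _ hcon
  rw [D.admissible.infDist_tube D.length_pos D.tubeRadius (D.abs_lt hr)] at h1
  have := abs_le.2 hr
  linarith

theorem energyDensity_tube (D : RecoveryData L γ ρ δ η) (ε s : ℝ) {r : ℝ} (hr : r ∈ Icc (-δ) δ) :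
    energyDensity ε (recovery (trace L γ) η δ ε) (tube γ s r) = profileEnergy η δ ε r := by
  obtain ⟨h1, -, h2, -⟩ := D.admissible.recovery_eq_tube D.length_pos D.startsAtBottom D.tubeRadius
    D.cutoff D.pos ε s (D.abs_lt hr)
  unfold energyDensity profileEnergy
  rw [h1, h2, norm_smul, D.admissible.norm_normal, mul_one, Real.norm_eq_abs, sq_abs]

theorem diffuseCurvature_tube (D : RecoveryData L γ ρ δ η) (ε s : ℝ) {r : ℝ}
    (hr : r ∈ Icc (-δ) δ) :
    diffuseCurvature ε (recovery (trace L γ) η δ ε) (tube γ s r) = profileDefect η δ ε r +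
      ε * deriv (qCut η δ ε) r * curvature γ s / (1 - r * curvature γ s) := by
  obtain ⟨h1, -, -, h2⟩ := D.admissible.recovery_eq_tube D.length_pos D.startsAtBottom D.tubeRadius
    D.cutoff D.pos ε s (D.abs_lt hr)
  unfold diffuseCurvature profileDefect
  rw [h1, h2]
  ring

theorem norm_gradient_tube (D : RecoveryData L γ ρ δ η) {ε : ℝ} (hε : 0 < ε) (s : ℝ) {r : ℝ}
    (hr : r ∈ Icc (-δ) δ) :
    ‖∇ (recovery (trace L γ) η δ ε) (tube γ s r)‖ = deriv (qCut η δ ε) r := by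
  obtain ⟨-, -, h2, -⟩ := D.admissible.recovery_eq_tube D.length_pos D.startsAtBottom D.tubeRadius
    D.cutoff D.pos ε s (D.abs_lt hr)
  rw [h2, norm_smul, D.admissible.norm_normal, mul_one, Real.norm_eq_abs,
    abs_of_nonneg (deriv_qCut_nonneg D.cutoff D.pos hε r)]

theorem densities_eq_zero (D : RecoveryData L γ ρ δ η) (ε : ℝ) {x : Plane}
    (hx : δ < Metric.infDist x (trace L γ)) :
    energyDensity ε (recovery (trace L γ) η δ ε) x = 0 ∧
    diffuseCurvature ε (recovery (trace L γ) η δ ε) x = 0 := by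
  obtain ⟨c, hc, h⟩ := recovery_locally_constant (ε := ε) D.admissible.isCompact_trace.isClosed
    D.cutoff D.pos hx
  obtain ⟨h1, h2⟩ := laplacian_of_eventuallyEq_const h
  constructor
  · unfold energyDensity W
    rw [h1, h.eq_of_nhds, hc]
    simp
  · unfold diffuseCurvature
    rw [h2, h.eq_of_nhds, deriv_W, show c ^ 3 - c = c * (c ^ 2 - 1) by ring, hc]
    simp

/-- The length of the parallel curve at distance `r` for `|r| ≤ δ`, by the Umlaufsatz. -/
theorem integral_one_sub (D : RecoveryData L γ ρ δ η) (r : ℝ) :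
    ∫ s in (0 : ℝ)..L, (1 - r * curvature γ s) = L - 2 * Real.pi * r := by
  have hk := D.admissible.continuous_curvature
  rw [intervalIntegral.integral_sub (by simp) (Continuous.intervalIntegrable (by fun_prop) _ _),
    intervalIntegral.integral_const_mul, D.admissible.integral_curvature D.length_pos
    D.startsAtBottom]
  simp
  ring

theorem integral_energyDensity_mul (D : RecoveryData L γ ρ δ η) (ε : ℝ) {ξ : Plane → ℝ}
    (hξ : ContinuousOn ξ disk) :
    ∫ x in disk, energyDensity ε (recovery (trace L γ) η δ ε) x * ξ x =
      ∫ r in (-δ)..δ, profileEnergy η δ ε r *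
        ∫ s in (0 : ℝ)..L, ξ (tube γ s r) * (1 - r * curvature γ s) := by
  have hk := D.admissible.continuous_curvature
  have hξt : ContinuousOn (fun p : ℝ × ℝ => ξ (tube γ p.1 p.2)) (univ ×ˢ Icc (-δ) δ) :=
    hξ.comp D.admissible.continuous_tube.continuousOn fun p hp => D.tube_mem_disk _ hp.2
  have he := continuous_profileEnergy D.cutoff D.pos ε
  rw [D.admissible.integral_disk_eq D.length_pos D.tubeRadius D.lt D.lt_infDist
    (H := fun p => profileEnergy η δ ε p.2 * (ξ (tube γ p.1 p.2) * (1 - p.2 * curvature γ p.1)))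
    (fun x hx => by rw [(D.densities_eq_zero ε hx).1, zero_mul])
    (fun s r hr => by rw [D.energyDensity_tube ε s hr]; ring)
    (ContinuousOn.mul (by fun_prop) (hξt.mul (by fun_prop))) D.pos]
  simp only [intervalIntegral.integral_const_mul]

/-- The test function may be unbounded near the circle: the measures live on a fixed compact tube
inside the disk. -/
theorem tendsto_interfaceMeasure (D : RecoveryData L γ ρ δ η) {ξ : Plane → ℝ}
    (hξ : ContinuousOn ξ disk) :
    Tendsto (fun ε => ∫ x, ξ x ∂(interfaceMeasure ε (recovery (trace L γ) η δ ε))) (𝓝[>] 0)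
      (𝓝 (∫ x in trace L γ, ξ x ∂(Measure.hausdorffMeasure 1))) := by
  have hk := D.admissible.continuous_curvature
  have hξt : ContinuousOn (fun p : ℝ × ℝ => ξ (tube γ p.1 p.2)) (univ ×ˢ Icc (-δ) δ) :=
    hξ.comp D.admissible.continuous_tube.continuousOn fun p hp => D.tube_mem_disk _ hp.2
  have h := tendsto_integral_profileEnergy_mul D.cutoff D.pos
    (continuousOn_integral_of_continuousOn (L := L) D.pos
      (H := fun p => ξ (tube γ p.1 p.2) * (1 - p.2 * curvature γ p.1)) (hξt.mul (by fun_prop)))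
  rw [D.admissible.integral_trace D.length_pos hξ]
  simp only [tube_zero, zero_mul, sub_zero, mul_one] at h
  refine h.congr' ?_
  filter_upwards [self_mem_nhdsWithin] with ε hε
  rw [integral_interfaceMeasure hε (D.admissible.contDiff_recovery D.length_pos D.startsAtBottom
    D.tubeRadius D.cutoff D.pos D.lt ε), D.integral_energyDensity_mul ε hξ]

theorem diffuseLength_isBigO (D : RecoveryData L γ ρ δ η) :
    ∃ c, 0 < c ∧ (fun ε => diffuseLength ε (recovery (trace L γ) η δ ε) - L) =O[𝓝[>] 0]
      fun ε => Real.exp (-c / ε) := by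
  obtain ⟨c, hc, h⟩ := profileLength_isBigO D.cutoff D.pos L (2 * Real.pi)
  refine ⟨c, hc, h.congr_left fun ε => ?_⟩
  have := D.integral_energyDensity_mul ε (ξ := fun _ => 1) continuousOn_const
  simp only [mul_one, one_mul, D.integral_one_sub] at this
  rw [diffuseLength, this]

theorem diffuseWinding_isBigO (D : RecoveryData L γ ρ δ η) :
    ∃ c, 0 < c ∧ (fun ε => diffuseWinding ε (recovery (trace L γ) η δ ε) - 2 * Real.pi)
      =O[𝓝[>] 0] fun ε => Real.exp (-c / ε) := by
  obtain ⟨c, hc, h⟩ := profileWinding_isBigO D.cutoff D.pos L (2 * Real.pi)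
  refine ⟨c, hc, h.congr' ?_ EventuallyEq.rfl⟩
  filter_upwards [self_mem_nhdsWithin] with ε hε
  have hk := D.admissible.continuous_curvature
  have ha := continuous_profileDefect D.cutoff D.pos ε
  have hf := continuous_deriv_qCut (ε := ε) D.cutoff D.pos
  rw [diffuseWinding, D.admissible.integral_disk_eq D.length_pos D.tubeRadius D.lt D.lt_infDist
    -- The Jacobian cancels the denominator of the curvature term, so the winding density is affine
    -- in `κ`.
    (H := fun p => profileDefect η δ ε p.2 * deriv (qCut η δ ε) p.2 * (1 - p.2 * curvature γ p.1) +
      ε * deriv (qCut η δ ε) p.2 ^ 2 * curvature γ p.1)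
    (fun x hx => by rw [(D.densities_eq_zero ε hx).2, zero_mul])
    (fun s r hr => by
      rw [D.diffuseCurvature_tube ε s hr, D.norm_gradient_tube hε s hr]
      have := D.one_sub_ne_zero hr s
      field_simp)
    (by fun_prop) D.pos]
  congr 2
  apply intervalIntegral.integral_congr
  intro r _
  simp only
  rw [intervalIntegral.integral_add (Continuous.intervalIntegrable (by fun_prop) _ _)
    (Continuous.intervalIntegrable (by fun_prop) _ _), intervalIntegral.integral_const_mul,
    intervalIntegral.integral_const_mul, D.integral_one_sub,
    D.admissible.integral_curvature D.length_pos D.startsAtBottom]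
  ring

theorem diffuseElastica_isBigO (D : RecoveryData L γ ρ δ η) :
    (fun ε => diffuseElastica ε (recovery (trace L γ) η δ ε) - elastica L γ)
      =O[𝓝[>] 0] fun ε => ε ^ 2 := by
  have hk := D.admissible.continuous_curvature
  have hne : ∀ p ∈ (univ : Set ℝ) ×ˢ Icc (-δ) δ, 1 - p.2 * curvature γ p.1 ≠ 0 :=
    fun p hp => D.one_sub_ne_zero hp.2 _
  have hquot : ∀ n : ℕ, ContinuousOn
      (fun p : ℝ × ℝ => curvature γ p.1 ^ n / (1 - p.2 * curvature γ p.1))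
      (univ ×ˢ Icc (-δ) δ) := fun n => ContinuousOn.div (by fun_prop) (by fun_prop) hne
  have hquot_s : ∀ n : ℕ, ∀ r ∈ Icc (-δ) δ, Continuous
      (fun s => curvature γ s ^ n / (1 - r * curvature γ s)) := fun n r hr =>
    Continuous.div (by fun_prop) (by fun_prop) fun s => D.one_sub_ne_zero hr s
  have hA := continuousOn_integral_of_continuousOn (L := L) D.pos (hquot 2)
  obtain ⟨M, hM⟩ := isCompact_Icc.exists_bound_of_continuousOn
    (continuousOn_integral_of_continuousOn (L := L) D.pos (hquot 4))
  -- The geometric expansion `κ²/(1 - rκ) = κ² + κ³ r + r² κ⁴/(1 - rκ)` with exact remainder.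
  have hexp : ∀ r ∈ Icc (-δ) δ, (∫ s in (0 : ℝ)..L, curvature γ s ^ 2 / (1 - r * curvature γ s)) =
      elastica L γ + (∫ s in (0 : ℝ)..L, curvature γ s ^ 3) * r +
        r ^ 2 * ∫ s in (0 : ℝ)..L, curvature γ s ^ 4 / (1 - r * curvature γ s) := by
    intro r hr
    have h4 := hquot_s 4 r hr
    unfold elastica
    simp_rw [D.admissible.norm_deriv_deriv_sq]
    rw [← intervalIntegral.integral_mul_const, ← intervalIntegral.integral_const_mul,
      ← intervalIntegral.integral_add (Continuous.intervalIntegrable (by fun_prop) _ _)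
      (Continuous.intervalIntegrable (by fun_prop) _ _),
      ← intervalIntegral.integral_add (Continuous.intervalIntegrable (by fun_prop) _ _)
      (Continuous.intervalIntegrable (by fun_prop) _ _)]
    congr 1
    ext s
    have := D.one_sub_ne_zero hr s
    rw [div_eq_iff this, add_mul, mul_assoc (r ^ 2), div_mul_cancel₀ _ this]
    ring
  have h := profileElastica_isBigO D.cutoff D.pos L (2 * Real.pi) hA hexp hM
  refine h.congr' ?_ EventuallyEq.rfl
  filter_upwards [self_mem_nhdsWithin] with ε hε
  have hε0 : ε ≠ 0 := (show 0 < ε from hε).ne'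
  have ha := continuous_profileDefect D.cutoff D.pos ε
  have hf := continuous_deriv_qCut (ε := ε) D.cutoff D.pos
  rw [diffuseElastica, D.admissible.integral_disk_eq D.length_pos D.tubeRadius D.lt D.lt_infDist
    -- With `f = q_ε'`, this is `(1 - rκ)/ε · (a + ε f κ/(1 - rκ))²` multiplied out.
    (H := fun p => profileDefect η δ ε p.2 * (profileDefect η δ ε p.2 / ε) *
        (1 - p.2 * curvature γ p.1) +
      2 * (profileDefect η δ ε p.2 * deriv (qCut η δ ε) p.2) * curvature γ p.1 +
      ε * deriv (qCut η δ ε) p.2 ^ 2 * (curvature γ p.1 ^ 2 / (1 - p.2 * curvature γ p.1)))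
    (fun x hx => by rw [(D.densities_eq_zero ε hx).2]; simp)
    (fun s r hr => by
      rw [D.diffuseCurvature_tube ε s hr]
      have := D.one_sub_ne_zero hr s
      field_simp
      ring)
    (ContinuousOn.add (by fun_prop) (ContinuousOn.mul (by fun_prop) (hquot 2))) D.pos]
  congr 2
  apply intervalIntegral.integral_congr
  intro r hr
  rw [uIcc_of_le (by linarith [D.pos])] at hr
  have h2 := hquot_s 2 r hr
  simp only
  rw [intervalIntegral.integral_add (Continuous.intervalIntegrable (by fun_prop) _ _)
    (Continuous.intervalIntegrable (by fun_prop) _ _),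
    intervalIntegral.integral_add (Continuous.intervalIntegrable (by fun_prop) _ _)
    (Continuous.intervalIntegrable (by fun_prop) _ _), intervalIntegral.integral_const_mul,
    intervalIntegral.integral_const_mul, intervalIntegral.integral_const_mul, D.integral_one_sub,
    D.admissible.integral_curvature D.length_pos D.startsAtBottom]
  ring

end RecoveryData

/-- Every admissible curve has a parametrization and a tube radius that provide recovery data
for all cut-offs. -/
theorem IsAdmissible.exists_recoveryData {L : ℝ} {γ : ℝ → Plane} (hγ : IsAdmissible L γ)
    (hL : 0 < L) : ∃ β ρ, 0 < ρ ∧ trace L β = trace L γ ∧ elastica L β = elastica L γ ∧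
      ∃ ρ', ∀ η, IsCutoff η → ∀ δ, 0 < δ → δ < ρ → RecoveryData L β ρ' δ η := by
  obtain ⟨β, hβ, hb, htr, hel⟩ := hγ.exists_startsAtBottom hL
  obtain ⟨ρ', hρ'⟩ := hβ.exists_isTubeRadius hL
  obtain ⟨ρ, hρ, hdist⟩ := exists_infDist_gt hβ.isCompact_trace (trace_nonempty hL)
    hβ.trace_subset_disk
  exact ⟨β, min ρ ρ', lt_min hρ hρ'.pos, htr, hel, ρ', fun η hη δ hδ hδρ =>
    ⟨hL, hβ, hb, hρ', hη, hδ, hδρ.trans_le (min_le_right _ _),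
      fun x hx => (hδρ.trans_le (min_le_left _ _)).trans_le (hdist x hx)⟩⟩

end PhaseField

/-! ### Conclusion -/

theorem lemma4p1 (L : ℝ) (hL : 0 < L) (γ : ℝ → PhaseField.Plane)
    (hγ : PhaseField.IsAdmissible L γ) :
    ∃ δ₀ : ℝ, 0 < δ₀ ∧ ∀ η : ℝ → ℝ, PhaseField.IsCutoff η → ∀ δ : ℝ, 0 < δ → δ < δ₀ →
      ∃ u : ℝ → PhaseField.Plane → ℝ,
        -- the phase fields are the explicit ones
        u = PhaseField.recovery (PhaseField.trace L γ) η δ ∧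
        -- regularity, range and boundary conditions
        (∀ ε : ℝ, 0 < ε →
          ContDiff ℝ 2 (u ε) ∧ (∀ x, u ε x ∈ Icc (-1 : ℝ) 1) ∧
          ∀ x, ‖x‖ = 1 → u ε x = -1 ∧ inner ℝ (∇ (u ε) x) x = 0) ∧
        -- convergence of the diffuse interface measures
        (∀ ξ : PhaseField.Plane → ℝ, ContinuousOn ξ PhaseField.disk →
          Tendsto (fun ε => ∫ x, ξ x ∂(PhaseField.interfaceMeasure ε (u ε))) (𝓝[>] 0)
            (𝓝 (∫ x in PhaseField.trace L γ, ξ x ∂(Measure.hausdorffMeasure 1)))) ∧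
        -- exponentially small errors of length and winding number
        (∃ c : ℝ, 0 < c ∧
          (fun ε => PhaseField.diffuseLength ε (u ε) - L) =O[𝓝[>] 0]
            fun ε => Real.exp (-c / ε)) ∧
        (∃ c : ℝ, 0 < c ∧
          (fun ε => PhaseField.diffuseWinding ε (u ε) - 2 * Real.pi) =O[𝓝[>] 0]
            fun ε => Real.exp (-c / ε)) ∧
        -- quadratic error of the elastica energy
        ((fun ε => PhaseField.diffuseElastica ε (u ε) - PhaseField.elastica L γ) =O[𝓝[>] 0]
          fun ε => ε ^ 2) ∧
        -- convergence of the total energy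
        ∀ α β : ℝ, 0 < α → 0 < β →
          Tendsto (fun ε => PhaseField.totalEnergy L α β ε (u ε)) (𝓝[>] 0)
            (𝓝 (PhaseField.elastica L γ)) := by

  obtain ⟨β, δ₀, hδ₀, htr, hel, ρ, hD⟩ := hγ.exists_recoveryData hL
  refine ⟨δ₀, hδ₀, fun η hη δ hδ hδδ₀ => ⟨_, rfl, ?_⟩⟩
  have D := hD η hη δ hδ hδδ₀
  -- The curve enters only through its trace and its elastica energy, so the normalized
  -- parametrization may replace it.
  rw [← htr, ← hel]
  obtain ⟨c, hc, hlen⟩ := D.diffuseLength_isBigO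
  obtain ⟨c', hc', hwind⟩ := D.diffuseWinding_isBigO
  have hβ := D.admissible
  refine ⟨fun ε _ => ⟨?_, PhaseField.recovery_mem_Icc _ hη δ ε, fun x hx => ?_⟩,
    fun ξ hξ => D.tendsto_interfaceMeasure hξ, ⟨c, hc, hlen⟩, ⟨c', hc', hwind⟩,
    D.diffuseElastica_isBigO, fun α β _ _ =>
      PhaseField.tendsto_totalEnergy hc hc' hlen hwind D.diffuseElastica_isBigO α β⟩
  · exact hβ.contDiff_recovery hL D.startsAtBottom D.tubeRadius hη hδ D.lt ε
  · exact PhaseField.recovery_boundary hβ.isCompact_trace.isClosed hβ.trace_subset_disk hη hδ ε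
      D.lt_infDist hx
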